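/- **Noncrossing matchings.** A noncrossing matching of size $n$ is a perfect matching of the points $1,\dots,2n$ on a line by $n$ pairwise noncrossing arches drawn above the line; $\mathrm{NC}_n$ is the set of these. Write $()_n$ for the matching consisting of $n$ nested arches, $\sigma\pi$ for concatenation, $(\pi)_k$ for $\pi$ surrounded by $k$ nested arches, and $\rho$ for the rotation: $i,j$ are connected in $\rho(\pi)$ iff $i-1,j-1$ are connected in $\pi$ (labels modulo $2n$). For $1\le j\le 2n$ the matching $e_j(\pi)$ is obtained from $\pi$ by connecting $j$ with $j+1$ (modulo $2n$) and the former partners of $j$ and $j+1$ with each other. The Young diagram $\lambda(\pi)$ is the region between the lattice path consisting of $n$ north steps followed by $n$ east steps and the lattice path whose $i$-th step is north if $i$ is the left endpoint of an arch of $\pi$ and east otherwise. The box in row $r$ (from the top) and column $c$ has label $n+c-r$. Write $\sigma\le\pi$ if $\lambda(\sigma)\subseteq\lambda(\pi)$, and $\sigma\nearrow_j\pi$ if $\lambda(\pi)$ is $\lambda(\sigma)$ with one box of label $j$ added. **Polynomials.** Let $q=e^{2\pi i/3}$. On polynomials in $z_1,\dots,z_{2n}$ (indices modulo $2n$) let $S_k$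 exchange $z_k$ and $z_{k+1}$, and let $$\mathbf D_k f=\frac{q z_k-q^{-1}z_{k+1}}{z_{k+1}-z_k}\,(S_kf-f)\qquad(k\in\mathbb Z).$$ Let $(\Psi_\pi)_{\pi\in \mathrm{NC}_n}$ be the family of polynomials with $$\Psi_{()_n}=(q-q^{-1})^{-n(n-1)}\prod_{1\le i<j\le n}(qz_i-q^{-1}z_j)(qz_{n+i}-q^{-1}z_{n+j})$$ and $$\Psi_\pi=\mathbf D_j(\Psi_\sigma)-\sum_{\tau\in e_j^{-1}(\sigma)\setminus\{\sigma,\pi\}}\Psi_\tau\qquad\text{whenever }\sigma\nearrow_j\pi .$$ For $\pi\in\mathrm{NC}_n$ the polynomial $D_\pi$ is obtained from $\Psi_{()_n}$ by reading the boxes of $\lambda(\pi)$ row by row from top to bottom, each row from left to right, and applying successively $\mathbf D_{n+c-r}$ for the box in row $r$ and column $c$. For $\pi_1\in\mathrm{NC}_{n_1}$, $\pi_2\in\mathrm{NC}_{n_2}$ and $n=n_1+n_2$ the polynomial $D_{\pi_1,\pi_2}$ in $z_1,\dots,z_{2n}$ is obtained from $D_{(\pi_1)_{n_2}}$ by reading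 the boxes of $\lambda(\pi_2)$ in the same order and applying successively $\mathbf D_{c-r}$. **Theorem.** Let $\pi_1\in\mathrm{NC}_{n_1}$, $\pi_2\in\mathrm{NC}_{n_2}$, $n=n_1+n_2$. The family $(\Psi_\pi)_{\pi\in\mathrm{NC}_n}$ exists and is unique, and the polynomial $$\Psi_{\rho^{n_2}(\pi_1\pi_2)}(z_1,\dots,z_{2n})=\Psi_{\pi_1\pi_2}(z_{n_2+1},\dots,z_{2n},z_1,\dots,z_{n_2})$$ is a linear combination, with coefficients in $\mathbb Q(q)$, of the polynomials $D_{\tau_1,\tau_2}$ with $\tau_1\in\mathrm{NC}_{n_1}$, $\tau_2\in\mathrm{NC}_{n_2}$, $\tau_1\le\pi_1$ and $\tau_2\le\pi_2$, in which the coefficient of $D_{\pi_1,\pi_2}$ is $1$. -/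

import Mathlib

/-- A noncrossing matching of size `n`: `2 * n` points on a line, numbered from left to right
(the point labelled `k` is the element `k - 1` of `Fin (2 * n)`), matched in pairs (`partner`)
by pairwise noncrossing arches. -/
@[ext]
structure NCMatching (n : ℕ) where
  partner : Fin (2 * n) → Fin (2 * n)
  partner_partner : ∀ i, partner (partner i) = i
  partner_ne : ∀ i, partner i ≠ i
  noncrossing : ∀ i j, i < j → j < partner i → partner j < partner i

namespace NCMatching

variable {n : ℕ}

noncomputable instance : Fintype (NCMatching n) :=
  Fintype.ofInjective NCMatching.partner fun _ _ h => NCMatching.ext h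

theorem partner_eq_iff (π : NCMatching n) (i j : Fin (2 * n)) :
    π.partner i = j ↔ π.partner j = i := by
  constructor <;> rintro rfl <;> exact π.partner_partner _

theorem partner_inj (π : NCMatching n) {i j : Fin (2 * n)} :
    π.partner i = π.partner j ↔ i = j := by
  rw [partner_eq_iff, partner_partner, eq_comm]

/-- The matching `()ₙ` of `n` nested arches. -/
def nested (n : ℕ) : NCMatching n where
  partner := Fin.rev
  partner_partner := Fin.rev_rev
  partner_ne i h := by
    have := congrArg Fin.val h
    rw [Fin.val_rev] at this
    omega
  noncrossing i j hij _ := Fin.rev_lt_rev.2 hij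

/-- The concatenation `σπ`. -/
def concat {m : ℕ} (σ : NCMatching m) (π : NCMatching n) : NCMatching (m + n) where
  partner i :=
    if h : (i : ℕ) < 2 * m then ⟨σ.partner ⟨i, h⟩, by omega⟩
    else ⟨2 * m + π.partner ⟨i - 2 * m, by omega⟩, by omega⟩
  partner_partner i := by
    by_cases h : (i : ℕ) < 2 * m
    · simp [h, σ.partner_partner]
    · simp only [h, dite_false]
      ext
      simp [π.partner_partner]
      omega
  partner_ne i := by
    by_cases h : (i : ℕ) < 2 * m
    · have := σ.partner_ne ⟨i, h⟩
      simp only [h, dite_true, Ne, Fin.ext_iff] at this ⊢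
      exact this
    · have := π.partner_ne ⟨i - 2 * m, by omega⟩
      simp only [h, dite_false, Ne, Fin.ext_iff] at this ⊢
      omega
  noncrossing i j hij hj := by
    by_cases h : (i : ℕ) < 2 * m <;> by_cases h' : (j : ℕ) < 2 * m
    · have := σ.noncrossing ⟨i, h⟩ ⟨j, h'⟩
      simp only [h, h', dite_true, Fin.lt_def] at hij hj this ⊢
      exact this hij hj
    · simp only [h, dite_true, Fin.lt_def] at hj
      omega
    · simp only [Fin.lt_def] at hij
      omega
    · have := π.noncrossing ⟨i - 2 * m, by omega⟩ ⟨j - 2 * m, by omega⟩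
      simp only [h, h', dite_false, Fin.lt_def] at hij hj this ⊢
      omega

/-- The matching `(π)ₖ`: `π` surrounded by `k` nested arches. -/
def nest (π : NCMatching n) (k : ℕ) : NCMatching (n + k) where
  partner i :=
    if h : k ≤ (i : ℕ) ∧ (i : ℕ) < 2 * n + k then
      ⟨k + π.partner ⟨i - k, by omega⟩, by omega⟩
    else i.rev
  partner_partner i := by
    by_cases h : k ≤ (i : ℕ) ∧ (i : ℕ) < 2 * n + k
    · have h' : (π.partner ⟨i - k, by omega⟩ : ℕ) < 2 * n := Fin.is_lt _
      have h2 : k + (π.partner ⟨i - k, by omega⟩ : ℕ) < 2 * n + k := by omega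
      ext
      simp [h, h2, π.partner_partner]
    · have h2 : ¬ (k ≤ (i.rev : ℕ) ∧ (i.rev : ℕ) < 2 * n + k) := by
        rw [Fin.val_rev]
        omega
      simp only [dif_neg h, dif_neg h2, Fin.rev_rev]
  partner_ne i := by
    by_cases h : k ≤ (i : ℕ) ∧ (i : ℕ) < 2 * n + k
    · have := π.partner_ne ⟨i - k, by omega⟩
      simp only [dif_pos h, Ne, Fin.ext_iff] at this ⊢
      omega
    · simp only [dif_neg h, Ne, Fin.ext_iff, Fin.val_rev]
      omega
  noncrossing i j hij hj := by
    by_cases h : k ≤ (i : ℕ) ∧ (i : ℕ) < 2 * n + k <;>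
      by_cases h' : k ≤ (j : ℕ) ∧ (j : ℕ) < 2 * n + k
    · have := π.noncrossing ⟨i - k, by omega⟩ ⟨j - k, by omega⟩
      simp only [dif_pos h, dif_pos h', Fin.lt_def] at hij hj this ⊢
      omega
    · simp only [dif_pos h, dif_neg h', Fin.lt_def, Fin.val_rev] at hij hj ⊢
      omega
    · have := (π.partner ⟨j - k, by omega⟩).is_lt
      simp only [dif_neg h, dif_pos h', Fin.lt_def, Fin.val_rev] at hij hj ⊢
      omega
    · simp only [dif_neg h, dif_neg h', Fin.lt_def, Fin.val_rev] at hij hj ⊢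
      omega

theorem val_finRotate {N : ℕ} (i : Fin N) :
    (finRotate N i : ℕ) = if (i : ℕ) + 1 = N then 0 else (i : ℕ) + 1 := by
  obtain _ | N := N
  · exact i.elim0
  · rw [coe_finRotate]
    simp [Fin.ext_iff]

theorem between_iff (π : NCMatching n) (i j : Fin (2 * n)) (h : j ≠ i) (h' : j ≠ π.partner i) :
    (((i : ℕ) < j ∧ (j : ℕ) < π.partner i) ∨ ((π.partner i : ℕ) < j ∧ (j : ℕ) < i)) ↔
      (((i : ℕ) < π.partner j ∧ (π.partner j : ℕ) < π.partner i) ∨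
        ((π.partner i : ℕ) < π.partner j ∧ (π.partner j : ℕ) < i)) := by
  have key : ∀ i j : Fin (2 * n), j ≠ i → j ≠ π.partner i → (i : ℕ) < j →
      (j : ℕ) < π.partner i → (i : ℕ) < π.partner j ∧ (π.partner j : ℕ) < π.partner i := by
    intro i j h h' h1 h2
    refine ⟨?_, π.noncrossing i j h1 h2⟩
    by_contra h3
    have h4 : π.partner j ≠ i := by
      rintro rfl
      exact h' (π.partner_partner j).symm
    have h5 := π.noncrossing (π.partner j) i (by rw [Fin.lt_def]; omega)
      (by rw [π.partner_partner]; exact h1)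
    rw [π.partner_partner, Fin.lt_def] at h5
    omega
  have e1 := π.partner_partner i
  have e2 := π.partner_partner j
  have h1 : π.partner j ≠ i := by
    rintro rfl
    exact h' e2.symm
  have h2 : π.partner j ≠ π.partner i := fun h3 => h (π.partner_inj.1 h3)
  have k1 := key i j h h'
  have k2 := key i (π.partner j) h1 h2
  have k3 := key (π.partner i) j h' (by rwa [e1])
  have k4 := key (π.partner i) (π.partner j) h2 (by rwa [e1])
  rw [e1] at k3 k4
  rw [e2] at k2 k4
  constructor
  · rintro (⟨h5, h6⟩ | ⟨h5, h6⟩)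
    · exact Or.inl (k1 h5 h6)
    · exact Or.inr (k3 h5 h6)
  · rintro (⟨h5, h6⟩ | ⟨h5, h6⟩)
    · exact Or.inl (k2 h5 h6)
    · exact Or.inr (k4 h5 h6)

/-- The rotation `ρ`: `i` and `j` are connected in `ρ(π)` iff `i - 1` and `j - 1` are
connected in `π`, cyclically. -/
def rotate (π : NCMatching n) : NCMatching n where
  partner i := finRotate (2 * n) (π.partner ((finRotate (2 * n)).symm i))
  partner_partner i := by
    rw [Equiv.symm_apply_apply, π.partner_partner, Equiv.apply_symm_apply]
  partner_ne i h := by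
    rw [← Equiv.eq_symm_apply] at h
    exact π.partner_ne _ h
  noncrossing i j hij hj := by
    obtain ⟨i, rfl⟩ := (finRotate (2 * n)).surjective i
    obtain ⟨j, rfl⟩ := (finRotate (2 * n)).surjective j
    rw [Equiv.symm_apply_apply] at hj ⊢
    rw [Equiv.symm_apply_apply]
    have h1 : j ≠ i := by
      rintro rfl
      exact lt_irrefl _ hij
    have h2 : j ≠ π.partner i := by
      rintro rfl
      exact lt_irrefl _ hj
    have h3 := π.between_iff i j h1 h2
    have h4 : (π.partner j : ℕ) ≠ π.partner i := fun h => h1 (π.partner_inj.1 (Fin.ext h))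
    have h5 : (π.partner j : ℕ) ≠ i := by
      intro h
      rw [← Fin.ext h, π.partner_partner] at h2
      exact h2 rfl
    rw [Fin.lt_def, val_finRotate, val_finRotate] at *
    have := i.is_lt
    have := j.is_lt
    have := (π.partner i).is_lt
    have := (π.partner j).is_lt
    split_ifs at * <;> omega

theorem finRotate_ne (a : Fin (2 * n)) : finRotate (2 * n) a ≠ a := by
  intro h
  have := val_finRotate a
  rw [h] at this
  split_ifs at this <;> omega

/-- The partner function of `temperleyLieb a π` below. -/
def temperleyLiebFun (a : Fin (2 * n)) (π : NCMatching n) (i : Fin (2 * n)) : Fin (2 * n) :=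
  if i = a then finRotate (2 * n) a
  else if i = finRotate (2 * n) a then a
  else if i = π.partner a then π.partner (finRotate (2 * n) a)
  else if i = π.partner (finRotate (2 * n) a) then π.partner a
  else π.partner i

set_option maxHeartbeats 1000000 in
theorem temperleyLiebFun_noncrossing (a : Fin (2 * n)) (π : NCMatching n) (i j : Fin (2 * n))
    (hij : i < j) (hj : j < temperleyLiebFun a π i) :
    temperleyLiebFun a π j < temperleyLiebFun a π i := by
  unfold temperleyLiebFun at *
  have h2 := finRotate_ne a
  have h3 := val_finRotate a
  generalize finRotate (2 * n) a = b at *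
  by_cases hab : π.partner a = b
  · have hba : π.partner b = a := (π.partner_eq_iff a b).1 hab
    have key : ∀ i, (if i = a then b else if i = b then a else if i = π.partner a then π.partner b
        else if i = π.partner b then π.partner a else π.partner i) = π.partner i := by
      intro i
      rw [hab, hba]
      split_ifs with h4 h5 <;> simp [*]
    rw [key] at hj ⊢
    rw [key]
    exact π.noncrossing i j hij hj
  have hx := π.partner_ne a
  have hy := π.partner_ne b
  have hxb : π.partner b ≠ a := fun h => hab ((π.partner_eq_iff b a).1 h)
  have hxy : π.partner a ≠ π.partner b := fun h => h2 (π.partner_inj.1 h).symm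
  have hother : ∀ k, k ≠ a → k ≠ b → k ≠ π.partner a → k ≠ π.partner b →
      π.partner k ≠ a ∧ π.partner k ≠ b ∧ π.partner k ≠ π.partner a ∧
        π.partner k ≠ π.partner b := by
    intro k h4 h5 h6 h7
    refine ⟨fun h => h6 ?_, fun h => h7 ?_, fun h => h4 (π.partner_inj.1 h),
      fun h => h5 (π.partner_inj.1 h)⟩
    · exact ((π.partner_eq_iff k a).1 h).symm
    · exact ((π.partner_eq_iff k b).1 h).symm
  have fab := π.between_iff a b h2 (Ne.symm hab)
  have fother : ∀ k, k ≠ a → k ≠ b → k ≠ π.partner a → k ≠ π.partner b → _ ∧ _ :=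
    fun k h4 h5 h6 h7 => ⟨π.between_iff a k h4 h6, π.between_iff b k h5 h7⟩
  have fij : j ≠ i → j ≠ π.partner i → _ := π.between_iff i j
  have hij' : π.partner i = π.partner j ↔ i = j := π.partner_inj
  have hi := hother i
  have hj' := hother j
  have fi := fother i
  have fj := fother j
  have := i.is_lt
  have := j.is_lt
  have := a.is_lt
  have := b.is_lt
  have := (π.partner i).is_lt
  have := (π.partner j).is_lt
  have := (π.partner a).is_lt
  have := (π.partner b).is_lt
  clear hother fother
  simp only [Fin.lt_def, Ne, Fin.ext_iff] at *
  generalize hX : (π.partner a : ℕ) = X at *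
  generalize hY : (π.partner b : ℕ) = Y at *
  generalize hI : (π.partner i : ℕ) = I at *
  generalize hJ : (π.partner j : ℕ) = J at *
  simp only [apply_ite Fin.val, hX, hY, hI, hJ] at *
  by_cases ho : ¬ (i : ℕ) = a ∧ ¬ (i : ℕ) = b ∧ ¬ (i : ℕ) = X ∧ ¬ (i : ℕ) = Y <;>
  by_cases ho' : ¬ (j : ℕ) = a ∧ ¬ (j : ℕ) = b ∧ ¬ (j : ℕ) = X ∧ ¬ (j : ℕ) = Y
  · clear fab hi hj' fi fj
    obtain ⟨o1, o2, o3, o4⟩ := ho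
    obtain ⟨o1', o2', o3', o4'⟩ := ho'
    simp only [o1, o2, o3, o4, o1', o2', o3', o4', if_false] at hj ⊢
    omega
  · clear fab hj' fj fij hij'
    obtain ⟨o1, o2, o3, o4⟩ := ho
    specialize hi o1 o2 o3 o4
    specialize fi o1 o2 o3 o4
    simp only [o1, o2, o3, o4, if_false] at hj ⊢
    split_ifs at h3 <;> split_ifs at hj ⊢ <;> omega
  · clear fab hi fi fij hij'
    obtain ⟨o1, o2, o3, o4⟩ := ho'
    specialize hj' o1 o2 o3 o4
    specialize fj o1 o2 o3 o4
    simp only [o1, o2, o3, o4, if_false] at hj ⊢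
    split_ifs at h3 <;> split_ifs at hj ⊢ <;> omega
  · clear hi hj' fi fj fij hij'
    split_ifs at h3 <;> split_ifs at hj ⊢ <;> omega

/-- The Temperley–Lieb operator: for a point `a`, with cyclic successor `b`, connect `a` with `b`
and connect the former partners of `a` and `b` with each other. -/
def temperleyLieb (a : Fin (2 * n)) (π : NCMatching n) : NCMatching n where
  partner := temperleyLiebFun a π
  partner_partner i := by
    unfold temperleyLiebFun
    have h0 := π.partner_partner
    have h1 := π.partner_ne
    have h2 := finRotate_ne a
    generalize finRotate (2 * n) a = b at *
    grind
  partner_ne i := by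
    unfold temperleyLiebFun
    have h0 := π.partner_partner
    have h1 := π.partner_ne
    have h2 := finRotate_ne a
    generalize finRotate (2 * n) a = b at *
    grind
  noncrossing := temperleyLiebFun_noncrossing a π

/-- The lattice path of `π` starts at `(0, 0)` and has a north step for every left endpoint of an
arch and an east step for every right endpoint. This is its height after `k` steps, i.e. the number
of left endpoints among the first `k` points. -/
def height (π : NCMatching n) (k : ℕ) : ℕ :=
  (Finset.univ.filter fun i : Fin (2 * n) => (i : ℕ) < k ∧ i < π.partner i).card

/-- The horizontal coordinate of the lattice path of `π` after `k` steps, i.e. the number of right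
endpoints among the first `k` points. -/
def width (π : NCMatching n) (k : ℕ) : ℕ :=
  (Finset.univ.filter fun i : Fin (2 * n) => (i : ℕ) < k ∧ π.partner i < i).card

/-- The Young diagram `λ(π)` enclosed by the path `NⁿEⁿ` and the lattice path of `π`. The box in
row `r` and column `c` (both counted from `0`, rows from the top) is the unit square with lower
right corner `(c + 1, n - r - 1)`; it lies in `λ(π)` iff the path of `π` visits a point weakly
to the right of and weakly below that corner. -/
def young (π : NCMatching n) : YoungDiagram where
  cells := (Finset.range n ×ˢ Finset.range n).filter fun b : ℕ × ℕ =>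
    ∃ k < 2 * n + 1, b.2 + 1 ≤ π.width k ∧ π.height k + (b.1 + 1) ≤ n
  isLowerSet := by
    rintro ⟨r, c⟩ ⟨r', c'⟩ hle h
    obtain ⟨h1, h2⟩ := Prod.mk_le_mk.1 hle
    simp only [Finset.coe_filter, Finset.mem_product, Finset.mem_range, Set.mem_ofPred_eq] at h ⊢
    obtain ⟨⟨h3, h4⟩, k, hk, h5, h6⟩ := h
    exact ⟨⟨by omega, by omega⟩, k, hk, by omega, by omega⟩

/-- `σ ↗ⱼ π`: `λ(π)` is `λ(σ)` with one box added on the `j`-th diagonal. The box in row `r` and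
column `c` (counted from `0`) lies on the diagonal with label `n + c - r`. -/
def AddsBox (j : ℕ) (σ π : NCMatching n) : Prop :=
  ∃ r c : ℕ, (r, c) ∉ σ.young ∧ n + c = j + r ∧ π.young.cells = insert (r, c) σ.young.cells

end NCMatching

namespace WheelPoly

open MvPolynomial

/-- `q = exp (2πi / 3)`. -/
noncomputable def q : ℂ := Complex.exp (2 * Real.pi * Complex.I / 3)

/-- Polynomials in `z₁, …, z₂ₙ`. The variables are indexed cyclically: `z_k` is
`X (k : ZMod (2 * n))`, so that `z_{k + 2n} = z_k`. -/
abbrev Pol (n : ℕ) := MvPolynomial (ZMod (2 * n)) ℂ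

variable {n : ℕ}

/-- The operator `S_k` exchanging the variables `z_k` and `z_{k+1}`. -/
noncomputable def S (k : ZMod (2 * n)) (f : Pol n) : Pol n :=
  rename (Equiv.swap k (k + 1)) f

theorem dvd_S_sub (k : ZMod (2 * n)) (f : Pol n) : (X (k + 1) - X k : Pol n) ∣ S k f - f := by
  unfold S
  induction f using MvPolynomial.induction_on with
  | C a => simp
  | add f g hf hg =>
    rw [map_add, add_sub_add_comm]
    exact dvd_add hf hg
  | mul_X f i hf =>
    have h : (X (k + 1) - X k : Pol n) ∣ X (Equiv.swap k (k + 1) i) - X i := by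
      by_cases h1 : i = k
      · rw [h1, Equiv.swap_apply_left]
      by_cases h2 : i = k + 1
      · rw [h2, Equiv.swap_apply_right]
        exact ⟨-1, by ring⟩
      · rw [Equiv.swap_apply_of_ne_of_ne h1 h2, sub_self]
        exact dvd_zero _
    have e : rename (Equiv.swap k (k + 1)) (f * X i) - f * X i =
        (rename (Equiv.swap k (k + 1)) f - f) * X (Equiv.swap k (k + 1) i) +
          f * (X (Equiv.swap k (k + 1) i) - X i) := by
      rw [map_mul, rename_X]
      ring
    rw [e]
    exact dvd_add (hf.mul_right _) (h.mul_left _)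

/-- The polynomial `(S_k f - f) / (z_{k+1} - z_k)`. -/
noncomputable def divDiff (k : ZMod (2 * n)) (f : Pol n) : Pol n :=
  (dvd_S_sub k f).choose

theorem mul_divDiff (k : ZMod (2 * n)) (f : Pol n) :
    (X (k + 1) - X k) * divDiff k f = S k f - f :=
  (dvd_S_sub k f).choose_spec.symm

/-- The operator `D_k f = (q z_k - q⁻¹ z_{k+1}) (S_k f - f) / (z_{k+1} - z_k)`, with cyclic index
`k` (so `D_{k+2n} = D_k`). -/
noncomputable def D (k : ZMod (2 * n)) (f : Pol n) : Pol n :=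
  (C q * X k - C q⁻¹ * X (k + 1)) * divDiff k f

/-- `Ψ` of the nested matching `()ₙ`:
`(q - q⁻¹) ^ (-n(n-1)) ∏_{1 ≤ i < j ≤ n} (q z_i - q⁻¹ z_j) (q z_{n+i} - q⁻¹ z_{n+j})`. -/
noncomputable def psiNested (n : ℕ) : Pol n :=
  C ((q - q⁻¹) ^ (n * (n - 1)))⁻¹ *
    ∏ i ∈ Finset.Icc 1 n, ∏ j ∈ Finset.Icc (i + 1) n,
      ((C q * X (i : ZMod (2 * n)) - C q⁻¹ * X (j : ZMod (2 * n))) *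
        (C q * X ((n + i : ℕ) : ZMod (2 * n)) - C q⁻¹ * X ((n + j : ℕ) : ZMod (2 * n))))

open Classical in
/-- The family `(Ψ_π)` with the prescribed value at `()ₙ` and
`Ψ_π = D_j Ψ_σ - ∑_{τ ∈ e_j⁻¹(σ) ∖ {σ, π}} Ψ_τ` whenever `σ ↗ⱼ π`. The point with label `j` is
`a = j - 1`. -/
structure IsPsi (Ψ : NCMatching n → Pol n) : Prop where
  nested : Ψ (NCMatching.nested n) = psiNested n
  recursion : ∀ (a : Fin (2 * n)) (σ π : NCMatching n), σ.AddsBox (a + 1) π →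
    Ψ π = D ((a + 1 : ℕ) : ZMod (2 * n)) (Ψ σ) -
      ∑ τ with τ.temperleyLieb a = σ ∧ τ ≠ σ ∧ τ ≠ π, Ψ τ

/-- The boxes (row, column), counted from `0`, of a Young diagram in reading order: rows from top
to bottom, every row from left to right. -/
def boxes (Y : YoungDiagram) : List (ℕ × ℕ) :=
  (List.range (Y.colLen 0)).flatMap fun r => (List.range (Y.rowLen r)).map fun c => (r, c)

/-- Starting from `f`, apply successively `D_{s + c - r}` for all boxes `(r, c)` of `Y` in reading
order. -/
noncomputable def applyBoxes (s : ZMod (2 * n)) (Y : YoungDiagram) (f : Pol n) : Pol n :=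
  (boxes Y).foldl (fun g b => D (s + b.2 - b.1) g) f

/-- The polynomial `D_π`. -/
noncomputable def basisD (π : NCMatching n) : Pol n :=
  applyBoxes n π.young (psiNested n)

/-- The polynomial `D_{π₁,π₂}`: the box `(r, c)` of `λ(π₂)` acts through `D_{c - r}`, starting from
`D_{(π₁)_{n₂}}`. -/
noncomputable def basisD₂ {n₁ n₂ : ℕ} (π₁ : NCMatching n₁) (π₂ : NCMatching n₂) : Pol (n₁ + n₂) :=
  applyBoxes 0 π₂.young (basisD (π₁.nest n₂))

end WheelPoly

/-!
The proof identifies the family `Ψ` with a dual basis. Call a polynomial in `z₁, …, z₂ₙ` a *wheel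
polynomial* (`IsWheel`) if it has degree at most `n - 1` in each variable and vanishes whenever
`z_j = q² z_i` and `z_k = q² z_j` for some `i < j < k`. A matching `σ` is turned into a point of
`ℂ²ⁿ` (`orientation`): the coordinate is `q⁻¹` at left and `q` at right endpoints of arches.

*A wheel polynomial is determined by its values at matchings* (`eq_zero_of_ev_orientation`).
Consider more generally points compatible with a noncrossing partial matching `g`, that is, with
`z_j = q² z_i` for every arch `(i, j)`. If `g` is a matching, rescaling an arch changes the value by
an explicit nonzero factor, because the wheel condition forces `2n - 2` zeros in the scale, which is
as many as the degree allows. If `g` has unmatched points, the wheel condition and the vanishing at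
points with one more arch force more zeros than the degree allows. Induction on the number of
unmatched points gives the claim for the empty partial matching, which imposes no condition. The
zeros are distinct at generic points only, and continuity takes care of the others
(`eq_zero_of_generic`).

*The exchange relation* (`ev_orientation_D`). The operators `D_a` preserve wheel polynomials and act
on their values at matchings as `e_a - 1`. This is immediate from the definition of `D_a` if `a` is
connected with `a + 1`, or if `a` closes an arch and `a + 1` opens one. The general case is reduced
to these by the rotation invariance `ev_orientation_rotate` of the values, again a count of zeros.

*Existence and uniqueness.* `Ψ_{()ₙ}` is a wheel polynomial with value `1` at `()ₙ` and `0` at the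
other matchings. By the exchange relation, the recursion along added boxes produces the basis dual
to the evaluations at matchings (`exists_dual`). This dual basis satisfies
`D_a Ψ_σ = ∑_{e_a τ = σ} Ψ_τ - Ψ_σ` for all `a` and `σ`, and the invariance of the values becomes
`Ψ_{ρ(π)}(z₁, …, z₂ₙ) = Ψ_π(z₂, …, z₂ₙ, z₁)` (`exists_exchange_family`). Uniqueness is plain from
the recursion.

*Triangularity.* If operators act on a family indexed by matchings like `e_a - 1`, then applying
those that belong to the boxes of `λ(π)` to the member at the nested matching gives a unitriangular
integral combination of the family, with coefficients that do not depend on the family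
(`exists_unitriangular`). Only instances with `τ ≤ σ`, where a box can be added to `σ` on the
diagonal of `a`, are needed. For these, an arch `(a, a + 1)` of `τ` is enclosed by another arch of
`τ`, so that the preimages of `τ` under `e_a` are the same if `τ` is inserted into a larger matching
(`IsInsertion.sum_temperleyLieb`). Hence the statement applies first to the family `Ψ_{(τ₁)_{n₂}}`,
with the labels `n + c - r`, and then, for each fixed `τ₁`, to the rotated family
`Ψ_{ρ^{n₂}(τ₁τ₂)}`, with the labels `c - r`. The two meet as `ρ^{n₂}(τ₁()_{n₂}) = (τ₁)_{n₂}`. So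
`D_{τ₁,τ₂}` is a combination of the polynomials `Ψ_{ρ^{n₂}(σ₁σ₂)}` whose matrix is the product of
two unitriangular ones (`basisD₂_eq_sum`), and inverting these two matrices proves the theorem.
-/


namespace NCMatching

variable {n : ℕ}

/-! ### Lattice paths -/

/-- A noncrossing matching is determined by its set of left endpoints: at the first right endpoint
whose partners differ, the two partners would be the endpoints of crossing arches. -/
theorem ext_of_lt_partner {π σ : NCMatching n}
    (h : ∀ i, i < π.partner i ↔ i < σ.partner i) : π = σ := by
  have closing : ∀ j, π.partner j < j → π.partner j = σ.partner j := by
    intro j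
    induction j using WellFoundedLT.induction with
    | ind j ih =>
      intro hj
      have hj' : σ.partner j < j := by
        have h1 := h j
        have h2 := σ.partner_ne j
        rw [Fin.lt_def] at *
        rw [Ne, Fin.ext_iff] at h2
        omega
      have h1 := π.partner_partner j
      have h2 := σ.partner_partner j
      rcases lt_trichotomy (π.partner j) (σ.partner j) with h3 | h3 | h3
      · exfalso
        have h4 := π.noncrossing (π.partner j) (σ.partner j) h3 (by rwa [h1])
        rw [h1] at h4
        have h5 : π.partner (π.partner (σ.partner j)) < π.partner (σ.partner j) := by
          rw [π.partner_partner]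
          refine (h (σ.partner j)).2 ?_
          rwa [h2]
        have h6 := ih _ h4 h5
        rw [π.partner_partner, eq_comm, σ.partner_eq_iff, h2] at h6
        exact absurd h6.symm h4.ne
      · exact h3
      · exfalso
        have h4 := σ.noncrossing (σ.partner j) (π.partner j) h3 (by rwa [h2])
        rw [h2] at h4
        have h7 : π.partner j < σ.partner (π.partner j) := by
          refine (h (π.partner j)).1 ?_
          rwa [h1]
        have h5 : π.partner (σ.partner (π.partner j)) < σ.partner (π.partner j) := by
          have h8 := h (σ.partner (π.partner j))
          rw [σ.partner_partner] at h8
          have h9 := π.partner_ne (σ.partner (π.partner j))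
          exact lt_of_le_of_ne (not_lt.1 fun h10 => lt_asymm h7 (h8.1 h10)) h9
        have h6 := ih _ h4 h5
        rw [σ.partner_partner, π.partner_eq_iff, h1] at h6
        exact absurd h6.symm h4.ne
  ext1
  funext i
  rcases lt_or_gt_of_ne (π.partner_ne i) with h1 | h1
  · exact closing i h1
  · have h2 := closing (π.partner i) (by rwa [π.partner_partner])
    rw [π.partner_partner, eq_comm, σ.partner_eq_iff] at h2
    exact h2.symm

theorem height_zero (π : NCMatching n) : π.height 0 = 0 := by
  simp [height]

theorem height_succ (π : NCMatching n) (i : Fin (2 * n)) :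
    π.height (i + 1) = π.height i + if i < π.partner i then 1 else 0 := by
  unfold height
  split_ifs with h
  · rw [← Finset.card_insert_of_notMem (a := i) (by simp)]
    congr 1
    ext j
    simp only [Finset.mem_filter, Finset.mem_univ, true_and, Finset.mem_insert, Fin.ext_iff]
    constructor
    · rintro ⟨h1, h2⟩
      by_cases h3 : (j : ℕ) = i
      · exact Or.inl h3
      · exact Or.inr ⟨by omega, h2⟩
    · rintro (h1 | ⟨h1, h2⟩)
      · obtain rfl := Fin.ext h1
        exact ⟨by omega, h⟩
      · exact ⟨by omega, h2⟩
  · rw [add_zero]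
    refine congrArg Finset.card (Finset.ext fun j => ?_)
    simp only [Finset.mem_filter, Finset.mem_univ, true_and]
    constructor
    · rintro ⟨h1, h2⟩
      by_cases h3 : (j : ℕ) = i
      · obtain rfl := Fin.ext h3
        exact absurd h2 h
      · exact ⟨by omega, h2⟩
    · rintro ⟨h1, h2⟩
      exact ⟨by omega, h2⟩

theorem height_mono (π : NCMatching n) {k l : ℕ} (h : k ≤ l) : π.height k ≤ π.height l := by
  refine Finset.card_le_card fun j => ?_
  simp only [Finset.mem_filter, Finset.mem_univ, true_and]
  exact fun hj => ⟨by omega, hj.2⟩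

theorem width_mono (π : NCMatching n) {k l : ℕ} (h : k ≤ l) : π.width k ≤ π.width l := by
  refine Finset.card_le_card fun j => ?_
  simp only [Finset.mem_filter, Finset.mem_univ, true_and]
  exact fun hj => ⟨by omega, hj.2⟩

theorem height_add_width (π : NCMatching n) {k : ℕ} (h : k ≤ 2 * n) :
    π.height k + π.width k = k := by
  unfold height width
  rw [← Finset.card_union_of_disjoint]
  · have : (Finset.univ.filter fun i : Fin (2 * n) => (i : ℕ) < k ∧ i < π.partner i) ∪
        (Finset.univ.filter fun i : Fin (2 * n) => (i : ℕ) < k ∧ π.partner i < i) =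
        Finset.univ.filter fun i : Fin (2 * n) => (i : ℕ) < k := by
      ext i
      simp only [Finset.mem_union, Finset.mem_filter, Finset.mem_univ, true_and, ← and_or_left,
        and_iff_left_iff_imp]
      exact fun _ => (lt_or_gt_of_ne (π.partner_ne i)).symm
    rw [this, Fin.card_filter_val_lt, min_eq_right h]
  · rw [Finset.disjoint_filter]
    exact fun i _ h1 h2 => lt_asymm h1.2 h2.2

/-- The lattice path stays above the diagonal: every arch is opened before it is closed. -/
theorem width_le_height (π : NCMatching n) (k : ℕ) : π.width k ≤ π.height k := by
  refine Finset.card_le_card_of_injOn π.partner ?_ fun i _ j _ h => π.partner_inj.1 h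
  intro i
  simp only [Finset.coe_filter, Finset.mem_univ, true_and, Set.mem_ofPred_eq, π.partner_partner]
  rintro ⟨h1, h2⟩
  exact ⟨lt_trans h2 h1, h2⟩

theorem height_of_le (π : NCMatching n) {k : ℕ} (h : 2 * n ≤ k) : π.height k = n := by
  have h1 : π.height k = π.height (2 * n) := by
    unfold height
    congr 1
    ext i
    have := i.is_lt
    simp only [Finset.mem_filter, Finset.mem_univ, true_and]
    exact ⟨fun h => ⟨by omega, h.2⟩, fun h => ⟨by omega, h.2⟩⟩
  have h2 : π.height (2 * n) ≤ π.width (2 * n) := by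
    refine Finset.card_le_card_of_injOn π.partner ?_ fun i _ j _ h => π.partner_inj.1 h
    intro i
    simp only [Finset.coe_filter, Finset.mem_univ, true_and, Set.mem_ofPred_eq, π.partner_partner]
    rintro ⟨-, h2⟩
    exact ⟨Fin.is_lt _, h2⟩
  have h3 := π.width_le_height (2 * n)
  have h4 := π.height_add_width le_rfl
  omega

theorem height_le (π : NCMatching n) (k : ℕ) : π.height k ≤ n :=
  (π.height_mono (le_max_left k (2 * n))).trans (π.height_of_le (le_max_right _ _)).le

theorem height_le_self (π : NCMatching n) (k : ℕ) : π.height k ≤ k := by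
  rcases le_total k (2 * n) with h | h
  · have := π.height_add_width h
    omega
  · rw [π.height_of_le h]
    omega

theorem le_two_mul_height (π : NCMatching n) {k : ℕ} (h : k ≤ 2 * n) : k ≤ 2 * π.height k := by
  have h1 := π.height_add_width h
  have h2 := π.width_le_height k
  omega

/-- The lower right corner of the box `(r, c)` lies on the antidiagonal which the path meets after
`n + c - r` steps, so a single point of the path decides whether the box belongs to the diagram. -/
theorem mem_young {π : NCMatching n} {r c : ℕ} :
    (r, c) ∈ π.young ↔ r < n ∧ c < n ∧ π.height (n + c - r) + (r + 1) ≤ n := by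
  rw [← YoungDiagram.mem_cells]
  simp only [young, Finset.mem_filter, Finset.mem_product, Finset.mem_range, and_assoc]
  refine and_congr_right fun hr => and_congr_right fun hc => ?_
  have h0 := π.height_add_width (k := n + c - r) (by omega)
  constructor
  · rintro ⟨k, hk, h1, h2⟩
    rcases le_total k (n + c - r) with h3 | h3
    · have := π.width_mono h3
      omega
    · have := π.height_mono h3
      omega
  · intro h
    exact ⟨n + c - r, by omega, by omega, h⟩

/-- The boxes of `λ(π)` lie strictly above the antidiagonal of the `n × n` square. -/
theorem add_le_of_mem_young {π : NCMatching n} {r c : ℕ} (h : (r, c) ∈ π.young) :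
    r + c + 2 ≤ n := by
  rw [mem_young] at h
  have := π.le_two_mul_height (k := n + c - r) (by omega)
  omega

/-- Inclusion of diagrams is the reverse pointwise order of the lattice paths. -/
theorem young_le_iff {σ π : NCMatching n} :
    σ.young ≤ π.young ↔ ∀ k, π.height k ≤ σ.height k := by
  constructor
  · intro h k
    by_contra! h1
    have h2 := π.height_le k
    have h3 := π.height_le_self k
    have h4 : k < 2 * n := by
      by_contra! h5
      rw [π.height_of_le h5, σ.height_of_le h5] at h1
      exact lt_irrefl _ h1
    have h5 := σ.height_add_width h4.le
    have h6 := σ.width_le_height k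
    -- the box of the diagonal `k` just inside the path of `σ`
    have h7 : (n - 1 - σ.height k, k - 1 - σ.height k) ∈ σ.young := by
      rw [mem_young, show n + (k - 1 - σ.height k) - (n - 1 - σ.height k) = k by omega]
      omega
    have h8 := h h7
    rw [mem_young, show n + (k - 1 - σ.height k) - (n - 1 - σ.height k) = k by omega] at h8
    omega
  · rintro h ⟨r, c⟩ h1
    rw [mem_young] at h1 ⊢
    have := h (n + c - r)
    omega

theorem ext_of_height {π σ : NCMatching n} (h : ∀ k, π.height k = σ.height k) : π = σ := by
  refine ext_of_lt_partner fun i => ?_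
  have h1 := π.height_succ i
  have h2 := σ.height_succ i
  rw [h, h] at h1
  split_ifs at * <;> first | tauto | omega

theorem young_injective : Function.Injective (young : NCMatching n → YoungDiagram) := by
  intro π σ h
  exact ext_of_height fun k => le_antisymm (young_le_iff.1 h.ge k) (young_le_iff.1 h.le k)

theorem height_nested (k : ℕ) : (nested n).height k = min k n := by
  have h : ∀ i : Fin (2 * n), i < (nested n).partner i ↔ (i : ℕ) < n := by
    intro i
    change i < i.rev ↔ _
    rw [Fin.lt_def, Fin.val_rev]
    omega
  unfold height
  simp only [h, ← lt_min_iff]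
  rw [Fin.card_filter_val_lt]
  omega

theorem notMem_young_nested (b : ℕ × ℕ) : b ∉ (nested n).young := by
  rcases b with ⟨r, c⟩
  rw [mem_young, height_nested]
  omega

/-! ### Adding boxes and the Temperley–Lieb operators -/

/-- Adding a box on the diagonal `j` lowers the lattice path by one after `j` steps and nowhere
else. -/
theorem addsBox_iff_height {σ π : NCMatching n} {j : ℕ} :
    σ.AddsBox j π ↔ σ.height j = π.height j + 1 ∧ ∀ k, k ≠ j → σ.height k = π.height k := by
  constructor
  · rintro ⟨r, c, h1, h2, h3⟩
    have h4 : ∀ b, b ∈ π.young ↔ b = (r, c) ∨ b ∈ σ.young := by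
      intro b
      rw [← YoungDiagram.mem_cells, h3, Finset.mem_insert, YoungDiagram.mem_cells]
    have h5 : σ.young ≤ π.young := fun b hb => (h4 b).2 (Or.inr hb)
    rw [young_le_iff] at h5
    -- a box of a diagonal `k` between the two paths is the added box
    have key : ∀ k x, π.height k ≤ x → x < σ.height k → r = n - 1 - x ∧ k = j := by
      intro k x h6 h7
      have h8 := σ.height_le k
      have h9 := σ.height_le_self k
      have h10 : k < 2 * n := by
        by_contra! h11
        rw [π.height_of_le h11] at h6
        omega
      have h11 := π.le_two_mul_height h10.le
      have h12 : n + (k - 1 - x) - (n - 1 - x) = k := by omega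
      have h13 : (n - 1 - x, k - 1 - x) ∈ π.young := by
        rw [mem_young, h12]
        omega
      rw [h4, mem_young, h12, Prod.mk.injEq] at h13
      omega
    have h6 := (h4 (r, c)).2 (Or.inl rfl)
    rw [mem_young] at h1 h6
    rw [show n + c - r = j by omega] at h1 h6
    constructor
    · by_contra h7
      have h8 := key j (π.height j) le_rfl (by omega)
      have h9 := key j (π.height j + 1) (by omega) (by omega)
      have := σ.height_le j
      omega
    · intro k hk
      by_contra h7
      have := h5 k
      exact hk (key k (π.height k) le_rfl (by omega)).2
  · rintro ⟨h1, h2⟩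
    have h3 := σ.height_le j
    have h4 := σ.height_le_self j
    have h10 : j < 2 * n := by
      by_contra! h11
      rw [π.height_of_le h11] at h1
      omega
    have h5 := π.le_two_mul_height h10.le
    refine ⟨n - σ.height j, j - σ.height j, ?_, by omega, ?_⟩
    · rw [mem_young, show n + (j - σ.height j) - (n - σ.height j) = j by omega]
      omega
    · ext ⟨r, c⟩
      rw [Finset.mem_insert, YoungDiagram.mem_cells, YoungDiagram.mem_cells, mem_young, mem_young,
        Prod.mk.injEq]
      by_cases h6 : n + c - r = j
      · rw [h6]
        omega
      · rw [h2 _ h6]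
        omega

theorem finRotate_eq {a b : Fin (2 * n)} (hb : (b : ℕ) = a + 1) : finRotate (2 * n) a = b := by
  have := b.is_lt
  rw [Fin.ext_iff, val_finRotate, if_neg (by omega), hb]

theorem temperleyLieb_partner (a : Fin (2 * n)) (π : NCMatching n) (i : Fin (2 * n)) :
    (temperleyLieb a π).partner i =
      if i = a then finRotate (2 * n) a
      else if i = finRotate (2 * n) a then a
      else if i = π.partner a then π.partner (finRotate (2 * n) a)
      else if i = π.partner (finRotate (2 * n) a) then π.partner a
      else π.partner i := rfl

theorem temperleyLieb_partner_self (a : Fin (2 * n)) (π : NCMatching n) :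
    (temperleyLieb a π).partner a = finRotate (2 * n) a := by
  rw [temperleyLieb_partner, if_pos rfl]

theorem temperleyLieb_of_partner {a : Fin (2 * n)} {π : NCMatching n}
    (h : π.partner a = finRotate (2 * n) a) : temperleyLieb a π = π := by
  ext1
  funext i
  have h1 := (π.partner_eq_iff _ _).1 h
  rw [temperleyLieb_partner, h, h1]
  split_ifs with h2 h3
  · rw [h2, h]
  · rw [h3, h1]
  · rfl

/-- If the left endpoints of `τ` and `u` form the same multiset as those of `τ'` and `v`, then the
paths of `τ` and `τ'` differ by the steps at `u` and `v`. -/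
theorem height_add_eq {τ τ' : NCMatching n} {u v : Fin (2 * n)}
    (h : ∀ i, (if i < τ.partner i then 1 else 0) + (if i = u then 1 else 0) =
      (if i < τ'.partner i then 1 else 0) + (if i = v then 1 else 0)) (k : ℕ) :
    τ.height k + (if (u : ℕ) < k then 1 else 0) = τ'.height k + (if (v : ℕ) < k then 1 else 0) := by
  rcases le_total k (2 * n) with hk | hk
  · induction k with
    | zero => simp [height_zero]
    | succ k ih =>
      have h1 := ih (by omega)
      have h2 := h ⟨k, by omega⟩
      have h3 := τ.height_succ ⟨k, by omega⟩
      have h4 := τ'.height_succ ⟨k, by omega⟩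
      simp only [Fin.ext_iff] at *
      rw [h3, h4]
      have e : ∀ w : ℕ, (if w < k + 1 then 1 else 0) =
          (if w < k then 1 else 0) + if k = w then 1 else 0 := by
        intro w
        split_ifs <;> omega
      rw [e, e]
      omega
  · rw [τ.height_of_le hk, τ'.height_of_le hk, if_pos (by omega), if_pos (by omega)]

/-- `e_a` changes the four endpoints `a`, `a + 1` and their partners only, hence the effect of
`e_a` on the lattice path can be read off there. -/
theorem height_temperleyLieb_add {a b : Fin (2 * n)} (hb : (b : ℕ) = a + 1) {π : NCMatching n}
    (hab : π.partner a ≠ b) {u v : Fin (2 * n)}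
    (hu : u = a ∨ u = b ∨ u = π.partner a ∨ u = π.partner b)
    (hv : v = a ∨ v = b ∨ v = π.partner a ∨ v = π.partner b)
    (h1 : (if a < b then 1 else 0) + (if a = u then 1 else 0) =
      (if a < π.partner a then 1 else 0) + (if a = v then 1 else 0))
    (h2 : (if b < a then 1 else 0) + (if b = u then 1 else 0) =
      (if b < π.partner b then 1 else 0) + (if b = v then 1 else 0))
    (h3 : (if π.partner a < π.partner b then 1 else 0) + (if π.partner a = u then 1 else 0) =
      (if π.partner a < a then 1 else 0) + (if π.partner a = v then 1 else 0))
    (h4 : (if π.partner b < π.partner a then 1 else 0) + (if π.partner b = u then 1 else 0) =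
      (if π.partner b < b then 1 else 0) + (if π.partner b = v then 1 else 0)) (k : ℕ) :
    (temperleyLieb a π).height k + (if (u : ℕ) < k then 1 else 0) =
      π.height k + (if (v : ℕ) < k then 1 else 0) := by
  refine height_add_eq (fun i => ?_) k
  have hba : π.partner b ≠ a := fun h => hab ((π.partner_eq_iff b a).1 h)
  have hne : b ≠ a := by
    rw [Ne, Fin.ext_iff]
    omega
  rw [temperleyLieb_partner, finRotate_eq hb]
  by_cases ia : i = a
  · rw [ia, if_pos rfl, h1]
  by_cases ib : i = b
  · rw [ib, if_neg hne, if_pos rfl, h2]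
  by_cases ix : i = π.partner a
  · rw [ix, if_neg (π.partner_ne a), if_neg hab, if_pos rfl, h3, π.partner_partner]
  by_cases iy : i = π.partner b
  · rw [iy, if_neg hba, if_neg (π.partner_ne b), if_neg fun h => hne (π.partner_inj.1 h),
      if_pos rfl, h4, π.partner_partner]
  rw [if_neg ia, if_neg ib, if_neg ix, if_neg iy, if_neg (c := i = u), if_neg (c := i = v)]
  · rintro rfl
    tauto
  · rintro rfl
    tauto

/-- If `a` closes an arch and `a + 1` opens one, then `e_a` removes a box on the diagonal
`a + 1`. -/
theorem addsBox_temperleyLieb {a b : Fin (2 * n)} (hb : (b : ℕ) = a + 1) {π : NCMatching n}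
    (h1 : π.partner a < a) (h2 : b < π.partner b) : (temperleyLieb a π).AddsBox (a + 1) π := by
  have key := height_temperleyLieb_add (u := b) (v := a) hb (π := π)
    (by rw [Ne, Fin.ext_iff]; rw [Fin.lt_def] at h1; omega) (by tauto) (by tauto)
    (by simp only [Fin.lt_def, Fin.ext_iff] at *; split_ifs <;> omega)
    (by simp only [Fin.lt_def, Fin.ext_iff] at *; split_ifs <;> omega)
    (by simp only [Fin.lt_def, Fin.ext_iff] at *; split_ifs <;> omega)
    (by simp only [Fin.lt_def, Fin.ext_iff] at *; split_ifs <;> omega)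
  rw [addsBox_iff_height]
  constructor
  · have := key (a + 1)
    rw [if_neg (by omega), if_pos (by omega)] at this
    omega
  · intro k hk
    have := key k
    split_ifs at this <;> omega

/-- A preimage of `τ` under `e_a` has a smaller diagram or arises from `τ` by adding a box. -/
theorem young_le_or_addsBox {a b : Fin (2 * n)} (hb : (b : ℕ) = a + 1) (τ : NCMatching n) :
    τ.young ≤ (temperleyLieb a τ).young ∨ (temperleyLieb a τ).AddsBox (a + 1) τ := by
  by_cases hab : τ.partner a = b
  · left
    rw [temperleyLieb_of_partner (by rw [hab, finRotate_eq hb])]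
  have key := fun u v => height_temperleyLieb_add (u := u) (v := v) hb hab
  have h3 := τ.partner_partner a
  have h4 := τ.partner_partner b
  have ha := τ.partner_ne a
  have hbb := τ.partner_ne b
  have hba : τ.partner b ≠ a := fun h => hab ((τ.partner_eq_iff b a).1 h)
  have hxy : τ.partner a ≠ τ.partner b := fun h => by
    have := τ.partner_inj.1 h
    rw [Fin.ext_iff] at this
    omega
  have nc1 := τ.noncrossing a b (by rw [Fin.lt_def]; omega)
  have nc2 := τ.noncrossing (τ.partner b) a
  have nc3 := τ.noncrossing (τ.partner b) (τ.partner a)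
  have nc4 := τ.noncrossing (τ.partner a) (τ.partner b)
  have add := addsBox_temperleyLieb hb (π := τ)
  rw [h4] at nc2 nc3 nc4
  rw [h3] at nc3 nc4
  rw [young_le_iff]
  generalize τ.partner a = x at *
  generalize τ.partner b = y at *
  simp only [Ne, Fin.ext_iff, Fin.lt_def] at *
  rcases lt_or_ge (a : ℕ) x with h1 | h1
  -- two nested arches opening at `a` and `a + 1`
  · left
    have h2 : (b : ℕ) < y := by omega
    have h5 : (y : ℕ) < x := by omega
    clear nc1 nc2 nc3 nc4 add h3 h4 ha hbb hba hab hxy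
    intro k
    have := key b y (by tauto) (by tauto) (by split_ifs <;> omega) (by split_ifs <;> omega)
      (by split_ifs <;> omega) (by split_ifs <;> omega) k
    split_ifs at this <;> omega
  · rcases lt_or_ge (b : ℕ) y with h2 | h2
    · right
      exact add (by omega) h2
    -- two nested arches closing at `a` and `a + 1`
    · left
      have h5 : (y : ℕ) < x := by omega
      have h6 : (x : ℕ) < a := by omega
      clear nc1 nc2 nc3 nc4 add h3 h4 ha hbb hba hab hxy
      intro k
      have := key x a (by tauto) (by tauto) (by split_ifs <;> omega) (by split_ifs <;> omega)
        (by split_ifs <;> omega) (by split_ifs <;> omega) k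
      split_ifs at this <;> omega

/-- If `a` opens an arch and `a + 1` closes one, then they belong to the same arch. -/
theorem partner_of_succ {a b : Fin (2 * n)} (hb : (b : ℕ) = a + 1) {σ : NCMatching n}
    (h1 : a < σ.partner a) (h2 : σ.partner b < b) : σ.partner a = b := by
  by_contra h
  have h3 := σ.noncrossing a b (by rw [Fin.lt_def]; omega)
  have h4 := σ.noncrossing (σ.partner b) a
  rw [σ.partner_partner] at h4
  have h5 : σ.partner b ≠ a := fun h5 => h ((σ.partner_eq_iff b a).1 h5)
  rw [Fin.ext_iff] at h
  rw [Ne, Fin.ext_iff] at h5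
  simp only [Fin.lt_def] at *
  omega

/-- A box added on the diagonal `a + 1` turns the arch `(a, a + 1)` into the end of one arch and
the beginning of another; `e_a` reverts this. -/
theorem AddsBox.eq_temperleyLieb {a : Fin (2 * n)} {σ π : NCMatching n}
    (h : σ.AddsBox (a + 1) π) : ∃ b : Fin (2 * n), (b : ℕ) = a + 1 ∧ π.partner a < a ∧
      b < π.partner b ∧ temperleyLieb a π = σ ∧ σ.partner a = b := by
  rw [addsBox_iff_height] at h
  have hlt : (a : ℕ) + 1 < 2 * n := by
    by_contra! h1
    rw [σ.height_of_le h1, π.height_of_le h1] at h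
    omega
  obtain ⟨b, hb⟩ : ∃ b : Fin (2 * n), (b : ℕ) = a + 1 := ⟨⟨a + 1, hlt⟩, rfl⟩
  have h1 := σ.height_succ a
  have h2 := π.height_succ a
  have h3 := σ.height_succ b
  have h4 := π.height_succ b
  have h5 := h.2 a (by omega)
  have h6 := h.2 (b + 1) (by omega)
  have h7 := h.1
  rw [hb] at h3 h4 h6
  have sa : a < σ.partner a := by
    by_contra h8
    rw [if_neg h8] at h1
    omega
  have pa : ¬ a < π.partner a := by
    intro h8
    rw [if_pos sa] at h1
    rw [if_pos h8] at h2
    omega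
  have sb : ¬ b < σ.partner b := by
    intro h8
    rw [if_pos h8] at h3
    split_ifs at h4 <;> omega
  have pb : b < π.partner b := by
    by_contra h8
    rw [if_neg h8] at h4
    rw [if_neg sb] at h3
    omega
  have pa' : π.partner a < a := lt_of_le_of_ne (not_lt.1 pa) (π.partner_ne a)
  refine ⟨b, hb, pa', pb, ?_,
    partner_of_succ hb sa (lt_of_le_of_ne (not_lt.1 sb) (σ.partner_ne b))⟩
  have h8 := addsBox_iff_height.1 (addsBox_temperleyLieb hb pa' pb)
  refine ext_of_height fun k => ?_
  by_cases hk : k = a + 1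
  · rw [hk, h8.1, h.1]
  · rw [h8.2 k hk, h.2 k hk]

theorem AddsBox.temperleyLieb_left {a : Fin (2 * n)} {σ π : NCMatching n}
    (h : σ.AddsBox (a + 1) π) : temperleyLieb a σ = σ := by
  obtain ⟨b, hb, -, -, -, h1⟩ := h.eq_temperleyLieb
  exact temperleyLieb_of_partner (by rw [h1, finRotate_eq hb])

theorem AddsBox.temperleyLieb_right {a : Fin (2 * n)} {σ π : NCMatching n}
    (h : σ.AddsBox (a + 1) π) : temperleyLieb a π = σ := by
  obtain ⟨b, -, -, -, h1, -⟩ := h.eq_temperleyLieb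
  exact h1

theorem AddsBox.young_le {j : ℕ} {σ π : NCMatching n} (h : σ.AddsBox j π) :
    σ.young ≤ π.young := by
  rw [addsBox_iff_height] at h
  rw [young_le_iff]
  intro k
  by_cases hk : k = j
  · rw [hk]
    omega
  · exact (h.2 k hk).ge

theorem AddsBox.ne {j : ℕ} {σ π : NCMatching n} (h : σ.AddsBox j π) : σ ≠ π := by
  rw [addsBox_iff_height] at h
  rintro rfl
  omega

theorem card_young_lt {σ π : NCMatching n} (h : σ.young ≤ π.young) (hne : σ ≠ π) :
    σ.young.card < π.young.card := by
  refine Finset.card_lt_card (Finset.ssubset_iff_subset_ne.2 ⟨h, fun h1 => hne ?_⟩)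
  exact young_injective (YoungDiagram.ext h1)

/-- Preimages of `τ ≤ σ` under `e_a` stay below `π` whenever `σ ↗ π` on the diagonal `a + 1`. -/
theorem AddsBox.young_le_of_temperleyLieb {a : Fin (2 * n)} {σ π τ : NCMatching n}
    (h : σ.AddsBox (a + 1) π) (hτ : (temperleyLieb a τ).young ≤ σ.young) : τ.young ≤ π.young := by
  obtain ⟨b, hb, -⟩ := h.eq_temperleyLieb
  have h1 := h.young_le
  rcases young_le_or_addsBox hb τ with h2 | h2
  · exact h2.trans (hτ.trans h1)
  · rw [addsBox_iff_height] at h h2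
    rw [young_le_iff] at hτ ⊢
    intro k
    have h3 := hτ k
    by_cases hk : k = a + 1
    · subst hk
      omega
    · have := h.2 k hk
      have := h2.2 k hk
      omega

/-- In the setting of the recursion for `Ψ_π`, all matchings on the right-hand side have a
smaller diagram than `π`. -/
theorem AddsBox.card_lt {a : Fin (2 * n)} {σ π τ : NCMatching n} (h : σ.AddsBox (a + 1) π)
    (hτ : temperleyLieb a τ = σ) (hne : τ ≠ π) : τ.young.card < π.young.card :=
  card_young_lt (h.young_le_of_temperleyLieb (by rw [hτ])) hne

/-- A box of `λ(π)` with no box below it and no box to its right can be removed. -/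
theorem exists_addsBox_of_corner {π : NCMatching n} {r c : ℕ} (h : (r, c) ∈ π.young)
    (h1 : (r + 1, c) ∉ π.young) (h2 : (r, c + 1) ∉ π.young) :
    ∃ (a : Fin (2 * n)) (σ : NCMatching n), σ.AddsBox (a + 1) π ∧ (a : ℕ) + 1 + r = n + c ∧
      π.young.cells = insert (r, c) σ.young.cells ∧ (r, c) ∉ σ.young := by
  have h0 := add_le_of_mem_young h
  rw [mem_young] at h h1 h2
  obtain ⟨a, ha⟩ : ∃ a : Fin (2 * n), (a : ℕ) = n + c - r - 1 := ⟨⟨n + c - r - 1, by omega⟩, rfl⟩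
  obtain ⟨b, hb⟩ : ∃ b : Fin (2 * n), (b : ℕ) = n + c - r := ⟨⟨n + c - r, by omega⟩, rfl⟩
  rw [show n + c - (r + 1) = a by omega] at h1
  rw [show n + (c + 1) - r = b + 1 by omega] at h2
  rw [← hb] at h
  have h3 := π.height_succ a
  have h4 := π.height_succ b
  rw [show (a : ℕ) + 1 = b by omega] at h3
  have ha' : π.partner a < a := by
    refine lt_of_le_of_ne (not_lt.1 fun h5 => ?_) (π.partner_ne a)
    rw [if_pos h5] at h3
    omega
  have hb' : b < π.partner b := by
    by_contra h5
    rw [if_neg h5] at h4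
    omega
  have h5 := addsBox_temperleyLieb (by omega) ha' hb'
  refine ⟨a, _, h5, by omega, ?_⟩
  have h6 := addsBox_iff_height.1 h5
  have h7 : (r, c) ∉ (temperleyLieb a π).young := by
    rw [mem_young, ← hb, show (b : ℕ) = a + 1 by omega]
    rw [show (a : ℕ) + 1 = b by omega] at *
    omega
  refine ⟨?_, h7⟩
  obtain ⟨r', c', h8, h9, h10⟩ := h5
  rw [h10]
  have h11 : (r, c) ∈ π.young.cells := by
    rw [YoungDiagram.mem_cells, mem_young, ← hb]
    exact h
  rw [h10, Finset.mem_insert, YoungDiagram.mem_cells] at h11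
  rw [h11.resolve_right h7]

end NCMatching

namespace NCMatching

variable {n : ℕ}

/-! ### Triangularity -/

/-- Empty rows may be included in the enumeration of the boxes. -/
theorem _root_.WheelPoly.boxes_eq_flatMap_range (Y : YoungDiagram) {N : ℕ} (h : Y.colLen 0 ≤ N) :
    WheelPoly.boxes Y =
      (List.range N).flatMap fun r => (List.range (Y.rowLen r)).map fun c => (r, c) := by
  unfold WheelPoly.boxes
  induction N, h using Nat.le_induction with
  | base => rfl
  | succ N hN ih =>
    have h1 : Y.rowLen N = 0 := by
      by_contra h2
      have h3 : (N, 0) ∈ Y := YoungDiagram.mem_iff_lt_rowLen.2 (Nat.pos_of_ne_zero h2)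
      have h4 := YoungDiagram.mem_iff_lt_colLen.1 h3
      omega
    rw [ih, List.range_succ, List.flatMap_append]
    simp [h1]

/-- The last box of a nonempty Young diagram in reading order is a corner. -/
theorem _root_.WheelPoly.exists_last_box {Y : YoungDiagram} (hY : Y.cells.Nonempty) :
    ∃ r c : ℕ, (r, c) ∈ Y ∧ (r + 1, c) ∉ Y ∧ (r, c + 1) ∉ Y ∧ ∀ Y' : YoungDiagram,
      Y.cells = insert (r, c) Y'.cells → (r, c) ∉ Y' →
        WheelPoly.boxes Y = WheelPoly.boxes Y' ++ [(r, c)] := by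
  obtain ⟨⟨r0, c0⟩, h0⟩ := hY
  rw [YoungDiagram.mem_cells] at h0
  have h00 : (0, 0) ∈ Y := Y.up_left_mem (Nat.zero_le _) (Nat.zero_le _) h0
  have hR := YoungDiagram.mem_iff_lt_colLen.1 h00
  obtain ⟨r, hr⟩ : ∃ r, Y.colLen 0 = r + 1 := ⟨Y.colLen 0 - 1, by omega⟩
  have hr0 : (r, 0) ∈ Y := YoungDiagram.mem_iff_lt_colLen.2 (by omega)
  have hC := YoungDiagram.mem_iff_lt_rowLen.1 hr0
  obtain ⟨c, hc⟩ : ∃ c, Y.rowLen r = c + 1 := ⟨Y.rowLen r - 1, by omega⟩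
  refine ⟨r, c, YoungDiagram.mem_iff_lt_rowLen.2 (by omega), fun h => ?_, fun h => ?_, ?_⟩
  · have h1 := Y.up_left_mem le_rfl (Nat.zero_le c) h
    have h2 := YoungDiagram.mem_iff_lt_colLen.1 h1
    omega
  · have h1 := YoungDiagram.mem_iff_lt_rowLen.1 h
    omega
  · intro Y' h1 h2
    have h3 : ∀ b, b ∈ Y ↔ b = (r, c) ∨ b ∈ Y' := by
      intro b
      rw [← YoungDiagram.mem_cells, h1, Finset.mem_insert, YoungDiagram.mem_cells]
    have h4 : Y'.colLen 0 ≤ r + 1 := by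
      by_contra! h5
      have h6 := (h3 _).2 (Or.inr (YoungDiagram.mem_iff_lt_colLen.2 h5))
      have h7 := YoungDiagram.mem_iff_lt_colLen.1 h6
      omega
    have h5 : ∀ i, i ≠ r → Y.rowLen i = Y'.rowLen i := by
      intro i hi
      refine eq_of_forall_lt_iff fun j => ?_
      rw [← YoungDiagram.mem_iff_lt_rowLen, ← YoungDiagram.mem_iff_lt_rowLen, h3, Prod.mk.injEq]
      tauto
    have h6 : Y'.rowLen r = c := by
      refine eq_of_forall_lt_iff fun j => ?_
      have h7 := h3 (r, j)
      rw [YoungDiagram.mem_iff_lt_rowLen, YoungDiagram.mem_iff_lt_rowLen, hc, Prod.mk.injEq] at h7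
      rw [YoungDiagram.mem_iff_lt_rowLen] at h2
      omega
    rw [WheelPoly.boxes_eq_flatMap_range Y hr.le, WheelPoly.boxes_eq_flatMap_range Y' h4,
      List.range_succ, List.flatMap_append, List.flatMap_append]
    have h7 : ((List.range r).flatMap fun r => (List.range (Y.rowLen r)).map fun c => (r, c)) =
        (List.range r).flatMap fun r => (List.range (Y'.rowLen r)).map fun c => (r, c) := by
      refine List.flatMap_congr fun i hi => ?_
      rw [h5 i (List.mem_range.1 hi).ne]
    rw [h7]
    simp [hc, h6, List.range_succ]

theorem eq_nested_of_cells_eq_empty {π : NCMatching n} (h : π.young.cells = ∅) :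
    π = nested n := by
  refine young_injective (YoungDiagram.ext ?_)
  rw [h, eq_comm, Finset.eq_empty_iff_forall_notMem]
  exact fun b hb => notMem_young_nested b hb

/-- Every matching other than `()ₙ` arises by adding the last box in reading order. -/
theorem exists_addsBox_of_ne_nested {π : NCMatching n} (h : π ≠ nested n) :
    ∃ (a : Fin (2 * n)) (σ : NCMatching n) (r c : ℕ), σ.AddsBox (a + 1) π ∧
      (a : ℕ) + 1 + r = n + c ∧
      WheelPoly.boxes π.young = WheelPoly.boxes σ.young ++ [(r, c)] := by
  have h1 : π.young.cells.Nonempty := by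
    rw [Finset.nonempty_iff_ne_empty]
    exact fun h2 => h (eq_nested_of_cells_eq_empty h2)
  obtain ⟨r, c, h2, h3, h4, h5⟩ := WheelPoly.exists_last_box h1
  obtain ⟨a, σ, h6, h7, h8, h9⟩ := exists_addsBox_of_corner h2 h3 h4
  exact ⟨a, σ, r, c, h6, h7, h5 _ h8 h9⟩

open Classical in
/-- Suppose that operators `T b`, indexed by boxes, act on a family `F` like the operators
`e_a - 1`, at least as long as boxes are being added. Then reading the boxes of `λ(π)` yields a
unitriangular integral combination of the members of `F`, with universal coefficients. -/
theorem exists_unitriangular (m : ℕ) : ∃ A : NCMatching m → NCMatching m → ℤ,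
    (∀ π, A π π = 1) ∧ (∀ π τ, A π τ ≠ 0 → τ.young ≤ π.young) ∧
    ∀ (M : Type) [AddCommGroup M] (F : NCMatching m → M) (T : ℕ × ℕ → M →+ M),
      (∀ (b : ℕ × ℕ) (a : Fin (2 * m)) (σ π τ : NCMatching m), (a : ℕ) + 1 + b.1 = m + b.2 →
        σ.AddsBox (a + 1) π → τ.young ≤ σ.young →
        T b (F τ) = (∑ τ' with temperleyLieb a τ' = τ, F τ') - F τ) →
      ∀ π, (WheelPoly.boxes π.young).foldl (fun g b => T b g) (F (nested m)) =
        ∑ τ, A π τ • F τ := by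
  suffices h : ∀ π : NCMatching m, ∃ A : NCMatching m → ℤ,
      A π = 1 ∧ (∀ τ, A τ ≠ 0 → τ.young ≤ π.young) ∧
      ∀ (M : Type) [AddCommGroup M] (F : NCMatching m → M) (T : ℕ × ℕ → M →+ M),
      (∀ (b : ℕ × ℕ) (a : Fin (2 * m)) (σ π τ : NCMatching m), (a : ℕ) + 1 + b.1 = m + b.2 →
        σ.AddsBox (a + 1) π → τ.young ≤ σ.young →
        T b (F τ) = (∑ τ' with temperleyLieb a τ' = τ, F τ') - F τ) →
      (WheelPoly.boxes π.young).foldl (fun g b => T b g) (F (nested m)) =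
        ∑ τ, A τ • F τ by
    choose A h1 h2 h3 using h
    exact ⟨A, h1, h2, fun M _ F T hT π => h3 π M F T hT⟩
  intro π
  induction hk : π.young.card using Nat.strong_induction_on generalizing π with
  | _ k ih =>
  by_cases hπ : π = nested m
  · refine ⟨fun τ => if τ = π then 1 else 0, if_pos rfl, fun τ hτ => ?_, fun M _ F T _ => ?_⟩
    · rw [ne_eq, ite_eq_right_iff, not_forall] at hτ
      rw [hτ.1]
    · have h1 : (nested m).young.colLen 0 = 0 := by
        by_contra h2
        exact notMem_young_nested (0, 0)
          (YoungDiagram.mem_iff_lt_colLen.2 (Nat.pos_of_ne_zero h2))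
      simp only [ite_smul, one_smul, zero_smul, Finset.sum_ite_eq', Finset.mem_univ, if_true]
      rw [hπ, WheelPoly.boxes_eq_flatMap_range _ h1.le]
      rfl
  · obtain ⟨a, σ, r, c, h1, h2, h3⟩ := exists_addsBox_of_ne_nested hπ
    obtain ⟨A, h4, h5, h6⟩ := ih _ (hk ▸ card_young_lt h1.young_le h1.ne) σ rfl
    refine ⟨fun τ => A (temperleyLieb a τ) - A τ, ?_, fun τ hτ => ?_, fun M _ F T hT => ?_⟩
    · have h7 : A π = 0 := by
        by_contra h8
        exact h1.ne (young_injective (le_antisymm h1.young_le (h5 _ h8)))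
      change A (temperleyLieb a π) - A π = 1
      rw [h1.temperleyLieb_right, h4, h7, sub_zero]
    · by_cases h7 : A τ = 0
      · change A (temperleyLieb a τ) - A τ ≠ 0 at hτ
        rw [h7, sub_zero] at hτ
        exact h1.young_le_of_temperleyLieb (h5 _ hτ)
      · exact (h5 _ h7).trans h1.young_le
    · rw [h3, List.foldl_append, h6 M F T hT]
      simp only [List.foldl_cons, List.foldl_nil, map_sum, map_zsmul, sub_smul,
        Finset.sum_sub_distrib]
      have h7 : ∀ τ, A τ • T (r, c) (F τ) =
          A τ • (∑ τ' with temperleyLieb a τ' = τ, F τ') - A τ • F τ := by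
        intro τ
        by_cases h8 : A τ = 0
        · rw [h8, zero_smul, zero_smul, zero_smul, sub_zero]
        · rw [hT (r, c) a σ π τ h2 h1 (h5 _ h8), smul_sub]
      simp only [h7, Finset.sum_sub_distrib, Finset.smul_sum]
      congr 1
      simp only [Finset.sum_filter]
      rw [Finset.sum_comm]
      simp

/-- A unitriangular integral matrix indexed by matchings has a unitriangular left inverse. -/
theorem exists_unitriangular_inverse (A : NCMatching n → NCMatching n → ℤ)
    (h1 : ∀ π, A π π = 1) (h2 : ∀ π τ, A π τ ≠ 0 → τ.young ≤ π.young) :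
    ∃ B : NCMatching n → NCMatching n → ℤ, (∀ π, B π π = 1) ∧
      (∀ π τ, B π τ ≠ 0 → τ.young ≤ π.young) ∧
      ∀ π, (∀ μ, μ ≠ π → ∑ τ, B π τ * A τ μ = 0) ∧ ∑ τ, B π τ * A τ π = 1 := by
  classical
  suffices h : ∀ π : NCMatching n, ∃ B : NCMatching n → ℤ, B π = 1 ∧
      (∀ τ, B τ ≠ 0 → τ.young ≤ π.young) ∧ ∀ μ, ∑ τ, B τ * A τ μ = if μ = π then 1 else 0 by
    choose B h3 h4 h5 using h
    exact ⟨B, h3, h4, fun π => ⟨fun μ hμ => by rw [h5, if_neg hμ], by rw [h5, if_pos rfl]⟩⟩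
  intro π
  induction hk : π.young.card using Nat.strong_induction_on generalizing π with
  | _ k ih =>
  have ih' : ∀ σ : NCMatching n, σ.young.card < k → ∃ B : NCMatching n → ℤ,
      (∀ τ, B τ ≠ 0 → τ.young ≤ σ.young) ∧ ∀ μ, ∑ τ, B τ * A τ μ = if μ = σ then 1 else 0 := by
    intro σ hσ
    obtain ⟨B, -, h3⟩ := ih _ hσ σ rfl
    exact ⟨B, h3⟩
  choose! B h4 h5 using ih'
  have h6 : ∀ σ, σ ≠ π → A π σ ≠ 0 → σ.young.card < k :=
    fun σ h7 h8 => hk ▸ card_young_lt (h2 π σ h8) h7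
  -- solve the relation `∑ y, A π y * B y z = [π = z]` for the row `B π`
  refine ⟨fun z => (if z = π then 1 else 0) - ∑ y ∈ Finset.univ.erase π, A π y * B y z,
    ?_, ?_, ?_⟩
  · dsimp only
    rw [if_pos rfl, Finset.sum_eq_zero, sub_zero]
    intro y hy
    by_contra h7
    have h8 := h6 y (Finset.ne_of_mem_erase hy) (left_ne_zero_of_mul h7)
    have h9 := h4 y h8 π (right_ne_zero_of_mul h7)
    have := Finset.card_le_card h9
    unfold YoungDiagram.card at *
    omega
  · intro τ hτ
    by_cases h7 : τ = π
    · rw [h7]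
    · change (if τ = π then 1 else 0) - ∑ y ∈ Finset.univ.erase π, A π y * B y τ ≠ 0 at hτ
      rw [if_neg h7, zero_sub, neg_ne_zero] at hτ
      obtain ⟨y, hy, h8⟩ := Finset.exists_ne_zero_of_sum_ne_zero hτ
      have h9 := left_ne_zero_of_mul h8
      exact (h4 y (h6 y (Finset.ne_of_mem_erase hy) h9) τ (right_ne_zero_of_mul h8)).trans
        (h2 π y h9)
  · intro μ
    simp only [sub_mul, ite_mul, one_mul, zero_mul, Finset.sum_sub_distrib, Finset.sum_ite_eq',
      Finset.mem_univ, if_true, Finset.sum_mul]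
    rw [Finset.sum_comm]
    have h7 : ∀ y ∈ Finset.univ.erase π, ∑ z, A π y * B y z * A z μ =
        A π y * if μ = y then 1 else 0 := by
      intro y hy
      by_cases h8 : A π y = 0
      · simp [h8]
      · rw [← h5 y (h6 y (Finset.ne_of_mem_erase hy) h8) μ, Finset.mul_sum]
        exact Finset.sum_congr rfl fun z _ => mul_assoc _ _ _
    rw [Finset.sum_congr rfl h7]
    simp only [mul_ite, mul_one, mul_zero, Finset.sum_ite_eq, Finset.mem_erase, Finset.mem_univ,
      and_true]
    by_cases h8 : μ = π
    · simp [h8, h1]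
    · simp [h8]

/-! ### Inserting a matching into a larger one -/

/-- If a box is added on the diagonal `a + 1` to `σ ≥ τ` and `a` is connected with `a + 1` in `τ`,
then this arch of `τ` is enclosed by another one: otherwise the path of `τ` would touch the diagonal
after `a` steps, leaving no room for the box. -/
theorem AddsBox.exists_enclosing {a b : Fin (2 * n)} (hb : (b : ℕ) = a + 1) {σ π τ : NCMatching n}
    (h : σ.AddsBox (a + 1) π) (hτ : τ.young ≤ σ.young) (hab : τ.partner a = b) :
    ∃ c, c < a ∧ b < τ.partner c := by
  by_contra! h1
  have h2 : τ.height a ≤ τ.width a := by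
    refine Finset.card_le_card_of_injOn τ.partner ?_ fun i _ j _ h => τ.partner_inj.1 h
    intro i
    simp only [Finset.coe_filter, Finset.mem_univ, true_and, Set.mem_ofPred_eq, τ.partner_partner]
    rintro ⟨h3, h4⟩
    have h5 := h1 i h3
    have h6 : τ.partner i ≠ b := fun h6 => by
      rw [← hab, τ.partner_inj] at h6
      exact absurd h3 (by rw [h6]; exact lt_irrefl _)
    have h7 : τ.partner i ≠ a := fun h7 => by
      rw [τ.partner_eq_iff, hab] at h7
      rw [Fin.ext_iff] at h7
      omega
    simp only [Ne, Fin.ext_iff, Fin.lt_def, Fin.le_def] at *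
    omega
  have h3 := τ.height_add_width a.is_lt.le
  have h4 := τ.height_succ a
  rw [if_pos (by rw [hab, Fin.lt_def]; omega)] at h4
  rw [addsBox_iff_height] at h
  rw [young_le_iff] at hτ
  have h5 := hτ (a + 1)
  have h6 := π.le_two_mul_height (k := a + 1) (by omega)
  omega

/-- `ι τ` is obtained from a fixed matching by replacing the part on the interval
`s, …, s + 2m - 1` by `τ`. -/
structure IsInsertion {m N : ℕ} (s : ℕ) (ι : NCMatching m → NCMatching N) : Prop where
  add_le : s + 2 * m ≤ 2 * N
  inside : ∀ (τ : NCMatching m) (i : Fin (2 * m)) (k : Fin (2 * N)), (k : ℕ) = s + i →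
    ((ι τ).partner k : ℕ) = s + τ.partner i
  outside : ∀ (τ τ' : NCMatching m) (k : Fin (2 * N)), (∀ i : Fin (2 * m), (k : ℕ) ≠ s + i) →
    (ι τ).partner k = (ι τ').partner k

namespace IsInsertion

variable {m N s : ℕ} {ι : NCMatching m → NCMatching N}

theorem injective (h : IsInsertion s ι) : Function.Injective ι := by
  intro τ τ' h1
  ext i
  have := h.add_le
  have h2 := h.inside τ i ⟨s + i, by omega⟩ rfl
  have h3 := h.inside τ' i ⟨s + i, by omega⟩ rfl
  rw [h1, h3] at h2
  omega

theorem temperleyLieb_comm (h : IsInsertion s ι) {a b : Fin (2 * m)} (hb : (b : ℕ) = a + 1)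
    {a' : Fin (2 * N)} (ha' : (a' : ℕ) = s + a) (τ : NCMatching m) :
    temperleyLieb a' (ι τ) = ι (temperleyLieb a τ) := by
  have hN := h.add_le
  obtain ⟨b', hb'⟩ : ∃ b' : Fin (2 * N), (b' : ℕ) = a' + 1 := ⟨⟨a' + 1, by omega⟩, rfl⟩
  have h1 := h.inside τ a a' ha'
  have h2 := h.inside τ b b' (by omega)
  ext1
  funext k
  by_cases hk : ∃ i : Fin (2 * m), (k : ℕ) = s + i
  · obtain ⟨i, hi⟩ := hk
    have h3 := h.inside τ i k hi
    have h4 := h.inside (temperleyLieb a τ) i k hi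
    rw [temperleyLieb_partner, finRotate_eq hb] at h4
    rw [temperleyLieb_partner, finRotate_eq hb']
    rw [Fin.ext_iff, h4]
    simp only [Fin.ext_iff, apply_ite Fin.val, h1, h2, h3, hi, ha', hb', hb, add_assoc,
      add_right_inj, ← apply_ite (s + ·)]
  · push Not at hk
    have h3 := h.outside τ (temperleyLieb a τ) k hk
    rw [← h3, temperleyLieb_partner, finRotate_eq hb', if_neg, if_neg, if_neg, if_neg]
    · intro h4
      exact hk _ (by rw [h4, h2])
    · intro h4
      exact hk _ (by rw [h4, h1])
    · rw [Fin.ext_iff, hb', ha', add_assoc, ← hb]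
      exact hk _
    · rw [Fin.ext_iff, ha']
      exact hk _

/-- A matching which preserves the interval `s, …, s + 2m - 1` and agrees with `ι τ` outside of it
belongs to the image of `ι`. -/
theorem exists_of_partner (h : IsInsertion s ι) {X : NCMatching N} (τ : NCMatching m)
    (hX : ∀ (i : Fin (2 * m)) (k : Fin (2 * N)), (k : ℕ) = s + i →
      s ≤ (X.partner k : ℕ) ∧ (X.partner k : ℕ) < s + 2 * m)
    (hX' : ∀ k : Fin (2 * N), (∀ i : Fin (2 * m), (k : ℕ) ≠ s + i) →
      X.partner k = (ι τ).partner k) : ∃ τ', X = ι τ' := by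
  have hN := h.add_le
  let emb : Fin (2 * m) → Fin (2 * N) := fun i => ⟨s + i, by omega⟩
  have key : ∀ i, ∃ j, X.partner (emb i) = emb j := by
    intro i
    have h1 := hX i (emb i) rfl
    refine ⟨⟨X.partner (emb i) - s, by omega⟩, Fin.ext ?_⟩
    change _ = s + ((X.partner (emb i) : ℕ) - s)
    omega
  have emb_inj : ∀ i j, emb i = emb j → i = j := by
    intro i j hij
    rw [Fin.ext_iff] at hij ⊢
    simp only [emb] at hij
    omega
  have emb_lt : ∀ i j, emb i < emb j ↔ i < j := by
    intro i j
    simp only [emb, Fin.lt_def]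
    omega
  choose f hf using key
  let τ' : NCMatching m :=
    { partner := f
      partner_partner := fun i => emb_inj _ _ (by rw [← hf, ← hf, X.partner_partner])
      partner_ne := fun i hi => X.partner_ne (emb i) (by rw [hf, hi])
      noncrossing := fun i j hij hj => by
        rw [← emb_lt, ← hf, ← hf]
        exact X.noncrossing _ _ ((emb_lt _ _).2 hij) (by rwa [hf, emb_lt]) }
  refine ⟨τ', ?_⟩
  ext1
  funext k
  by_cases hk : ∃ i : Fin (2 * m), (k : ℕ) = s + i
  · obtain ⟨i, hi⟩ := hk
    have h3 := h.inside τ' i k hi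
    obtain rfl : k = emb i := Fin.ext hi
    rw [Fin.ext_iff, h3, hf]
  · push Not at hk
    rw [hX' k hk, h.outside τ τ' k hk]

/-- Undoing `e_a` at an enclosed arch of the inserted matching does not touch its surroundings. -/
theorem exists_of_temperleyLieb_eq (h : IsInsertion s ι) {a b : Fin (2 * m)}
    (hb : (b : ℕ) = a + 1) {a' : Fin (2 * N)} (ha' : (a' : ℕ) = s + a) {τ : NCMatching m}
    {c : Fin (2 * m)} (hc : c < a) (hc' : b < τ.partner c) {X : NCMatching N}
    (hX : temperleyLieb a' X = ι τ) : ∃ τ', X = ι τ' := by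
  have hN := h.add_le
  obtain ⟨b', hb'⟩ : ∃ b' : Fin (2 * N), (b' : ℕ) = a' + 1 := ⟨⟨a' + 1, by omega⟩, rfl⟩
  obtain ⟨c', hcv⟩ : ∃ c' : Fin (2 * N), (c' : ℕ) = s + c := ⟨⟨s + c, by omega⟩, rfl⟩
  have hp := fun k => congrArg (fun Y : NCMatching N => Y.partner k) hX
  simp only [temperleyLieb_partner, finRotate_eq hb'] at hp
  by_cases hab : X.partner a' = b'
  · exact ⟨τ, by rw [← hX, temperleyLieb_of_partner (by rw [hab, finRotate_eq hb'])]⟩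
  have hba : X.partner b' ≠ a' := fun h1 => hab ((X.partner_eq_iff b' a').1 h1)
  have h0 := h.inside τ c c' hcv
  -- both former partners of the endpoints of the arch lie in the inserted interval
  have hxy : (s ≤ (X.partner a' : ℕ) ∧ (X.partner a' : ℕ) < s + 2 * m) ∧
      (s ≤ (X.partner b' : ℕ) ∧ (X.partner b' : ℕ) < s + 2 * m) := by
    have h1 := hp c'
    have hca : c' ≠ a' := by rw [Ne, Fin.ext_iff]; rw [Fin.lt_def] at hc; omega
    have hcb : c' ≠ b' := by rw [Ne, Fin.ext_iff]; rw [Fin.lt_def] at hc; omega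
    have := (τ.partner c).is_lt
    rw [if_neg hca, if_neg hcb] at h1
    by_cases hx : c' = X.partner a'
    · rw [if_pos hx] at h1
      rw [← hx, h1]
      omega
    · rw [if_neg hx] at h1
      by_cases hy : c' = X.partner b'
      · rw [if_pos hy] at h1
        rw [← hy, h1]
        omega
      · rw [if_neg hy] at h1
        have h2 := X.between_iff c' a' hca.symm fun h2 => by
          rw [eq_comm, X.partner_eq_iff] at h2
          exact hx h2.symm
        have h3 := X.between_iff c' b' hcb.symm fun h2 => by
          rw [eq_comm, X.partner_eq_iff] at h2
          exact hy h2.symm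
        rw [h1] at h2 h3
        rw [Fin.lt_def] at hc hc'
        have h4 := h2.1 (Or.inl (by omega))
        have h5 := h3.1 (Or.inl (by omega))
        omega
  refine h.exists_of_partner τ (fun i k hk => ?_) fun k hk => ?_
  · by_cases hka : k = a'
    · rw [hka]
      exact hxy.1
    by_cases hkb : k = b'
    · rw [hkb]
      exact hxy.2
    by_cases hkx : k = X.partner a'
    · rw [hkx, X.partner_partner]
      omega
    by_cases hky : k = X.partner b'
    · rw [hky, X.partner_partner]
      omega
    have h1 := hp k
    rw [if_neg hka, if_neg hkb, if_neg hkx, if_neg hky] at h1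
    have := (τ.partner i).is_lt
    rw [h1, h.inside τ i k hk]
    omega
  · have h1 := hp k
    rw [if_neg, if_neg, if_neg, if_neg] at h1
    · exact h1
    · rintro rfl
      exact hk ⟨X.partner b' - s, by omega⟩ (by simp only; omega)
    · rintro rfl
      exact hk ⟨X.partner a' - s, by omega⟩ (by simp only; omega)
    · rintro rfl
      exact hk b (by omega)
    · rintro rfl
      exact hk a (by omega)

open Classical in
/-- As long as boxes are being added, preimages under `e_a` may be taken before or after the
insertion: the arch `(a, a + 1)` of `τ` is absent or enclosed by an arch of `τ`, which protects the
surroundings. -/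
theorem sum_temperleyLieb (h : IsInsertion s ι) {a : Fin (2 * m)} {a' : Fin (2 * N)}
    (ha' : (a' : ℕ) = s + a) {σ π τ : NCMatching m} (hσ : σ.AddsBox (a + 1) π)
    (hτ : τ.young ≤ σ.young) {M : Type*} [AddCommMonoid M] (F : NCMatching N → M) :
    ∑ X with temperleyLieb a' X = ι τ, F X = ∑ τ' with temperleyLieb a τ' = τ, F (ι τ') := by
  obtain ⟨b, hb, -⟩ := hσ.eq_temperleyLieb
  have hN := h.add_le
  rw [← Finset.sum_image (f := F) fun x _ y _ hxy => h.injective hxy]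
  refine Finset.sum_congr ?_ fun _ _ => rfl
  ext X
  simp only [Finset.mem_filter, Finset.mem_univ, true_and, Finset.mem_image]
  constructor
  · intro hX
    have hab : τ.partner a = b := by
      have h1 := h.inside τ a a' ha'
      rw [← hX, temperleyLieb_partner_self,
        finRotate_eq (b := ⟨a' + 1, by omega⟩) rfl] at h1
      rw [Fin.ext_iff]
      simp only at h1
      omega
    obtain ⟨c, hc, hc'⟩ := hσ.exists_enclosing hb hτ hab
    obtain ⟨τ', rfl⟩ := h.exists_of_temperleyLieb_eq hb ha' hc hc' hX
    rw [h.temperleyLieb_comm hb ha'] at hX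
    exact ⟨τ', h.injective hX, rfl⟩
  · rintro ⟨τ', rfl, rfl⟩
    exact h.temperleyLieb_comm hb ha' τ'

end IsInsertion

theorem isInsertion_nest (n k : ℕ) :
    IsInsertion k (fun τ : NCMatching n => τ.nest k) where
  add_le := by omega
  inside τ i j hj := by
    have hj' : k ≤ (j : ℕ) ∧ (j : ℕ) < 2 * n + k := by omega
    simp only [nest, dif_pos hj']
    rw [add_right_inj]
    congr 2
    exact Fin.ext (by simp only; omega)
  outside τ τ' j hj := by
    have hj' : ¬ (k ≤ (j : ℕ) ∧ (j : ℕ) < 2 * n + k) := fun h =>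
      hj ⟨j - k, by omega⟩ (by simp only; omega)
    simp only [nest, dif_neg hj']

theorem isInsertion_concat {m : ℕ} (σ : NCMatching m) (n : ℕ) :
    IsInsertion (2 * m) (fun τ : NCMatching n => σ.concat τ) where
  add_le := by omega
  inside τ i j hj := by
    have hj' : ¬ (j : ℕ) < 2 * m := by omega
    simp only [concat, dif_neg hj']
    rw [add_right_inj]
    congr 2
    exact Fin.ext (by simp only; omega)
  outside τ τ' j hj := by
    have hj' : (j : ℕ) < 2 * m := by
      by_contra h
      exact hj ⟨j - 2 * m, by omega⟩ (by simp only; omega)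
    simp only [concat, dif_pos hj']

theorem nest_nested (n k : ℕ) : (nested n).nest k = nested (n + k) := by
  ext i
  simp only [nest, nested]
  split_ifs with h
  · simp only [Fin.val_rev]
    omega
  · rfl

theorem height_nest (τ : NCMatching n) (k j : ℕ) (hj : j ≤ 2 * n) :
    (τ.nest k).height (k + j) = k + τ.height j := by
  have h := isInsertion_nest n k
  induction j with
  | zero =>
    rw [height_zero]
    suffices h1 : ∀ l ≤ k, (τ.nest k).height l = l from h1 k le_rfl
    intro l hl
    induction l with
    | zero => exact height_zero _
    | succ l ih =>
      have h2 := (τ.nest k).height_succ ⟨l, by omega⟩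
      have h3 : ¬ (k ≤ l ∧ l < 2 * n + k) := by omega
      rw [if_pos] at h2
      · rw [h2, ih (by omega)]
      · simp only [nest, dif_neg h3, Fin.lt_def, Fin.val_rev]
        omega
  | succ j ih =>
    have h1 := (τ.nest k).height_succ ⟨k + j, by omega⟩
    have h2 := τ.height_succ ⟨j, by omega⟩
    have h3 := h.inside τ ⟨j, by omega⟩ ⟨k + j, by omega⟩ rfl
    simp only [Fin.lt_def] at *
    rw [← add_assoc, h1, h2, ih (by omega), h3, add_assoc, add_right_inj, add_right_inj]
    simp only [add_lt_add_iff_left]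

/-- Surrounding a matching by nested arches leaves its diagram unchanged. -/
theorem young_nest (τ : NCMatching n) (k : ℕ) : (τ.nest k).young = τ.young := by
  refine YoungDiagram.ext (Finset.ext fun ⟨r, c⟩ => ?_)
  rw [YoungDiagram.mem_cells, YoungDiagram.mem_cells]
  constructor
  · intro h
    have h1 := add_le_of_mem_young h
    rw [mem_young] at h ⊢
    by_cases h2 : r < n ∧ c < n
    · have := τ.height_nest k (n + c - r) (by omega)
      rw [show k + (n + c - r) = n + k + c - r by omega] at this
      omega
    · -- outside the inner square the path of `(τ)ₖ` is that of nested arches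
      exfalso
      have h3 := τ.height_nest k 0 (by omega)
      have h4 := τ.height_nest k (2 * n) le_rfl
      rw [τ.height_of_le le_rfl] at h4
      simp only [height_zero, add_zero] at h3
      rcases le_or_gt k (n + k + c - r) with h5 | h5
      · have h6 := (τ.nest k).height_mono h5
        rcases le_or_gt n r with h7 | h7
        · omega
        · rcases le_or_gt (2 * n) (n + c - r) with h8 | h8
          · have := (τ.nest k).height_mono (show k + 2 * n ≤ n + k + c - r by omega)
            omega
          · have h9 := τ.height_nest k (n + c - r) h8.le
            rw [show k + (n + c - r) = n + k + c - r by omega] at h9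
            have h10 := τ.height_add_width h8.le
            have h11 := τ.width_mono h8.le
            have h12 := τ.height_add_width (le_refl (2 * n))
            rw [τ.height_of_le le_rfl] at h12
            omega
      · have h6 := (τ.nest k).height_add_width (k := n + k + c - r) (by omega)
        have h7 := (τ.nest k).width_mono h5.le
        have h8 := (τ.nest k).height_add_width (k := k) (by omega)
        omega
  · intro h
    have h1 := add_le_of_mem_young h
    rw [mem_young] at h ⊢
    have := τ.height_nest k (n + c - r) (by omega)
    rw [show k + (n + c - r) = n + k + c - r by omega] at this
    omega

/-! ### Rotated concatenations -/

theorem rotate_partner_finRotate (π : NCMatching n) (i : Fin (2 * n)) :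
    π.rotate.partner (finRotate (2 * n) i) = finRotate (2 * n) (π.partner i) := by
  simp only [rotate, Equiv.symm_apply_apply]

/-- The partners in `ρʳ(π)`; both alternatives express congruence modulo `2n`. -/
theorem rotate_iterate_partner (π : NCMatching n) (r : ℕ) (hr : r ≤ 2 * n) :
    ∀ i j : Fin (2 * n), ((j : ℕ) = i + r ∨ (j : ℕ) + 2 * n = i + r) →
      ((rotate^[r] π).partner j : ℕ) = π.partner i + r ∨
        ((rotate^[r] π).partner j : ℕ) + 2 * n = π.partner i + r := by
  induction r with
  | zero =>
    intro i j h
    obtain rfl : j = i := Fin.ext (by omega)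
    left
    simp
  | succ r ih =>
    intro i j h
    rw [Function.iterate_succ_apply']
    obtain ⟨j, rfl⟩ := (finRotate (2 * n)).surjective j
    rw [rotate_partner_finRotate]
    have h1 := val_finRotate j
    have h2 := val_finRotate ((rotate^[r] π).partner j)
    have h3 := ih (by omega) i j (by split_ifs at h1 <;> omega)
    have := ((rotate^[r] π).partner j).is_lt
    have := (π.partner i).is_lt
    split_ifs at h2 <;> omega

theorem rotate_iterate_concat_nested {m : ℕ} (σ : NCMatching m) (k : ℕ) :
    rotate^[k] (σ.concat (nested k)) = σ.nest k := by
  ext j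
  obtain ⟨i, hi⟩ : ∃ i : Fin (2 * (m + k)), (j : ℕ) = i + k ∨ (j : ℕ) + 2 * (m + k) = i + k := by
    rcases le_or_gt k (j : ℕ) with h | h
    · exact ⟨⟨j - k, by omega⟩, by simp only; omega⟩
    · exact ⟨⟨j + 2 * (m + k) - k, by omega⟩, by simp only; omega⟩
  have h1 := (σ.concat (nested k)).rotate_iterate_partner k (by omega) i j hi
  have hlt := ((rotate^[k] (σ.concat (nested k))).partner j).is_lt
  by_cases h2 : (i : ℕ) < 2 * m
  · have h3 : k ≤ (j : ℕ) ∧ (j : ℕ) < 2 * m + k := by omega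
    have h4 : (σ.concat (nested k)).partner i = ⟨σ.partner ⟨i, h2⟩, by omega⟩ := by
      simp only [concat, dif_pos h2]
    have h5 := (isInsertion_nest m k).inside σ ⟨i, h2⟩ j (by simp only; omega)
    rw [h4] at h1
    rw [h5]
    have := (σ.partner ⟨i, h2⟩).is_lt
    simp only at h1 ⊢
    omega
  · have h3 : ¬ (k ≤ (j : ℕ) ∧ (j : ℕ) < 2 * m + k) := by omega
    have h4 : ((σ.concat (nested k)).partner i : ℕ) = 2 * m + (2 * k - (i - 2 * m + 1)) := by
      simp only [concat, dif_neg h2, nested, Fin.val_rev]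
    have h5 : ((σ.nest k).partner j : ℕ) = 2 * (m + k) - (j + 1) := by
      simp only [nest, dif_neg h3, Fin.val_rev]
    rw [h4] at h1
    rw [h5]
    omega

end NCMatching

namespace WheelPoly

open MvPolynomial

variable {n : ℕ}

/-! ### Evaluation of polynomials in cyclically indexed variables -/

theorem isPrimitiveRoot_q : IsPrimitiveRoot q 3 := by
  have := Complex.isPrimitiveRoot_exp 3 (by norm_num)
  unfold q
  exact_mod_cast this

theorem q_pow_three : q ^ 3 = 1 := isPrimitiveRoot_q.pow_eq_one

theorem q_ne_zero : q ≠ 0 := isPrimitiveRoot_q.ne_zero (by norm_num)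

theorem q_ne_one : q ≠ 1 := isPrimitiveRoot_q.ne_one (by norm_num)

theorem q_inv : q⁻¹ = q ^ 2 :=
  inv_eq_of_mul_eq_one_right (by rw [← pow_succ', q_pow_three])

theorem q_sq_ne_one : q ^ 2 ≠ 1 :=
  isPrimitiveRoot_q.pow_ne_one_of_pos_of_lt (by norm_num) (by norm_num)

theorem q_sq_ne_q : q ^ 2 ≠ q := by
  intro h
  rw [sq, mul_eq_left₀ q_ne_zero] at h
  exact q_ne_one h

theorem add_one_ne_self (k : ZMod (2 * n)) : k + 1 ≠ k := by
  have : Nontrivial (ZMod (2 * n)) := ZMod.nontrivial_iff.2 (by omega)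
  simp

theorem X_succ_sub_X_ne_zero (k : ZMod (2 * n)) : (X (k + 1) - X k : Pol n) ≠ 0 := by
  rw [Ne, sub_eq_zero, X_inj]
  exact add_one_ne_self k

theorem divDiff_unique {k : ZMod (2 * n)} {f g : Pol n}
    (h : (X (k + 1) - X k) * g = S k f - f) : divDiff k f = g :=
  mul_left_cancel₀ (X_succ_sub_X_ne_zero k) ((mul_divDiff k f).trans h.symm)

/-- The operator `D_k` as a linear map. -/
noncomputable def linD (k : ZMod (2 * n)) : Pol n →ₗ[ℂ] Pol n where
  toFun := D k
  map_add' f g := by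
    have : divDiff k (f + g) = divDiff k f + divDiff k g := divDiff_unique (by
      rw [mul_add, mul_divDiff, mul_divDiff, S, S, S, map_add]
      ring)
    simp only [D, this, mul_add]
  map_smul' c f := by
    have : divDiff k (c • f) = c • divDiff k f := divDiff_unique (by
      rw [mul_smul_comm, mul_divDiff, S, S, map_smul, smul_sub])
    simp only [D, this, mul_smul_comm, RingHom.id_apply]

/-- The operators `D_k` commute with cyclic permutations of the variables. -/
theorem D_rename_add (c k : ZMod (2 * n)) (f : Pol n) :
    D (k + c) (rename (· + c) f) = rename (· + c) (D k f) := by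
  have h1 : S (k + c) (rename (· + c) f) = rename (· + c) (S k f) := by
    unfold S
    rw [rename_rename, rename_rename]
    congr 2
    funext i
    simp only [Function.comp_apply, Equiv.swap_apply_def, add_right_comm k c 1, add_left_inj]
    split_ifs <;> rfl
  have h2 : divDiff (k + c) (rename (· + c) f) = rename (· + c) (divDiff k f) := by
    refine divDiff_unique ?_
    rw [h1, ← map_sub, ← mul_divDiff, map_mul, map_sub, rename_X, rename_X, add_right_comm]
  unfold D
  rw [h2, map_mul, map_sub, map_mul, map_mul, rename_C, rename_C, rename_X, rename_X,
    add_right_comm]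

section Eval

variable [NeZero n]

/-- The point number `i` of `Fin (2 * n)` carries the label `i + 1`. -/
noncomputable def label (n : ℕ) [NeZero n] : Fin (2 * n) ≃ ZMod (2 * n) :=
  Equiv.ofBijective (fun i => ((i + 1 : ℕ) : ZMod (2 * n))) <| by
    rw [Fintype.bijective_iff_injective_and_card, ZMod.card, Fintype.card_fin]
    refine ⟨fun i j h => ?_, rfl⟩
    rw [ZMod.natCast_eq_natCast_iff'] at h
    have h1 : (i : ℕ) % (2 * n) = j % (2 * n) :=
      Nat.ModEq.add_right_cancel' 1 h
    rw [Nat.mod_eq_of_lt i.is_lt, Nat.mod_eq_of_lt j.is_lt] at h1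
    exact Fin.ext h1

theorem label_apply (i : Fin (2 * n)) : label n i = ((i + 1 : ℕ) : ZMod (2 * n)) := rfl

theorem label_finRotate (i : Fin (2 * n)) : label n (finRotate (2 * n) i) = label n i + 1 := by
  rw [label_apply, label_apply, NCMatching.val_finRotate]
  split_ifs with h
  · rw [h, ZMod.natCast_self]
    simp
  · push_cast
    rfl

/-- Evaluation at a point whose coordinates are numbered linearly: `y i` is the value of the
variable with label `i + 1`. -/
noncomputable def ev (y : Fin (2 * n) → ℂ) : Pol n →+* ℂ :=
  eval fun k => y ((label n).symm k)

theorem ev_X (y : Fin (2 * n) → ℂ) (i : Fin (2 * n)) : ev y (X (label n i)) = y i := by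
  rw [ev, eval_X, Equiv.symm_apply_apply]

theorem ev_C (y : Fin (2 * n) → ℂ) (c : ℂ) : ev y (C c : Pol n) = c := eval_C _

theorem continuous_ev (f : Pol n) : Continuous fun y => ev y f :=
  (continuous_eval f).comp (continuous_pi fun _ => continuous_apply _)

theorem eq_zero_of_ev {f : Pol n} (h : ∀ y, ev y f = 0) : f = 0 := by
  refine MvPolynomial.funext fun z => ?_
  have := h (z ∘ label n)
  simp only [ev, Function.comp_apply, Equiv.apply_symm_apply] at this
  rw [this, map_zero]

theorem ev_rename_succ (y : Fin (2 * n) → ℂ) (f : Pol n) :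
    ev y (rename (· + 1) f) = ev (y ∘ finRotate (2 * n)) f := by
  unfold ev
  rw [eval_rename]
  congr 2
  funext k
  obtain ⟨i, rfl⟩ := (label n).surjective k
  simp only [Function.comp_apply]
  rw [← label_finRotate, Equiv.symm_apply_apply, Equiv.symm_apply_apply]

theorem ev_S (y : Fin (2 * n) → ℂ) (a : Fin (2 * n)) (f : Pol n) :
    ev y (S (label n a) f) = ev (y ∘ Equiv.swap a (finRotate (2 * n) a)) f := by
  unfold ev S
  rw [eval_rename]
  congr 2
  funext k
  obtain ⟨i, rfl⟩ := (label n).surjective k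
  simp only [Function.comp_apply]
  rw [← label_finRotate, ← (label n).injective.map_swap, Equiv.symm_apply_apply,
    Equiv.symm_apply_apply]

theorem ev_D (y : Fin (2 * n) → ℂ) (a : Fin (2 * n)) (f : Pol n) :
    ev y (D (label n a) f) = (q * y a - q⁻¹ * y (finRotate (2 * n) a)) *
      ev y (divDiff (label n a) f) := by
  rw [D, map_mul, map_sub, map_mul, map_mul, ev_C, ev_C, ← label_finRotate, ev_X, ev_X]

/-- The definition of `D_a`, cleared of denominators. -/
theorem mul_ev_D (y : Fin (2 * n) → ℂ) (a : Fin (2 * n)) (f : Pol n) :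
    (y (finRotate (2 * n) a) - y a) * ev y (D (label n a) f) =
      (q * y a - q⁻¹ * y (finRotate (2 * n) a)) *
        (ev (y ∘ Equiv.swap a (finRotate (2 * n) a)) f - ev y f) := by
  rw [ev_D, ← ev_S, ← map_sub, ← mul_divDiff, map_mul, map_sub, ← label_finRotate, ev_X, ev_X]
  ring

theorem eq_zero_of_finite_compl {φ : ℂ → ℂ} (hφ : Continuous φ) {s : Set ℂ} (hs : s.Finite)
    (h : ∀ x ∉ s, φ x = 0) (x : ℂ) : φ x = 0 := by
  have h1 : Dense sᶜ := hs.countable.dense_compl ℂ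
  exact congrFun (Continuous.ext_on h1 hφ continuous_const fun x hx => h x hx) x

/-! ### The wheel condition -/

/-- The polynomials which have degree at most `n - 1` in each variable and satisfy the wheel
condition: they vanish whenever `z_j = q² z_i` and `z_k = q² z_j` for some `i < j < k`. -/
structure IsWheel (f : Pol n) : Prop where
  degreeOf_le : ∀ k, f.degreeOf k ≤ n - 1
  ev_eq_zero : ∀ (y : Fin (2 * n) → ℂ) (i j k : Fin (2 * n)), i < j → j < k →
    y j = q ^ 2 * y i → y k = q ^ 2 * y j → ev y f = 0

namespace IsWheel

/-- As `q ^ 6 = 1`, the wheel condition is invariant under cyclic permutations. -/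
theorem ev_eq_zero_of_cyclic {f : Pol n} (hf : IsWheel f) {y : Fin (2 * n) → ℂ}
    {i j k : Fin (2 * n)} (h : i < j ∧ j < k ∨ j < k ∧ k < i ∨ k < i ∧ i < j)
    (h1 : y j = q ^ 2 * y i) (h2 : y k = q ^ 2 * y j) : ev y f = 0 := by
  have h3 : y i = q ^ 2 * y k := by
    rw [h2, h1]
    linear_combination -(q ^ 3 + 1) * y i * q_pow_three
  rcases h with h | h | h
  · exact hf.ev_eq_zero y i j k h.1 h.2 h1 h2
  · exact hf.ev_eq_zero y j k i h.1 h.2 h2 h3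
  · exact hf.ev_eq_zero y k i j h.1 h.2 h3 h1

theorem zero : IsWheel (0 : Pol n) :=
  ⟨fun k => by simp, fun y i j k _ _ _ _ => map_zero _⟩

theorem add {f g : Pol n} (hf : IsWheel f) (hg : IsWheel g) : IsWheel (f + g) :=
  ⟨fun k => (degreeOf_add_le k f g).trans (max_le (hf.1 k) (hg.1 k)),
    fun y i j k h1 h2 h3 h4 => by
      rw [map_add, hf.2 y i j k h1 h2 h3 h4, hg.2 y i j k h1 h2 h3 h4, add_zero]⟩

theorem sub {f g : Pol n} (hf : IsWheel f) (hg : IsWheel g) : IsWheel (f - g) :=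
  ⟨fun k => (degreeOf_sub_le k f g).trans (max_le (hf.1 k) (hg.1 k)),
    fun y i j k h1 h2 h3 h4 => by
      rw [map_sub, hf.2 y i j k h1 h2 h3 h4, hg.2 y i j k h1 h2 h3 h4, sub_zero]⟩

theorem sum {ι : Type*} {s : Finset ι} {f : ι → Pol n} (hf : ∀ i ∈ s, IsWheel (f i)) :
    IsWheel (∑ i ∈ s, f i) :=
  Finset.sum_induction _ _ (fun _ _ => add) zero hf

theorem rename_succ {f : Pol n} (hf : IsWheel f) :
    IsWheel (rename (· + 1) f : Pol n) := by
  constructor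
  · intro k
    have := degreeOf_rename_of_injective (p := f) (add_left_injective (1 : ZMod (2 * n))) (k - 1)
    rw [sub_add_cancel] at this
    rw [this]
    exact hf.1 _
  · intro y i j k hij hjk h1 h2
    rw [ev_rename_succ]
    obtain ⟨i, rfl⟩ := (finRotate (2 * n)).surjective i
    obtain ⟨j, rfl⟩ := (finRotate (2 * n)).surjective j
    obtain ⟨k, rfl⟩ := (finRotate (2 * n)).surjective k
    refine hf.ev_eq_zero_of_cyclic (i := i) (j := j) (k := k) ?_ h1 h2
    rw [Fin.lt_def, NCMatching.val_finRotate, NCMatching.val_finRotate] at hij hjk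
    simp only [Fin.lt_def]
    split_ifs at * <;> omega

/-- The numerator `q z_k - q⁻¹ z_{k+1}` has the same degrees as the denominator `z_{k+1} - z_k`. -/
theorem degreeOf_D_le {f : Pol n} (hf : IsWheel f) (k i : ZMod (2 * n)) :
    (D k f).degreeOf i ≤ n - 1 := by
  by_cases h0 : divDiff k f = 0
  · rw [D, h0, mul_zero, degreeOf_zero]
    exact Nat.zero_le _
  have h1 := congrArg (degreeOf i) (mul_divDiff k f)
  rw [degreeOf_mul_eq (X_succ_sub_X_ne_zero k) h0] at h1
  have h2 : (S k f - f).degreeOf i ≤ n - 1 := by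
    refine (degreeOf_sub_le i _ _).trans (max_le ?_ (hf.1 i))
    have := degreeOf_rename_of_injective (p := f) (Equiv.swap k (k + 1)).injective
      (Equiv.swap k (k + 1) i)
    rw [Equiv.swap_apply_self] at this
    rw [S, this]
    exact hf.1 _
  have h3 : (C q * X k - C q⁻¹ * X (k + 1) : Pol n).degreeOf i ≤
      (X (k + 1) - X k : Pol n).degreeOf i := by
    have h4 : (if i = k ∨ i = k + 1 then 1 else 0) ≤
        (X (k + 1) - X k : Pol n).degreeOf i := by
      split_ifs with h
      · have h5 := add_one_ne_self k
        have h6 := degreeOf_add_le i (X (k + 1) - X k : Pol n) (X k)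
        have h7 := degreeOf_sub_le i (X (k + 1) : Pol n) (X (k + 1) - X k)
        rw [sub_add_cancel, degreeOf_X, degreeOf_X] at h6
        rw [sub_sub_cancel, degreeOf_X, degreeOf_X] at h7
        rcases h with rfl | rfl
        · rw [if_pos rfl, if_neg h5.symm] at h7
          omega
        · rw [if_pos rfl, if_neg h5] at h6
          omega
      · exact Nat.zero_le _
    refine le_trans ((degreeOf_sub_le i _ _).trans
      ((max_le_max (degreeOf_C_mul_le _ _ _) (degreeOf_C_mul_le _ _ _)).trans ?_)) h4
    rw [degreeOf_X, degreeOf_X]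
    split_ifs <;> simp_all
  have h4 := degreeOf_mul_le i (C q * X k - C q⁻¹ * X (k + 1) : Pol n) (divDiff k f)
  unfold D
  omega

theorem D_label {f : Pol n} (hf : IsWheel f) (a : Fin (2 * n)) :
    IsWheel (D (label n a) f) := by
  refine ⟨hf.degreeOf_D_le _, ?_⟩
  intro y i j k hij hjk h1 h2
  have hb := NCMatching.val_finRotate a
  have hba := NCMatching.finRotate_ne a
  by_cases hboth : (a = i ∨ a = j ∨ a = k) ∧
    (finRotate (2 * n) a = i ∨ finRotate (2 * n) a = j ∨ finRotate (2 * n) a = k)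
  · -- two cyclically adjacent points of the triple: the explicit factor of `D` vanishes
    have h3 : y (finRotate (2 * n) a) = q ^ 2 * y a := by
      have h4 : y i = q ^ 2 * y k := by
        rw [h2, h1]
        linear_combination -(q ^ 3 + 1) * y i * q_pow_three
      obtain ⟨ha, hb'⟩ := hboth
      generalize finRotate (2 * n) a = b at *
      have := k.is_lt
      have := b.is_lt
      rw [Fin.lt_def] at hij hjk
      rcases ha with rfl | rfl | rfl <;> rcases hb' with rfl | rfl | rfl <;>
        first | exact absurd rfl hba | assumption | (exfalso; split_ifs at hb <;> omega)
    rw [ev_D, h3, q_inv]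
    linear_combination -(q * y a * ev y (divDiff (label n a) f)) * q_pow_three
  · obtain ⟨c, o, hc, hci, hcj, hck⟩ : ∃ c o, (c = a ∧ o = finRotate (2 * n) a ∨
        c = finRotate (2 * n) a ∧ o = a) ∧ c ≠ i ∧ c ≠ j ∧ c ≠ k := by
      by_cases h3 : a = i ∨ a = j ∨ a = k
      · exact ⟨finRotate (2 * n) a, a, Or.inr ⟨rfl, rfl⟩, by tauto⟩
      · exact ⟨a, finRotate (2 * n) a, Or.inl ⟨rfl, rfl⟩, by tauto⟩
    have hco : o ≠ c := by
      rcases hc with ⟨rfl, rfl⟩ | ⟨rfl, rfl⟩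
      · exact hba
      · exact hba.symm
    -- perturb the coordinate of `{a, a + 1}` which does not occur in the triple
    have key : ∀ x, ev (Function.update y c x) (D (label n a) f) = 0 := by
      refine eq_zero_of_finite_compl ?_ (Set.finite_singleton (y o)) ?_
      · exact (continuous_ev _).comp (continuous_const.update c continuous_id)
      · intro x hx
        have h3 := mul_ev_D (Function.update y c x) a f
        have e1 : ev (Function.update y c x) f = 0 := by
          refine hf.ev_eq_zero _ i j k hij hjk ?_ ?_
          · rwa [Function.update_of_ne hcj.symm, Function.update_of_ne hci.symm]
          · rwa [Function.update_of_ne hck.symm, Function.update_of_ne hcj.symm]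
        have e2 : ev (Function.update y c x ∘ Equiv.swap a (finRotate (2 * n) a)) f = 0 := by
          refine hf.ev_eq_zero_of_cyclic (i := Equiv.swap a (finRotate (2 * n) a) i)
            (j := Equiv.swap a (finRotate (2 * n) a) j)
            (k := Equiv.swap a (finRotate (2 * n) a) k) ?_ ?_ ?_
          · clear e1 h3 h1 h2 hf hx
            generalize finRotate (2 * n) a = b at *
            simp only [Equiv.swap_apply_def, Fin.lt_def, Fin.ext_iff, apply_ite Fin.val] at *
            have := i.is_lt
            have := j.is_lt
            have := k.is_lt
            have := a.is_lt
            have := b.is_lt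
            split_ifs at * <;> omega
          · simp only [Function.comp_apply, Equiv.swap_apply_self]
            rwa [Function.update_of_ne hcj.symm, Function.update_of_ne hci.symm]
          · simp only [Function.comp_apply, Equiv.swap_apply_self]
            rwa [Function.update_of_ne hck.symm, Function.update_of_ne hcj.symm]
        rw [e1, e2, sub_zero, mul_zero, mul_eq_zero] at h3
        refine h3.resolve_left fun h4 => hx ?_
        rw [sub_eq_zero] at h4
        rcases hc with ⟨rfl, rfl⟩ | ⟨rfl, rfl⟩
        · rw [Function.update_self, Function.update_of_ne hco] at h4
          exact h4.symm
        · rw [Function.update_self, Function.update_of_ne hco] at h4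
          exact h4
    have := key (y c)
    rwa [Function.update_eq_self] at this

end IsWheel

end Eval

end WheelPoly

namespace WheelPoly

open MvPolynomial

variable {n : ℕ}

/-! ### Restriction to lines -/

/-- The degree of `f` along a line that moves the coordinates in `T` only. -/
theorem natDegree_aeval_le {σ : Type*} [Fintype σ] (f : MvPolynomial σ ℂ) {d : ℕ}
    (hf : ∀ i, f.degreeOf i ≤ d) (T : Finset σ) (z : σ → Polynomial ℂ)
    (h1 : ∀ i ∈ T, (z i).natDegree ≤ 1) (h0 : ∀ i ∉ T, (z i).natDegree = 0) :
    (aeval z f).natDegree ≤ d * T.card := by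
  classical
  rw [aeval_def, eval₂_eq']
  refine Polynomial.natDegree_sum_le_of_forall_le _ _ fun m hm => ?_
  rw [Polynomial.algebraMap_apply, Algebra.algebraMap_self_apply]
  refine (Polynomial.natDegree_C_mul_le _ _).trans ((Polynomial.natDegree_prod_le _ _).trans ?_)
  have h2 : ∀ i, (z i ^ m i).natDegree ≤ if i ∈ T then d else 0 := by
    intro i
    refine Polynomial.natDegree_pow_le.trans ?_
    split_ifs with h
    · exact (Nat.mul_le_mul ((monomial_le_degreeOf i hm).trans (hf i)) (h1 i h)).trans
        (Nat.mul_one d).le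
    · rw [h0 i h, mul_zero]
  refine (Finset.sum_le_sum fun i _ => h2 i).trans ?_
  rw [Finset.sum_ite_mem, Finset.univ_inter, Finset.sum_const, smul_eq_mul, mul_comm]

/-- A polynomial of degree at most `|s|` with the roots `r i` is a multiple of `∏ (X - r i)`; this
is the ratio of two of its values, cleared of denominators. -/
theorem eval_mul_prod_eq {ι : Type*} (p : Polynomial ℂ) (s : Finset ι) (r : ι → ℂ)
    (hr : Set.InjOn r s) (hs : p.natDegree ≤ s.card) (h0 : ∀ i ∈ s, p.eval (r i) = 0) (u v : ℂ) :
    p.eval u * ∏ i ∈ s, (v - r i) = p.eval v * ∏ i ∈ s, (u - r i) := by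
  classical
  by_cases hv : v ∈ s.image r
  · obtain ⟨i, hi, rfl⟩ := Finset.mem_image.1 hv
    rw [h0 i hi, zero_mul, Finset.prod_eq_zero hi (sub_self _), mul_zero]
  -- a polynomial in `u` of degree at most `|s|` with the roots `r i` and `v`
  let P : Polynomial ℂ := p * Polynomial.C (∏ i ∈ s, (v - r i)) -
    Polynomial.C (p.eval v) * ∏ i ∈ s, (Polynomial.X - Polynomial.C (r i))
  have hP : P.natDegree ≤ s.card := by
    refine (Polynomial.natDegree_sub_le _ _).trans (max_le ?_ ?_)
    · exact (Polynomial.natDegree_mul_C_le _ _).trans hs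
    · refine (Polynomial.natDegree_C_mul_le _ _).trans ?_
      rw [Polynomial.natDegree_prod_of_monic _ _ fun i _ => Polynomial.monic_X_sub_C _]
      simp
  have he : ∀ x, P.eval x = p.eval x * ∏ i ∈ s, (v - r i) - p.eval v * ∏ i ∈ s, (x - r i) := by
    intro x
    simp [P, Polynomial.eval_prod]
  have h1 : P = 0 := by
    refine Polynomial.eq_zero_of_natDegree_lt_card_of_eval_eq_zero' P (insert v (s.image r)) ?_ ?_
    · intro x hx
      rw [he]
      rcases Finset.mem_insert.1 hx with rfl | hx
      · ring
      · obtain ⟨i, hi, rfl⟩ := Finset.mem_image.1 hx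
        rw [h0 i hi, zero_mul, Finset.prod_eq_zero hi (sub_self _), mul_zero, sub_zero]
    · rw [Finset.card_insert_of_notMem hv, Finset.card_image_of_injOn hr]
      omega
  have h2 := he u
  rw [h1, Polynomial.eval_zero, eq_comm, sub_eq_zero] at h2
  exact h2

/-- The point obtained from `y` by replacing the coordinates `i ∈ T` by `α i * t`. -/
def line {N : ℕ} (y : Fin N → ℂ) (T : Finset (Fin N)) (α : Fin N → ℂ) (t : ℂ) (i : Fin N) : ℂ :=
  if i ∈ T then α i * t else y i

section Eval

variable [NeZero n]

theorem exists_polynomial_line {f : Pol n} (hf : ∀ k, f.degreeOf k ≤ n - 1)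
    (y : Fin (2 * n) → ℂ) (T : Finset (Fin (2 * n))) (α : Fin (2 * n) → ℂ) :
    ∃ p : Polynomial ℂ, p.natDegree ≤ (n - 1) * T.card ∧ ∀ t, p.eval t = ev (line y T α t) f := by
  let z : ZMod (2 * n) → Polynomial ℂ := fun k => if (label n).symm k ∈ T then
    Polynomial.C (α ((label n).symm k)) * Polynomial.X else Polynomial.C (y ((label n).symm k))
  have hT : ∀ k, k ∈ T.map (label n).toEmbedding ↔ (label n).symm k ∈ T := by
    intro k
    rw [Finset.mem_map_equiv]
  refine ⟨aeval z f, ?_, fun t => ?_⟩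
  · rw [← Finset.card_map (label n).toEmbedding]
    refine natDegree_aeval_le f hf _ z (fun k hk => ?_) fun k hk => ?_
    · rw [hT] at hk
      simp only [z, if_pos hk]
      exact (Polynomial.natDegree_C_mul_le _ _).trans Polynomial.natDegree_X_le
    · rw [hT] at hk
      simp only [z, if_neg hk, Polynomial.natDegree_C]
  · have h : (Polynomial.aeval t).comp (aeval z) =
        (aeval fun k => line y T α t ((label n).symm k) : Pol n →ₐ[ℂ] ℂ) := by
      ext k
      simp only [AlgHom.comp_apply, aeval_X, z, line]
      split_ifs <;> simp
    have h1 := DFunLike.congr_fun h f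
    rw [AlgHom.comp_apply, Polynomial.coe_aeval_eq_eval, aeval_eq_eval] at h1
    exact h1

namespace IsWheel

/-- If the restriction of `f` to a line has as many known zeros as its degree allows, it is
determined by them up to a scalar. -/
theorem ev_line_mul_prod {f : Pol n} (hf : IsWheel f) (y : Fin (2 * n) → ℂ)
    (T : Finset (Fin (2 * n))) (α : Fin (2 * n) → ℂ) {ι : Type*} (s : Finset ι) (r : ι → ℂ)
    (hr : Set.InjOn r s) (hs : (n - 1) * T.card ≤ s.card)
    (h0 : ∀ i ∈ s, ev (line y T α (r i)) f = 0) (u v : ℂ) :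
    ev (line y T α u) f * ∏ i ∈ s, (v - r i) = ev (line y T α v) f * ∏ i ∈ s, (u - r i) := by
  obtain ⟨p, hp, he⟩ := exists_polynomial_line hf.degreeOf_le y T α
  simp only [← he] at *
  exact eval_mul_prod_eq p s r hr (hp.trans hs) h0 u v

/-- If the restriction of `f` to a line has more zeros than its degree allows, it vanishes. -/
theorem ev_line_eq_zero {f : Pol n} (hf : IsWheel f) (y : Fin (2 * n) → ℂ)
    (T : Finset (Fin (2 * n))) (α : Fin (2 * n) → ℂ) {ι : Type*} (s : Finset ι) (r : ι → ℂ)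
    (hr : Set.InjOn r s) (hs : (n - 1) * T.card < s.card)
    (h0 : ∀ i ∈ s, ev (line y T α (r i)) f = 0) (u : ℂ) : ev (line y T α u) f = 0 := by
  classical
  obtain ⟨p, hp, he⟩ := exists_polynomial_line hf.degreeOf_le y T α
  simp only [← he] at *
  rw [Polynomial.eq_zero_of_natDegree_lt_card_of_eval_eq_zero' p (s.image r), Polynomial.eval_zero]
  · simpa using h0
  · rw [Finset.card_image_of_injOn hr]
    omega

/-! ### Zeros forced by the wheel condition -/

/-- A point outside of the arch `(l, m)`. -/
theorem ev_eq_zero_of_outside {f : Pol n} (hf : IsWheel f) {y : Fin (2 * n) → ℂ}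
    {l m p : Fin (2 * n)} (hlm : l < m) (h : y m = q ^ 2 * y l) (hp : p < l ∨ m < p)
    (h' : y p = q * y l) : ev y f = 0 := by
  rcases hp with hp | hp
  · refine hf.ev_eq_zero y p l m hp hlm ?_ h
    rw [h']
    linear_combination -y l * q_pow_three
  · refine hf.ev_eq_zero y l m p hlm hp h ?_
    rw [h', h]
    linear_combination -(q * y l) * q_pow_three

/-- Two noncrossing arches `(l, m)` and `(a, a')`. -/
theorem ev_eq_zero_of_arches {f : Pol n} (hf : IsWheel f) {y : Fin (2 * n) → ℂ}
    {l m a a' : Fin (2 * n)} (hlm : l < m) (h : y m = q ^ 2 * y l) (haa : a < a')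
    (h' : y a' = q ^ 2 * y a)
    (hp : (a < l ∨ m < a) ∧ (a' < l ∨ m < a') ∨ l < a ∧ a' < m)
    (hr : y a = q * y l ∨ y a = q ^ 2 * y l) : ev y f = 0 := by
  rcases hp with ⟨hp, hp'⟩ | ⟨hp, hp'⟩
  · rcases hr with hr | hr
    · exact hf.ev_eq_zero_of_outside hlm h hp hr
    · refine hf.ev_eq_zero_of_outside hlm h hp' ?_
      rw [h', hr]
      linear_combination (q * y l) * q_pow_three
  · rcases hr with hr | hr
    · refine hf.ev_eq_zero_of_outside haa h' (p := m) (Or.inr hp') ?_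
      rw [h, hr]
      ring
    · refine hf.ev_eq_zero_of_outside haa h' (p := l) (Or.inl hp) ?_
      rw [hr]
      linear_combination -(y l) * q_pow_three

end IsWheel

/-! ### Generic points -/

/-- The coordinates of `y` at the two endpoints of each arch of `g` differ by the factor `q²`. -/
def Compatible {N : ℕ} (g : Fin N → Fin N) (y : Fin N → ℂ) : Prop :=
  ∀ i, i < g i → y (g i) = q ^ 2 * y i

/-- The cubes of the coordinates belonging to different arches and fixed points of `g` are distinct,
and different from `0` and `1`. Cubes are used because they ignore factors `q`. -/
structure Generic {N : ℕ} (g : Fin N → Fin N) (y : Fin N → ℂ) : Prop where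
  ne_zero : ∀ i, y i ≠ 0
  cube_ne_one : ∀ i, y i ^ 3 ≠ 1
  cube_ne : ∀ i j, j ≠ i → j ≠ g i → y i ^ 3 ≠ y j ^ 3

/-- The cubes of two affine functions agree at finitely many points only, unless the cubes of the
leading coefficients coincide. -/
theorem finite_cube_eq {a b a' b' : ℂ} (h : b ^ 3 ≠ b' ^ 3) :
    {x : ℂ | (a + x * b) ^ 3 = (a' + x * b') ^ 3}.Finite := by
  let p : Polynomial ℂ := Polynomial.C (a ^ 3 - a' ^ 3) +
    Polynomial.C (3 * a ^ 2 * b - 3 * a' ^ 2 * b') * Polynomial.X +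
    Polynomial.C (3 * a * b ^ 2 - 3 * a' * b' ^ 2) * Polynomial.X ^ 2 +
    Polynomial.C (b ^ 3 - b' ^ 3) * Polynomial.X ^ 3
  have hp : p ≠ 0 := by
    intro h1
    have h2 := congrArg (fun p => Polynomial.coeff p 3) h1
    simp only [p, Polynomial.coeff_add, Polynomial.coeff_C_mul, Polynomial.coeff_C,
      Polynomial.coeff_X, Polynomial.coeff_X_pow, Polynomial.coeff_zero] at h2
    norm_num at h2
    exact h (sub_eq_zero.1 h2)
  refine (Polynomial.finite_setOfPred_isRoot hp).subset fun x hx => ?_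
  rw [Set.mem_ofPred_eq] at hx ⊢
  simp only [p, Polynomial.IsRoot.def, Polynomial.eval_add, Polynomial.eval_mul,
    Polynomial.eval_C, Polynomial.eval_X, Polynomial.eval_pow]
  linear_combination hx

/-- A continuous function which vanishes at all generic compatible points vanishes at all compatible
points. -/
theorem eq_zero_of_generic {N : ℕ} {g : Fin N → Fin N} (hg : ∀ i, g (g i) = i)
    {Φ : (Fin N → ℂ) → ℂ} (hΦ : Continuous Φ) (h : ∀ y, Compatible g y → Generic g y → Φ y = 0)
    {y : Fin N → ℂ} (hy : Compatible g y) : Φ y = 0 := by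
  -- move in a compatible direction with distinct absolute values
  let c : Fin N → ℂ := fun i => ((min (i : ℕ) (g i) + 1 : ℕ) : ℂ) * if g i < i then q ^ 2 else 1
  have hc : Compatible g c := by
    intro i hi
    simp only [c, hg, if_pos hi, if_neg (lt_asymm hi), min_comm (g i : ℕ)]
    ring
  have hc3 : ∀ i, c i ^ 3 = (((min (i : ℕ) (g i) + 1) ^ 3 : ℕ) : ℂ) := by
    intro i
    simp only [c]
    rw [mul_pow]
    split_ifs
    · rw [← pow_mul, pow_mul', q_pow_three, one_pow]
      push_cast
      ring
    · push_cast
      ring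
  have hfin : {x : ℂ | ¬ Generic g (fun i => y i + x * c i)}.Finite := by
    have h0 : ∀ i, c i ^ 3 ≠ 0 ^ 3 := by
      intro i
      rw [hc3, zero_pow (by norm_num), Nat.cast_ne_zero]
      positivity
    have h1 : ∀ i j, j ≠ i → j ≠ g i → c i ^ 3 ≠ c j ^ 3 := by
      intro i j hj hj' h2
      rw [hc3, hc3, Nat.cast_inj] at h2
      have h3 := Nat.pow_left_injective (n := 3) (by norm_num) h2
      have h4 : g j ≠ i := fun h4 => hj' (by rw [← h4, hg])
      have h5 : g i ≠ g j := fun h5 => hj (by rw [← hg j, ← h5, hg])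
      simp only [Ne, Fin.ext_iff] at *
      omega
    refine Set.Finite.subset (((Set.finite_iUnion fun i => finite_cube_eq (a := y i) (a' := 0)
      (h0 i)).union (Set.finite_iUnion fun i => finite_cube_eq (a := y i) (a' := 1) (h0 i))).union
      (Set.finite_iUnion fun i => Set.finite_iUnion fun j => Set.finite_iUnion
        fun hj : j ≠ i => Set.finite_iUnion fun hj' : j ≠ g i =>
          finite_cube_eq (a := y i) (a' := y j) (h1 i j hj hj'))) fun x hx => ?_
    by_contra hx'
    simp only [Set.mem_union, Set.mem_iUnion, Set.mem_ofPred_eq, mul_zero, add_zero, not_or,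
      not_exists] at hx'
    refine hx ⟨fun i h2 => hx'.1.1 i (by rw [h2]), fun i h2 => hx'.1.2 i (by rw [h2, one_pow]),
      fun i j hj hj' => hx'.2 i j hj hj'⟩
  have h2 := eq_zero_of_finite_compl (φ := fun x => Φ fun i => y i + x * c i)
    (hΦ.comp (by fun_prop)) hfin (fun x hx => ?_) 0
  · simpa using h2
  · refine h _ (fun i hi => ?_) (not_not.1 hx)
    rw [hy i hi, hc i hi]
    ring

end Eval

end WheelPoly

namespace WheelPoly

open MvPolynomial NCMatching

variable {n : ℕ}

/-! ### Points compatible with a matching -/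

theorem eq_of_partner_eq {N : ℕ} {g : Fin N → Fin N} (hg : ∀ i, g (g i) = i) {i j : Fin N}
    (h : g i = g j) : i = j := by
  rw [← hg i, h, hg]

theorem Compatible.right {N : ℕ} {g : Fin N → Fin N} {y : Fin N → ℂ} (hg : ∀ i, g (g i) = i)
    (hy : Compatible g y) {i : Fin N} (h : g i < i) : y i = q ^ 2 * y (g i) := by
  have := hy (g i) (by rwa [hg])
  rwa [hg] at this

theorem cube_q_mul (x : ℂ) : (q * x) ^ 3 = x ^ 3 := by
  rw [mul_pow, q_pow_three, one_mul]

theorem cube_q_sq_mul (x : ℂ) : (q ^ 2 * x) ^ 3 = x ^ 3 := by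
  rw [mul_pow, ← pow_mul, pow_mul', q_pow_three, one_pow, one_mul]

theorem q_mul_ne_q_sq_mul {x : ℂ} (hx : x ≠ 0) : q * x ≠ q ^ 2 * x := fun h =>
  q_sq_ne_q (mul_right_cancel₀ hx h).symm

/-- The point attached to a matching: `q⁻¹` at left endpoints, `q` at right endpoints. -/
noncomputable def orientation (σ : NCMatching n) (i : Fin (2 * n)) : ℂ :=
  if i < σ.partner i then q⁻¹ else q

theorem compatible_orientation (σ : NCMatching n) : Compatible σ.partner (orientation σ) := by
  intro i hi
  rw [orientation, orientation, if_pos hi, σ.partner_partner, if_neg (lt_asymm hi), sq, mul_assoc,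
    mul_inv_cancel₀ q_ne_zero, mul_one]

/-! ### Noncrossing partial matchings -/

/-- A noncrossing partial matching without unmatched points (fixed points of `g`) under its
arches. -/
structure IsPartialMatching {N : ℕ} (g : Fin N → Fin N) : Prop where
  invol : ∀ i, g (g i) = i
  closed : ∀ i j, i < j → j < g i → g j ≠ j ∧ g j < g i

namespace IsPartialMatching

variable {N : ℕ} {g : Fin N → Fin N}

theorem fixed_outside (hg : IsPartialMatching g) {p l : Fin N} (hp : g p = p) (hl : l < g l) :
    p < l ∨ g l < p := by
  have h1 := hg.closed l p
  have h2 : p ≠ l := by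
    rintro rfl
    exact absurd hl (by rw [hp]; exact lt_irrefl _)
  have h3 : p ≠ g l := by
    rintro rfl
    rw [hg.invol] at hp
    exact hl.ne hp
  by_contra! h4
  exact (h1 (lt_of_le_of_ne h4.1 h2.symm) (lt_of_le_of_ne h4.2 h3)).1 hp

/-- Of two different arches, the second has both endpoints outside of the first one or lies under
it. -/
theorem arches (hg : IsPartialMatching g) {l a : Fin N} (hl : l < g l) (ha : a < g a)
    (h : a ≠ l) : (a < l ∨ g l < a) ∧ (g a < l ∨ g l < g a) ∨ l < a ∧ g a < g l := by
  have h1 := hg.closed l a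
  have h2 := hg.closed a l
  have h3 : a ≠ g l := by
    rintro rfl
    rw [hg.invol] at ha
    exact lt_asymm hl ha
  have h4 : g a ≠ l := by
    rintro rfl
    rw [hg.invol] at hl
    exact lt_asymm hl ha
  have h5 : g a ≠ g l := fun h5 => h (eq_of_partner_eq hg.invol h5)
  simp only [Ne, Fin.ext_iff, Fin.lt_def] at *
  omega

theorem _root_.NCMatching.isPartialMatching (σ : NCMatching n) : IsPartialMatching σ.partner :=
  ⟨σ.partner_partner, fun i j h1 h2 => ⟨σ.partner_ne j, σ.noncrossing i j h1 h2⟩⟩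

theorem id : IsPartialMatching (id : Fin N → Fin N) :=
  ⟨fun _ => rfl, fun _ _ h1 h2 => absurd h1 (lt_asymm h2)⟩

/-- Connecting two consecutive unmatched points. -/
theorem comp_swap (hg : IsPartialMatching g) {p p' : Fin N} (hp : g p = p) (hp' : g p' = p')
    (hlt : p < p') (h : ∀ i, p < i → i < p' → g i ≠ i) :
    IsPartialMatching (g ∘ Equiv.swap p p') := by
  have h0 : ∀ i, (g ∘ Equiv.swap p p') i = if i = p then p' else if i = p' then p else g i := by
    intro i
    rw [Function.comp_apply, Equiv.swap_apply_def]
    split_ifs <;> simp [hp, hp']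
  have h1 : ∀ i, i ≠ p → g i ≠ p := fun i hi h2 => hi (by rw [← hg.invol i, h2, hp])
  have h2 : ∀ i, i ≠ p' → g i ≠ p' := fun i hi h2 => hi (by rw [← hg.invol i, h2, hp'])
  constructor
  · intro i
    rw [h0, h0 i]
    by_cases hi : i = p
    · rw [if_pos hi, if_neg hlt.ne', if_pos rfl, hi]
    by_cases hi' : i = p'
    · rw [if_neg hi, if_pos hi', if_pos rfl, hi']
    rw [if_neg hi, if_neg hi', if_neg (h1 i hi), if_neg (h2 i hi'), hg.invol]
  · intro i j hij hj
    rw [h0] at hj ⊢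
    rw [h0]
    by_cases hi : i = p
    · rw [if_pos hi] at hj ⊢
      have hjp : j ≠ p := fun h3 => by rw [hi, h3] at hij; exact lt_irrefl _ hij
      rw [if_neg hjp, if_neg hj.ne]
      refine ⟨h j (hi ▸ hij) hj, ?_⟩
      by_contra h3
      rcases hg.fixed_outside hp' (l := j) (hj.trans_le (not_lt.1 h3)) with h4 | h4
      · exact lt_asymm h4 hj
      · exact h3 h4
    by_cases hi' : i = p'
    · rw [if_neg hi, if_pos hi'] at hj
      rw [hi'] at hij
      exact absurd (hij.trans hj) (lt_asymm hlt)
    rw [if_neg hi, if_neg hi'] at hj ⊢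
    have h3 := hg.closed i j hij hj
    have hjp : j ≠ p := fun h4 => h3.1 (by rw [h4, hp])
    have hjp' : j ≠ p' := fun h4 => h3.1 (by rw [h4, hp'])
    rwa [if_neg hjp, if_neg hjp']

end IsPartialMatching

/-- An involution of `2n` points with a fixed point `p` has at least `n` other points which are
unmatched or left endpoints. -/
theorem card_fixed_or_left {g : Fin (2 * n) → Fin (2 * n)} (hg : ∀ i, g (g i) = i)
    {p : Fin (2 * n)} (hp : g p = p) :
    n ≤ (Finset.univ.filter fun i => i ≠ p ∧ (g i = i ∨ i < g i)).card := by
  have h1 : (Finset.univ.filter fun i => g i < i).card ≤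
      (Finset.univ.filter fun i => i ≠ p ∧ (g i = i ∨ i < g i)).card := by
    refine Finset.card_le_card_of_injOn g (fun i hi => ?_) fun i _ j _ h => eq_of_partner_eq hg h
    simp only [Finset.coe_filter, Finset.mem_univ, true_and, Set.mem_ofPred_eq] at hi ⊢
    refine ⟨fun h => ?_, Or.inr (by rwa [hg])⟩
    have h2 : i = p := by rw [← hg i, h, hp]
    rw [h2, hp] at hi
    exact lt_irrefl _ hi
  have h2 : (Finset.univ : Finset (Fin (2 * n))) = insert p
      ((Finset.univ.filter fun i => g i < i) ∪
        Finset.univ.filter fun i => i ≠ p ∧ (g i = i ∨ i < g i)) := by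
    ext i
    simp only [Finset.mem_univ, Finset.mem_insert, Finset.mem_union, Finset.mem_filter, true_and,
      true_iff]
    by_cases h3 : i = p
    · exact Or.inl h3
    · rcases lt_trichotomy (g i) i with h4 | h4 | h4
      · exact Or.inr (Or.inl h4)
      · exact Or.inr (Or.inr ⟨h3, Or.inl h4⟩)
      · exact Or.inr (Or.inr ⟨h3, Or.inr h4⟩)
  have h3 := congrArg Finset.card h2
  rw [Finset.card_univ, Fintype.card_fin] at h3
  have h4 := Finset.card_insert_le p ((Finset.univ.filter fun i => g i < i) ∪
        Finset.univ.filter fun i => i ≠ p ∧ (g i = i ∨ i < g i))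
  have h5 := Finset.card_union_le (Finset.univ.filter fun i => g i < i)
    (Finset.univ.filter fun i => i ≠ p ∧ (g i = i ∨ i < g i))
  omega

section Eval

variable [NeZero n]

namespace IsWheel

/-! ### A polynomial satisfying the wheel condition is determined by its values at matchings -/

/-- Rescaling an arch of a matching changes the value of `f` by an explicit factor: every endpoint
of another arch forces a zero, and these `2n - 2` zeros exhaust the degree. -/
theorem ev_line_arch {f : Pol n} (hf : IsWheel f) (σ : NCMatching n) {a : Fin (2 * n)}
    (ha : a < σ.partner a) {y : Fin (2 * n) → ℂ} (hy : Compatible σ.partner y) (u v : ℂ) :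
    ev (line y {a, σ.partner a} (fun i => if i = a then 1 else q ^ 2) u) f *
        ∏ i ∈ {a, σ.partner a}ᶜ, (v - if i < σ.partner i then q * y i else y i) =
      ev (line y {a, σ.partner a} (fun i => if i = a then 1 else q ^ 2) v) f *
        ∏ i ∈ {a, σ.partner a}ᶜ, (u - if i < σ.partner i then q * y i else y i) := by
  have hline : ∀ t, Continuous fun y : Fin (2 * n) → ℂ =>
      ev (line y {a, σ.partner a} (fun i => if i = a then 1 else q ^ 2) t) f := by
    intro t
    refine (continuous_ev f).comp (continuous_pi fun i => ?_)
    unfold line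
    split_ifs <;> fun_prop
  have hprod : ∀ t, Continuous fun y : Fin (2 * n) → ℂ =>
      ∏ i ∈ {a, σ.partner a}ᶜ, (t - if i < σ.partner i then q * y i else y i) := by
    intro t
    refine continuous_finsetProd _ fun i _ => ?_
    split_ifs <;> fun_prop
  rw [← sub_eq_zero]
  refine eq_zero_of_generic (g := σ.partner) (Φ := fun y => _ * _ - _ * _) σ.partner_partner
    (((hline u).mul (hprod v)).sub ((hline v).mul (hprod u))) (fun y hy hgen => ?_) hy
  rw [sub_eq_zero]
  refine hf.ev_line_mul_prod y _ _ _ _ ?_ ?_ ?_ u v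
  · intro i hi j hj hij
    dsimp only at hij
    by_contra hne
    have hc : ∀ i, (if i < σ.partner i then q * y i else y i) ^ 3 = y i ^ 3 := by
      intro i
      split_ifs
      · exact cube_q_mul _
      · rfl
    have h1 : j = σ.partner i := by
      by_contra h2
      exact hgen.cube_ne i j (Ne.symm hne) h2 (by rw [← hc, ← hc j, hij])
    subst h1
    rw [σ.partner_partner] at hij
    rcases lt_or_gt_of_ne (σ.partner_ne i) with h2 | h2
    · rw [if_neg (lt_asymm h2), if_pos h2, hy.right σ.partner_partner h2] at hij
      exact q_mul_ne_q_sq_mul (hgen.ne_zero _) hij.symm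
    · rw [if_neg (lt_asymm h2), if_pos h2, hy i h2] at hij
      exact q_mul_ne_q_sq_mul (hgen.ne_zero _) hij
  · rw [Finset.card_compl, Fintype.card_fin, Finset.card_pair ha.ne]
    omega
  · intro i hi
    simp only [Finset.mem_compl, Finset.mem_insert, Finset.mem_singleton, not_or] at hi
    have hi' : σ.partner i ≠ a := fun h => hi.2 (by rw [← h, σ.partner_partner])
    have hi'' : σ.partner i ≠ σ.partner a := fun h => hi.1 (σ.partner_inj.1 h)
    have e0 : ∀ t j, j ≠ a → j ≠ σ.partner a →
        line y {a, σ.partner a} (fun i => if i = a then 1 else q ^ 2) t j = y j := by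
      intro t j h1 h2
      rw [line, if_neg]
      simp [h1, h2]
    have e1 : ∀ t, line y {a, σ.partner a} (fun i => if i = a then 1 else q ^ 2) t a = t := by
      intro t
      simp [line]
    have e2 : ∀ t, line y {a, σ.partner a} (fun i => if i = a then 1 else q ^ 2) t
        (σ.partner a) = q ^ 2 * t := by
      intro t
      simp [line, ha.ne']
    rcases lt_or_gt_of_ne (σ.partner_ne i) with h2 | h2
    · have h3 := σ.partner_partner i
      have h4 : σ.partner i < σ.partner (σ.partner i) := by rwa [h3]
      rw [if_neg (lt_asymm h2)]
      refine hf.ev_eq_zero_of_arches h4 ?_ ha ?_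
        (σ.isPartialMatching.arches h4 ha hi'.symm) (Or.inr ?_)
      · rw [h3, e0 _ _ hi.1 hi.2, e0 _ _ hi' hi'', hy.right σ.partner_partner h2]
      · rw [e1, e2]
      · rw [e1, e0 _ _ hi' hi'', hy.right σ.partner_partner h2]
    · rw [if_pos h2]
      refine hf.ev_eq_zero_of_arches h2 ?_ ha ?_
        (σ.isPartialMatching.arches h2 ha (Ne.symm hi.1)) (Or.inl ?_)
      · rw [e0 _ _ hi.1 hi.2, e0 _ _ hi' hi'', hy i h2]
      · rw [e1, e2]
      · rw [e1, e0 _ _ hi.1 hi.2]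

/-- The value at the point attached to `σ` determines the values at all points compatible with
`σ`. -/
theorem ev_eq_zero_of_compatible {f : Pol n} (hf : IsWheel f) (σ : NCMatching n)
    (h0 : ev (orientation σ) f = 0) {y : Fin (2 * n) → ℂ} (hy : Compatible σ.partner y) :
    ev y f = 0 := by
  -- rescale the arches one at a time; `T` contains the arches already rescaled
  have key : ∀ (T : Finset (Fin (2 * n))) (y : Fin (2 * n) → ℂ), Compatible σ.partner y →
      (∀ l, l < σ.partner l → l ∉ T → y l = q⁻¹) →
      (∀ l ∈ T, l < σ.partner l → y l ^ 3 ≠ 1) → ev y f = 0 := by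
    intro T
    induction T using Finset.induction_on with
    | empty =>
      intro y hy h1 _
      have : y = orientation σ := by
        funext i
        have h2 := compatible_orientation σ
        rcases lt_or_gt_of_ne (σ.partner_ne i) with h3 | h3
        · have h4 : σ.partner i < σ.partner (σ.partner i) := by rwa [σ.partner_partner]
          rw [hy.right σ.partner_partner h3, h2.right σ.partner_partner h3,
            h1 _ h4 (by simp), orientation, if_pos h4]
        · rw [h1 i h3 (by simp), orientation, if_pos h3]
      rw [this, h0]
    | insert a T haT ih =>
      intro y hy h1 h2
      by_cases ha : a < σ.partner a
      swap
      · exact ih y hy (fun l hl hlT => h1 l hl fun h3 => by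
          rcases Finset.mem_insert.1 h3 with rfl | h3
          · exact ha hl
          · exact hlT h3) fun l hl => h2 l (Finset.mem_insert_of_mem hl)
      have h3 := hf.ev_line_arch σ ha hy (y a) q⁻¹
      have e1 : line y {a, σ.partner a} (fun i => if i = a then 1 else q ^ 2) (y a) = y := by
        funext i
        by_cases h4 : i = a
        · simp [line, h4]
        by_cases h5 : i = σ.partner a
        · simp [line, h5, ha.ne', hy a ha]
        · simp [line, h4, h5]
      have e2 : ev (line y {a, σ.partner a} (fun i => if i = a then 1 else q ^ 2) q⁻¹) f = 0 := by
        refine ih _ (fun i hi => ?_) (fun l hl hlT => ?_) fun l hlT hl => ?_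
        · by_cases h4 : i = a
          · subst h4
            simp [line, ha.ne']
          · have h5 : σ.partner i ≠ σ.partner a := fun h5 => h4 (σ.partner_inj.1 h5)
            have h6 : i ≠ σ.partner a := by
              rintro rfl
              rw [σ.partner_partner] at hi
              exact lt_asymm ha hi
            have h7 : σ.partner i ≠ a := fun h7 => h6 (by rw [← h7, σ.partner_partner])
            simp [line, h4, h5, h6, h7, hy i hi]
        · by_cases h4 : l = a
          · subst h4
            simp [line]
          · have h6 : l ≠ σ.partner a := by
              rintro rfl
              rw [σ.partner_partner] at hl
              exact lt_asymm ha hl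
            simp [line, h4, h6, h1 l hl (by simp [h4, hlT])]
        · have h4 : l ≠ a := fun h4 => haT (h4 ▸ hlT)
          have h6 : l ≠ σ.partner a := by
            rintro rfl
            rw [σ.partner_partner] at hl
            exact lt_asymm ha hl
          simpa [line, h4, h6] using h2 l (Finset.mem_insert_of_mem hlT) hl
      rw [e1, e2, zero_mul, mul_eq_zero] at h3
      refine h3.resolve_right fun h4 => ?_
      obtain ⟨i, hi, h5⟩ := Finset.prod_eq_zero_iff.1 h4
      simp only [Finset.mem_compl, Finset.mem_insert, Finset.mem_singleton, not_or] at hi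
      rw [sub_eq_zero] at h5
      -- none of the roots is `q⁻¹`
      have h6 : ∀ l, l < σ.partner l → l ≠ a → q⁻¹ ≠ q * y l ∧ q⁻¹ ≠ q ^ 2 * y l := by
        intro l hl hla
        by_cases hlT : l ∈ T
        · have h7 := h2 l (Finset.mem_insert_of_mem hlT) hl
          constructor
          · intro h8
            apply h7
            rw [← cube_q_mul, ← h8, inv_pow, q_pow_three, inv_one]
          · intro h8
            apply h7
            rw [← cube_q_sq_mul, ← h8, inv_pow, q_pow_three, inv_one]
        · rw [h1 l hl (by simp [hla, hlT]), q_inv]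
          constructor
          · rw [← pow_succ', q_pow_three]
            exact q_sq_ne_one
          · intro h8
            apply q_sq_ne_q
            rw [h8]
            linear_combination q * q_pow_three
      rcases lt_or_gt_of_ne (σ.partner_ne i) with h7 | h7
      · rw [if_neg (lt_asymm h7), hy.right σ.partner_partner h7] at h5
        exact (h6 (σ.partner i) (by rwa [σ.partner_partner])
          fun h => hi.2 (by rw [← h, σ.partner_partner])).2 h5
      · rw [if_pos h7] at h5
        exact (h6 i h7 hi.1).1 h5
  exact eq_zero_of_generic σ.partner_partner (continuous_ev f) (fun y hy hgen =>
    key Finset.univ y hy (fun l _ hl => absurd (Finset.mem_univ l) hl)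
      fun l _ _ => hgen.cube_ne_one l) hy

/-- Suppose that `f` vanishes whenever two consecutive unmatched points of `g` are connected.
Then it vanishes on connecting any two unmatched points: the restriction to the arch has too many
zeros, by induction on the distance of the points. -/
theorem ev_eq_zero_of_pair {f : Pol n} (hf : IsWheel f) {g : Fin (2 * n) → Fin (2 * n)}
    (hg : IsPartialMatching g)
    (h0 : ∀ p p', g p = p → g p' = p' → p < p' → (∀ i, p < i → i < p' → g i ≠ i) →
      ∀ y, Compatible (g ∘ Equiv.swap p p') y → ev y f = 0) (d : ℕ) :
    ∀ p p', g p = p → g p' = p' → p < p' → (p' : ℕ) - p = d →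
      ∀ y, Compatible g y → y p' = q ^ 2 * y p → ev y f = 0 := by
  induction d using Nat.strong_induction_on with
  | _ d ih =>
  intro p p' hp hp' hlt hd y hy hyp
  have hg' : ∀ i, (g ∘ Equiv.swap p p') i = if i = p then p' else if i = p' then p else g i := by
    intro i
    rw [Function.comp_apply, Equiv.swap_apply_def]
    split_ifs <;> simp [hp, hp']
  have hnp : ∀ i, i ≠ p → g i ≠ p := fun i hi h2 => hi (by rw [← hg.invol i, h2, hp])
  have hnp' : ∀ i, i ≠ p' → g i ≠ p' := fun i hi h2 => hi (by rw [← hg.invol i, h2, hp'])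
  have hcomp : Compatible (g ∘ Equiv.swap p p') y := by
    intro i hi
    rw [hg'] at hi ⊢
    by_cases h1 : i = p
    · rw [if_pos h1, hyp, h1]
    by_cases h2 : i = p'
    · rw [if_neg h1, if_pos h2, h2] at hi
      exact absurd hlt (lt_asymm hi)
    rw [if_neg h1, if_neg h2] at hi ⊢
    exact hy i hi
  by_cases hadj : ∀ i, p < i → i < p' → g i ≠ i
  · exact h0 p p' hp hp' hlt hadj y hcomp
  push Not at hadj
  obtain ⟨o, hpo, hop', ho⟩ := hadj
  have hinv : ∀ i, (g ∘ Equiv.swap p p') ((g ∘ Equiv.swap p p') i) = i := by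
    intro i
    rw [hg', hg' i]
    by_cases hi : i = p
    · rw [if_pos hi, if_neg hlt.ne', if_pos rfl, hi]
    by_cases hi' : i = p'
    · rw [if_neg hi, if_pos hi', if_pos rfl, hi']
    rw [if_neg hi, if_neg hi', if_neg (hnp i hi), if_neg (hnp' i hi'), hg.invol]
  clear hyp hy
  refine eq_zero_of_generic hinv (continuous_ev f) (fun y hcomp hgen => ?_) hcomp
  have hy : Compatible g y := by
    intro i hi
    have h1 : i ≠ p := by
      rintro rfl
      rw [hp] at hi
      exact lt_irrefl _ hi
    have h2 : i ≠ p' := by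
      rintro rfl
      rw [hp'] at hi
      exact lt_irrefl _ hi
    have h3 := hcomp i
    rw [hg', if_neg h1, if_neg h2] at h3
    exact h3 hi
  have hyp : y p' = q ^ 2 * y p := by
    have h3 := hcomp p
    rw [hg', if_pos rfl] at h3
    exact h3 hlt
  have e1 : line y {p, p'} (fun i => if i = p then 1 else q ^ 2) (y p) = y := by
    funext i
    by_cases h4 : i = p
    · simp [line, h4]
    by_cases h5 : i = p'
    · simp [line, h5, hlt.ne', hyp]
    · simp [line, h4, h5]
  rw [← e1]
  have l0 : ∀ t j, j ≠ p → j ≠ p' →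
      line y {p, p'} (fun i => if i = p then 1 else q ^ 2) t j = y j := by
    intro t j h1 h2
    rw [line, if_neg]
    simp [h1, h2]
  have l1 : ∀ t, line y {p, p'} (fun i => if i = p then 1 else q ^ 2) t p = t := by
    intro t
    simp [line]
  have l2 : ∀ t, line y {p, p'} (fun i => if i = p then 1 else q ^ 2) t p' = q ^ 2 * t := by
    intro t
    simp [line, hlt.ne']
  have lc : ∀ t, Compatible g (line y {p, p'} (fun i => if i = p then 1 else q ^ 2) t) := by
    intro t i hi
    have h1 : i ≠ p := by
      rintro rfl
      rw [hp] at hi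
      exact lt_irrefl _ hi
    have h2 : i ≠ p' := by
      rintro rfl
      rw [hp'] at hi
      exact lt_irrefl _ hi
    rw [l0 _ _ h1 h2, l0 _ _ (hnp i h1) (hnp' i h2), hy i hi]
  -- one zero for every other point, and another one for the unmatched point `o` in between
  let r : Option (Fin (2 * n)) → ℂ := fun x => x.elim (q * y o) fun i =>
    if g i = i then if p < i ∧ i < p' then y i else q ^ 2 * y i
    else if i < g i then q * y i else y i
  have hr3 : ∀ i, r (some i) ^ 3 = y i ^ 3 := by
    intro i
    simp only [r, Option.elim_some]
    split_ifs
    · rfl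
    · exact cube_q_sq_mul _
    · exact cube_q_mul _
    · rfl
  have hmem : ∀ i, some i ∈ Finset.insertNone ({p, p'}ᶜ : Finset (Fin (2 * n))) →
      i ≠ p ∧ i ≠ p' := by
    intro i hi
    simpa using hi
  have hro : r (some o) = y o := by
    simp only [r, Option.elim_some]
    rw [if_pos ho, if_pos ⟨hpo, hop'⟩]
  have hrn : r none = q * y o := rfl
  have hne : ∀ i, i ≠ p → i ≠ p' → r (some i) ≠ q * y o := by
    intro i h1 h2 h3
    by_cases h4 : i = o
    · rw [h4, hro, eq_comm, mul_eq_right₀ (hgen.ne_zero o)] at h3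
      exact q_ne_one h3
    · refine hgen.cube_ne o i h4 ?_ ?_
      · rwa [hg', if_neg hpo.ne', if_neg hop'.ne, ho]
      · rw [← hr3 i, h3, cube_q_mul]
  refine hf.ev_line_eq_zero y _ _ (Finset.insertNone ({p, p'}ᶜ : Finset (Fin (2 * n)))) r
    ?_ ?_ ?_ _
  · rintro (_ | i) hi (_ | j) hj hij
    · rfl
    · exact absurd hij.symm (hne j (hmem j hj).1 (hmem j hj).2)
    · exact absurd hij (hne i (hmem i hi).1 (hmem i hi).2)
    · obtain ⟨hi1, hi2⟩ := hmem i hi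
      rw [Option.some_inj]
      by_contra hne'
      have h1 : j = g i := by
        by_contra h2
        refine hgen.cube_ne i j (Ne.symm hne') ?_ (by rw [← hr3 i, hij, hr3])
        rwa [hg', if_neg hi1, if_neg hi2]
      subst h1
      simp only [r, Option.elim_some] at hij
      rw [if_neg (Ne.symm hne'), hg.invol, if_neg hne'] at hij
      rcases lt_or_gt_of_ne hne' with h2 | h2
      · rw [if_pos h2, if_neg (lt_asymm h2), hy i h2] at hij
        exact q_mul_ne_q_sq_mul (hgen.ne_zero _) hij
      · rw [if_neg (lt_asymm h2), if_pos h2, hy.right hg.invol h2] at hij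
        exact q_mul_ne_q_sq_mul (hgen.ne_zero _) hij.symm
  · rw [Finset.card_insertNone, Finset.card_compl, Fintype.card_fin, Finset.card_pair hlt.ne]
    omega
  · rintro (_ | i) hi
    · refine ih (o - p) (by rw [Fin.lt_def] at *; omega) p o hp ho hpo rfl _ (lc _) ?_
      rw [l1, l0 _ _ hpo.ne' hop'.ne, hrn]
      linear_combination -y o * q_pow_three
    · obtain ⟨hi1, hi2⟩ := hmem i hi
      simp only [r, Option.elim_some]
      split_ifs with h1 h2 h3
      · refine ih (p' - i) (by rw [Fin.lt_def, Fin.lt_def] at h2; omega) i p' h1 hp' h2.2 rfl _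
          (lc _) ?_
        rw [l2, l0 _ _ hi1 hi2]
      · refine hf.ev_eq_zero_of_outside hlt (by rw [l1, l2]) (p := i) ?_ ?_
        · by_contra! h3
          exact h2 ⟨lt_of_le_of_ne h3.1 hi1.symm, lt_of_le_of_ne h3.2 hi2⟩
        · rw [l0 _ _ hi1 hi2, l1]
          linear_combination -y i * q_pow_three
      · refine hf.ev_eq_zero_of_arches h3 (lc _ i h3) hlt (by rw [l1, l2])
          (Or.inl ⟨hg.fixed_outside hp h3, hg.fixed_outside hp' h3⟩) (Or.inl ?_)
        rw [l1, l0 _ _ hi1 hi2]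
      · have h4 : g i < i := lt_of_le_of_ne (not_lt.1 h3) h1
        have h5 : g i < g (g i) := by rwa [hg.invol]
        refine hf.ev_eq_zero_of_arches h5 (lc _ _ h5) hlt (by rw [l1, l2])
          (Or.inl ⟨hg.fixed_outside hp h5, hg.fixed_outside hp' h5⟩) (Or.inr ?_)
        rw [l1, l0 _ _ (hnp i hi1) (hnp' i hi2), hy.right hg.invol h4]

/-- Induction on the number `k` of unmatched points. If the first unmatched point `p` is moved, `f`
vanishes whenever `p` is connected with another unmatched point, and whenever `p` completes an arch
to a wheel; these are at least `n` zeros of a polynomial of degree at most `n - 1`. -/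
theorem ev_eq_zero_of_isPartialMatching {f : Pol n} (hf : IsWheel f)
    (h0 : ∀ σ, ev (orientation σ) f = 0) (k : ℕ) :
    ∀ g : Fin (2 * n) → Fin (2 * n), IsPartialMatching g →
      (Finset.univ.filter fun i => g i = i).card = k →
      ∀ y, Compatible g y → ev y f = 0 := by
  induction k using Nat.strong_induction_on with
  | _ k ih =>
  intro g hg hk y hy
  by_cases hfix : ∃ p, g p = p
  swap
  · push Not at hfix
    exact hf.ev_eq_zero_of_compatible ⟨g, hg.invol, hfix, fun i j h1 h2 => (hg.closed i j h1 h2).2⟩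
      (h0 _) hy
  -- the first unmatched point
  obtain ⟨p, hp, hmin⟩ : ∃ p, g p = p ∧ ∀ i, g i = i → p ≤ i := by
    have hne : (Finset.univ.filter fun i => g i = i).Nonempty := by
      obtain ⟨p, hp⟩ := hfix
      exact ⟨p, by simpa using hp⟩
    exact ⟨(Finset.univ.filter fun i => g i = i).min' hne,
      (Finset.mem_filter.1 (Finset.min'_mem _ hne)).2, fun i hi =>
        Finset.min'_le _ _ (by simpa using hi)⟩
  have hpair := fun d => hf.ev_eq_zero_of_pair hg (fun p p' hp hp' hlt hadj y hy => by
    refine ih _ ?_ _ (hg.comp_swap hp hp' hlt hadj) rfl y hy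
    rw [← hk]
    refine Finset.card_lt_card (Finset.ssubset_iff_of_subset (fun i hi => ?_) |>.2 ⟨p, ?_, ?_⟩)
    · rw [Finset.mem_filter] at hi ⊢
      refine ⟨Finset.mem_univ _, ?_⟩
      by_cases h1 : i = p
      · rw [h1, hp]
      by_cases h2 : i = p'
      · rw [h2, hp']
      · have h3 := hi.2
        rwa [Function.comp_apply, Equiv.swap_apply_of_ne_of_ne h1 h2] at h3
    · simpa using hp
    · simpa [hp'] using hlt.ne') d
  refine eq_zero_of_generic hg.invol (continuous_ev f) (fun y hy hgen => ?_) hy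
  have e1 : line y {p} (fun _ => 1) (y p) = y := by
    funext i
    by_cases h1 : i = p
    · simp [line, h1]
    · simp [line, h1]
  rw [← e1]
  have l0 : ∀ t j, j ≠ p → line y {p} (fun _ => 1) t j = y j := by
    intro t j h1
    simp [line, h1]
  have l1 : ∀ t, line y {p} (fun _ => 1) t p = t := by
    intro t
    simp [line]
  have hnp : ∀ i, i ≠ p → g i ≠ p := fun i hi h2 => hi (by rw [← hg.invol i, h2, hp])
  have lc : ∀ t, Compatible g (line y {p} (fun _ => 1) t) := by
    intro t i hi
    have h1 : i ≠ p := by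
      rintro rfl
      rw [hp] at hi
      exact lt_irrefl _ hi
    rw [l0 _ _ h1, l0 _ _ (hnp i h1), hy i hi]
  refine hf.ev_line_eq_zero y _ _
    (Finset.univ.filter fun i => i ≠ p ∧ (g i = i ∨ i < g i)) (fun i => q * y i) ?_ ?_ ?_ _
  · intro i hi j hj hij
    simp only [Finset.coe_filter, Finset.mem_univ, true_and, Set.mem_ofPred_eq] at hi hj
    by_contra hne
    have h1 : j = g i := by
      by_contra h2
      have h3 := congrArg (· ^ 3) hij
      simp only [cube_q_mul] at h3
      exact hgen.cube_ne i j (Ne.symm hne) h2 h3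
    subst h1
    rw [hg.invol] at hj
    rcases hi.2 with h2 | h2
    · exact hne h2.symm
    · rcases hj.2 with h3 | h3
      · exact hne h3
      · exact lt_asymm h2 h3
  · have := card_fixed_or_left hg.invol hp
    have := NeZero.pos n
    rw [Finset.card_singleton]
    omega
  · intro i hi
    simp only [Finset.mem_filter, Finset.mem_univ, true_and] at hi
    rcases hi.2 with h1 | h1
    · refine hpair _ p i hp h1 (lt_of_le_of_ne (hmin i h1) hi.1.symm) rfl _ (lc _) ?_
      rw [l1, l0 _ _ hi.1]
      linear_combination -y i * q_pow_three
    · refine hf.ev_eq_zero_of_outside h1 (lc _ i h1) (hg.fixed_outside hp h1) ?_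
      rw [l1, l0 _ _ hi.1]

/-- The values at the points attached to matchings determine `f`. -/
theorem eq_zero_of_ev_orientation {f : Pol n} (hf : IsWheel f)
    (h0 : ∀ σ, ev (orientation σ) f = 0) : f = 0 :=
  eq_zero_of_ev fun y => hf.ev_eq_zero_of_isPartialMatching h0 _ id IsPartialMatching.id rfl y
    fun _ h => absurd h (lt_irrefl _)

end IsWheel

end Eval

end WheelPoly

namespace NCMatching

variable {n : ℕ}

/-! ### Rotation -/

theorem temperleyLieb_rotate (a : Fin (2 * n)) (σ : NCMatching n) :
    temperleyLieb (finRotate (2 * n) a) σ.rotate = (temperleyLieb a σ).rotate := by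
  ext1
  funext i
  obtain ⟨i, rfl⟩ := (finRotate (2 * n)).surjective i
  rw [rotate_partner_finRotate, temperleyLieb_partner, temperleyLieb_partner]
  simp only [rotate_partner_finRotate, (finRotate (2 * n)).injective.eq_iff,
    apply_ite (finRotate (2 * n))]

theorem rotate_injective : Function.Injective (rotate : NCMatching n → NCMatching n) := by
  intro σ π h
  ext1
  funext i
  have h1 := congrArg (fun τ => NCMatching.partner τ (finRotate (2 * n) i)) h
  simp only [rotate_partner_finRotate] at h1
  exact (finRotate (2 * n)).injective h1

theorem rotate_surjective : Function.Surjective (rotate : NCMatching n → NCMatching n) :=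
  Finite.surjective_of_injective rotate_injective

end NCMatching

namespace WheelPoly

open MvPolynomial NCMatching

variable {n : ℕ}

section Eval

variable [NeZero n]

namespace IsWheel

/-- Moving one endpoint of an arch `(p, e)` ending at the last point: each of the other `n - 1`
arches forces a zero. -/
theorem ev_line_endpoint {f : Pol n} (hf : IsWheel f) (σ : NCMatching n) {p e w : Fin (2 * n)}
    (he : (e : ℕ) + 1 = 2 * n) (hp : σ.partner e = p) (hw : w = p ∨ w = e)
    {y : Fin (2 * n) → ℂ} (hy : Compatible (σ.partner ∘ Equiv.swap p e) y) (u v : ℂ) :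
    ev (line y {w} (fun _ => 1) u) f *
        ∏ i with i < σ.partner i ∧ i ≠ p, (v - q * y i) =
      ev (line y {w} (fun _ => 1) v) f *
        ∏ i with i < σ.partner i ∧ i ≠ p, (u - q * y i) := by
  have hp' : σ.partner p = e := (σ.partner_eq_iff _ _).1 hp
  have hpe : p < e := by
    have := σ.partner_ne e
    rw [hp, Ne, Fin.ext_iff] at this
    rw [Fin.lt_def]
    omega
  have hg : ∀ i, i ≠ p → i ≠ e → (σ.partner ∘ Equiv.swap p e) i = σ.partner i := by
    intro i h1 h2
    rw [Function.comp_apply, Equiv.swap_apply_of_ne_of_ne h1 h2]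
  have hgp : (σ.partner ∘ Equiv.swap p e) p = p := by
    rw [Function.comp_apply, Equiv.swap_apply_left, hp]
  have hge : (σ.partner ∘ Equiv.swap p e) e = e := by
    rw [Function.comp_apply, Equiv.swap_apply_right, hp']
  have hinv : ∀ i, (σ.partner ∘ Equiv.swap p e) ((σ.partner ∘ Equiv.swap p e) i) = i := by
    intro i
    by_cases h1 : i = p
    · rw [h1, hgp, hgp]
    by_cases h2 : i = e
    · rw [h2, hge, hge]
    rw [hg i h1 h2, hg, σ.partner_partner]
    · intro h3
      exact h2 (by rw [← σ.partner_partner i, h3, hp'])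
    · intro h3
      exact h1 (by rw [← σ.partner_partner i, h3, hp])
  have hmem : ∀ i, i < σ.partner i → i ≠ p →
      i ≠ e ∧ σ.partner i ≠ p ∧ σ.partner i ≠ e := by
    intro i h1 h2
    have h3 : i ≠ e := by
      rintro rfl
      rw [hp] at h1
      exact lt_asymm h1 hpe
    refine ⟨h3, fun h4 => h3 ?_, fun h4 => h2 ?_⟩
    · rw [← σ.partner_partner i, h4, hp']
    · rw [← σ.partner_partner i, h4, hp]
  have hline : ∀ t, Continuous fun y : Fin (2 * n) → ℂ => ev (line y {w} (fun _ => 1) t) f := by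
    intro t
    refine (continuous_ev f).comp (continuous_pi fun i => ?_)
    unfold line
    split_ifs <;> fun_prop
  have hprod : ∀ t, Continuous fun y : Fin (2 * n) → ℂ =>
      ∏ i with i < σ.partner i ∧ i ≠ p, (t - q * y i) := by
    intro t
    refine continuous_finsetProd _ fun i _ => ?_
    fun_prop
  rw [← sub_eq_zero]
  refine eq_zero_of_generic (Φ := fun y => _ * _ - _ * _) hinv
    (((hline u).mul (hprod v)).sub ((hline v).mul (hprod u))) (fun y hy hgen => ?_) hy
  rw [sub_eq_zero]
  refine hf.ev_line_mul_prod y _ _ _ _ ?_ ?_ ?_ u v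
  · intro i hi j hj hij
    simp only [Finset.coe_filter, Finset.mem_univ, true_and, Set.mem_ofPred_eq] at hi hj
    by_contra hne
    have h3 := congrArg (· ^ 3) hij
    simp only [cube_q_mul] at h3
    have h1 : j = σ.partner i := by
      by_contra h2
      exact hgen.cube_ne i j (Ne.symm hne) (by rwa [hg i hi.2 (hmem i hi.1 hi.2).1]) h3
    subst h1
    rw [σ.partner_partner] at hj
    exact lt_asymm hi.1 hj.1
  · have h1 : (Finset.univ.filter fun i => σ.partner i < i ∧ i ≠ e).card ≤
        (Finset.univ.filter fun i => i < σ.partner i ∧ i ≠ p).card := by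
      refine Finset.card_le_card_of_injOn σ.partner (fun i hi => ?_)
        fun i _ j _ h => σ.partner_inj.1 h
      simp only [Finset.coe_filter, Finset.mem_univ, true_and, Set.mem_ofPred_eq] at hi ⊢
      rw [σ.partner_partner]
      exact ⟨hi.1, fun h => hi.2 (by rw [← σ.partner_partner i, h, hp'])⟩
    have h2 : (Finset.univ : Finset (Fin (2 * n))) = {p, e} ∪
        ((Finset.univ.filter fun i => σ.partner i < i ∧ i ≠ e) ∪
          Finset.univ.filter fun i => i < σ.partner i ∧ i ≠ p) := by
      ext i
      simp only [Finset.mem_univ, Finset.mem_insert, Finset.mem_union, Finset.mem_filter,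
        Finset.mem_singleton, true_and, true_iff]
      have := lt_or_gt_of_ne (σ.partner_ne i)
      tauto
    have h3 := congrArg Finset.card h2
    rw [Finset.card_univ, Fintype.card_fin] at h3
    have h4 := Finset.card_union_le {p, e}
      ((Finset.univ.filter fun i => σ.partner i < i ∧ i ≠ e) ∪
          Finset.univ.filter fun i => i < σ.partner i ∧ i ≠ p)
    have h5 := Finset.card_union_le (Finset.univ.filter fun i => σ.partner i < i ∧ i ≠ e)
      (Finset.univ.filter fun i => i < σ.partner i ∧ i ≠ p)
    rw [Finset.card_pair hpe.ne] at h4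
    rw [Finset.card_singleton]
    omega
  · intro i hi
    simp only [Finset.mem_filter, Finset.mem_univ, true_and] at hi
    obtain ⟨h1, h2, h3⟩ := hmem i hi.1 hi.2
    have l0 : ∀ t j, j ≠ p → j ≠ e → line y {w} (fun _ => 1) t j = y j := by
      intro t j h4 h5
      have : j ≠ w := by
        rcases hw with rfl | rfl <;> assumption
      simp [line, this]
    have l1 : ∀ t, line y {w} (fun _ => 1) t w = t := by
      intro t
      simp [line]
    refine hf.ev_eq_zero_of_outside hi.1 (p := w) ?_ ?_ ?_
    · rw [l0 _ _ h2 h3, l0 _ _ hi.2 h1]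
      have h4 := hy i
      rw [hg i hi.2 h1] at h4
      exact h4 hi.1
    · have h4 := σ.noncrossing i p
      rw [hp'] at h4
      rcases hw with rfl | rfl
      · rw [Ne, Fin.ext_iff] at *
        simp only [Fin.lt_def] at *
        omega
      · rw [Ne, Fin.ext_iff] at *
        simp only [Fin.lt_def] at *
        omega
    · rw [l1, l0 _ _ hi.2 h1]

/-- Values at matchings are invariant under rotation. The rotation of the points reverses the
orientation of the arch which ends at the last point; moving its two endpoints one after the other
multiplies the value by inverse factors. -/
theorem ev_orientation_rotate {f : Pol n} (hf : IsWheel f) (σ : NCMatching n) :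
    ev (orientation σ.rotate) (rename (· + 1) f) = ev (orientation σ) f := by
  have hn := NeZero.pos n
  obtain ⟨e, he⟩ : ∃ e : Fin (2 * n), (e : ℕ) + 1 = 2 * n :=
    ⟨⟨2 * n - 1, by omega⟩, by simp only; omega⟩
  obtain ⟨p, hp⟩ : ∃ p, σ.partner e = p := ⟨_, rfl⟩
  have hp' : σ.partner p = e := (σ.partner_eq_iff _ _).1 hp
  have hpe : p < e := by
    have := σ.partner_ne e
    rw [hp, Ne, Fin.ext_iff] at this
    rw [Fin.lt_def]
    omega
  have hcomp : ∀ y : Fin (2 * n) → ℂ, (∀ i, i ≠ p → i ≠ e → y i = orientation σ i) →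
      Compatible (σ.partner ∘ Equiv.swap p e) y := by
    intro y hy i hi
    have h1 : i ≠ p := by
      rintro rfl
      rw [Function.comp_apply, Equiv.swap_apply_left, hp] at hi
      exact lt_irrefl _ hi
    have h2 : i ≠ e := by
      rintro rfl
      rw [Function.comp_apply, Equiv.swap_apply_right, hp'] at hi
      exact lt_irrefl _ hi
    rw [Function.comp_apply, Equiv.swap_apply_of_ne_of_ne h1 h2] at hi ⊢
    rw [hy i h1 h2, hy, compatible_orientation σ i hi]
    · intro h3
      exact h2 (by rw [← σ.partner_partner i, h3, hp'])
    · intro h3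
      exact h1 (by rw [← σ.partner_partner i, h3, hp])
  have hprod : ∀ (y : Fin (2 * n) → ℂ) (t : ℂ), (∀ i, i ≠ p → i ≠ e → y i = orientation σ i) →
      ∏ i with i < σ.partner i ∧ i ≠ p, (t - q * y i) =
        ∏ i : Fin (2 * n) with i < σ.partner i ∧ i ≠ p, (t - 1) := by
    intro y t hy
    refine Finset.prod_congr rfl fun i hi => ?_
    simp only [Finset.mem_filter, Finset.mem_univ, true_and] at hi
    have h1 : i ≠ e := by
      rintro rfl
      rw [hp] at hi
      exact lt_asymm hi.1 hpe
    rw [hy i hi.2 h1, orientation, if_pos hi.1, mul_inv_cancel₀ q_ne_zero]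
  let y₁ := line (orientation σ) {p} (fun _ => 1) q
  let y₂ := line y₁ {e} (fun _ => 1) q⁻¹
  have hy₁ : ∀ i, i ≠ p → i ≠ e → y₁ i = orientation σ i := by
    intro i h1 h2
    simp [y₁, line, h1]
  have e1 : line (orientation σ) {p} (fun _ => 1) q⁻¹ = orientation σ := by
    funext i
    by_cases h1 : i = p
    · rw [h1]
      simp [line, orientation, hp', hpe]
    · simp [line, h1]
  have e2 : line y₁ {e} (fun _ => 1) q = y₁ := by
    funext i
    by_cases h1 : i = e
    · rw [h1]
      simp [line, y₁, orientation, hp, hpe.ne', lt_asymm hpe]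
    · simp [line, h1]
  have e3 : orientation σ.rotate ∘ finRotate (2 * n) = y₂ := by
    funext i
    rw [Function.comp_apply, orientation, rotate_partner_finRotate]
    have h1 := val_finRotate i
    have h2 := val_finRotate (σ.partner i)
    by_cases hi : i = p
    · rw [hi, hp'] at h2 ⊢
      rw [if_pos he] at h2
      rw [if_neg (by rw [Fin.lt_def]; omega)]
      simp [y₂, y₁, line, hpe.ne]
    by_cases hi' : i = e
    · rw [hi', hp] at h2 ⊢
      rw [hi'] at h1
      rw [if_pos he] at h1
      rw [if_neg (by rw [Fin.lt_def] at hpe; omega)] at h2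
      rw [if_pos (by rw [Fin.lt_def]; omega)]
      simp [y₂, line]
    · have h3 : σ.partner i ≠ e := fun h3 => hi (by rw [← σ.partner_partner i, h3, hp])
      rw [Ne, Fin.ext_iff] at h3
      rw [Fin.ext_iff] at hi'
      have h4 : y₂ i = orientation σ i := by
        simp [y₂, y₁, line, hi, Fin.ext_iff, hi']
      rw [h4, orientation]
      rw [if_neg (by omega)] at h1 h2
      simp only [Fin.lt_def, h1, h2, add_lt_add_iff_right]
  have h1 := hf.ev_line_endpoint σ he hp (Or.inl rfl) (hcomp _ fun _ _ _ => rfl) q⁻¹ q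
  have h2 := hf.ev_line_endpoint σ he hp (Or.inr rfl) (hcomp _ hy₁) q q⁻¹
  rw [e1, hprod _ _ fun _ _ _ => rfl, hprod _ _ fun _ _ _ => rfl] at h1
  rw [e2, hprod _ _ hy₁, hprod _ _ hy₁] at h2
  rw [ev_rename_succ, e3]
  have h3 : (∏ i : Fin (2 * n) with i < σ.partner i ∧ i ≠ p, (q - 1)) ≠ 0 :=
    Finset.prod_ne_zero_iff.2 fun _ _ => sub_ne_zero.2 q_ne_one
  exact mul_right_cancel₀ h3 (h2.symm.trans h1.symm)

/-! ### The exchange relation -/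

/-- If `a` and `a + 1` are connected, then `e_a` fixes `σ`, and the factor `q z_a - q⁻¹ z_{a+1}` of
`D_a f` vanishes. -/
theorem ev_orientation_D_of_partner {f : Pol n} {σ : NCMatching n} {a b : Fin (2 * n)}
    (hb : (b : ℕ) = a + 1) (hab : σ.partner a = b) :
    ev (orientation σ) (D (label n a) f) =
      ev (orientation (temperleyLieb a σ)) f - ev (orientation σ) f := by
  have hba : σ.partner b = a := (σ.partner_eq_iff _ _).1 hab
  have hlt : a < b := by
    rw [Fin.lt_def]
    omega
  rw [temperleyLieb_of_partner (by rw [hab, finRotate_eq hb]), sub_self, ev_D, finRotate_eq hb,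
    orientation, orientation, hab, hba, if_pos hlt, if_neg (lt_asymm hlt),
    mul_inv_cancel₀ q_ne_zero, inv_mul_cancel₀ q_ne_zero, sub_self, zero_mul]

/-- If `a` closes an arch and `a + 1` opens one, then `e_a` exchanges the coordinates `q` and `q⁻¹`
at these points, and the fraction in the definition of `D_a` equals `1` there. -/
theorem ev_orientation_D_of_lt {f : Pol n} {σ : NCMatching n} {a b : Fin (2 * n)}
    (hb : (b : ℕ) = a + 1) (ha' : σ.partner a < a) (hb' : b < σ.partner b) :
    ev (orientation σ) (D (label n a) f) =
      ev (orientation (temperleyLieb a σ)) f - ev (orientation σ) f := by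
  have hlt : a < b := by
    rw [Fin.lt_def]
    omega
  have h1 : orientation σ ∘ Equiv.swap a b = orientation (temperleyLieb a σ) := by
    funext i
    have h3 := σ.partner_partner a
    have h4 := σ.partner_partner b
    rw [Function.comp_apply, orientation, orientation, temperleyLieb_partner, finRotate_eq hb]
    by_cases ia : i = a
    · rw [ia, Equiv.swap_apply_left, if_pos hb', if_pos rfl, if_pos hlt]
    by_cases ib : i = b
    · rw [ib, Equiv.swap_apply_right, if_neg (lt_asymm ha'), if_neg hlt.ne', if_pos rfl,
        if_neg (lt_asymm hlt)]
    rw [Equiv.swap_apply_of_ne_of_ne ia ib, if_neg ia, if_neg ib]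
    by_cases ix : i = σ.partner a
    · rw [if_pos ix, ix, h3, if_pos ha', if_pos ((ha'.trans hlt).trans hb')]
    by_cases iy : i = σ.partner b
    · rw [if_neg ix, if_pos iy, iy, h4, if_neg (lt_asymm hb'),
        if_neg (lt_asymm ((ha'.trans hlt).trans hb'))]
    rw [if_neg ix, if_neg iy]
  have h2 := mul_ev_D (orientation σ) a f
  have ha0 : orientation σ a = q := by rw [orientation, if_neg (lt_asymm ha')]
  have hb0 : orientation σ b = q⁻¹ := by rw [orientation, if_pos hb']
  have hq : q⁻¹ - q ≠ 0 := by
    rw [q_inv]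
    exact sub_ne_zero.2 q_sq_ne_q
  rw [finRotate_eq hb, h1, ha0, hb0] at h2
  refine mul_left_cancel₀ hq (h2.trans ?_)
  congr 1
  rw [q_inv]
  linear_combination -q * q_pow_three

/-- The operators `D_a` act on values at matchings as `e_a - 1`. Rotation reduces this to the case
that `a` and `a + 1` are connected or belong to neighbouring arches `(·, a)`, `(a + 1, ·)`. -/
theorem ev_orientation_D {f : Pol n} (hf : IsWheel f) (a : Fin (2 * n)) (σ : NCMatching n) :
    ev (orientation σ) (D (label n a) f) =
      ev (orientation (temperleyLieb a σ)) f - ev (orientation σ) f := by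
  have rot : ∀ (f : Pol n) (a : Fin (2 * n)) (σ : NCMatching n), IsWheel f →
      ev (orientation σ.rotate) (D (label n (finRotate (2 * n) a)) (rename (· + 1) f)) =
        ev (orientation (temperleyLieb (finRotate (2 * n) a) σ.rotate)) (rename (· + 1) f) -
          ev (orientation σ.rotate) (rename (· + 1) f) →
      ev (orientation σ) (D (label n a) f) =
        ev (orientation (temperleyLieb a σ)) f - ev (orientation σ) f := by
    intro f a σ hf h
    rwa [temperleyLieb_rotate, hf.ev_orientation_rotate, hf.ev_orientation_rotate,
      label_finRotate, D_rename_add, (hf.D_label a).ev_orientation_rotate] at h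
  induction hk : 2 * n - 1 - (σ.partner (finRotate (2 * n) a) : ℕ) generalizing f a σ with
  | zero =>
    have h1 := val_finRotate a
    have h2 := (σ.partner (finRotate (2 * n) a)).is_lt
    by_cases hpa : σ.partner (finRotate (2 * n) a) = a
    · rw [hpa] at hk
      rw [if_pos (by omega)] at h1
      have h3 := val_finRotate (finRotate (2 * n) a)
      rw [h1, if_neg (by omega)] at h3
      refine rot f a σ hf (ev_orientation_D_of_partner (b := finRotate (2 * n)
        (finRotate (2 * n) a)) (by omega) ?_)
      rw [rotate_partner_finRotate, (σ.partner_eq_iff _ _).1 hpa]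
    · have h3 : (a : ℕ) + 1 ≠ 2 * n := by
        intro h3
        exact hpa (Fin.ext (by omega))
      rw [if_neg h3] at h1
      have h4 := σ.partner_ne (finRotate (2 * n) a)
      have h5 := σ.partner_ne a
      have h6 := σ.noncrossing a (finRotate (2 * n) a) (by rw [Fin.lt_def]; omega)
      have h7 : σ.partner a ≠ finRotate (2 * n) a := fun h => hpa ((σ.partner_eq_iff _ _).1 h)
      have := (σ.partner a).is_lt
      simp only [Ne, Fin.ext_iff, Fin.lt_def] at h4 h5 h6 h7
      exact ev_orientation_D_of_lt h1 (by rw [Fin.lt_def]; omega) (by rw [Fin.lt_def]; omega)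
  | succ k ih =>
    refine rot f a σ hf (ih hf.rename_succ _ _ ?_)
    rw [rotate_partner_finRotate]
    have h1 := val_finRotate (σ.partner (finRotate (2 * n) a))
    rw [if_neg (by omega)] at h1
    omega

end IsWheel

end Eval

end WheelPoly

namespace NCMatching

variable {n : ℕ}

/-! ### The polynomial of the nested matching -/

theorem exists_closing_of_ne_nested {σ : NCMatching n} (h : σ ≠ nested n) :
    ∃ j : Fin (2 * n), (j : ℕ) < n ∧ σ.partner j < j := by
  by_contra! h1
  have h2 : ∀ i : Fin (2 * n), (i : ℕ) < n → i < σ.partner i := fun i hi =>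
    lt_of_le_of_ne (h1 i hi) (σ.partner_ne i).symm
  have h3 : ∀ k ≤ n, σ.height k = k := by
    intro k hk
    induction k with
    | zero => exact σ.height_zero
    | succ k ih =>
      have h4 := σ.height_succ ⟨k, by omega⟩
      rw [if_pos (h2 _ (by simp only; omega))] at h4
      simp only at h4
      rw [h4, ih (by omega)]
  refine h (ext_of_height fun k => ?_)
  rw [height_nested]
  rcases le_total k n with h4 | h4
  · rw [h3 k h4, min_eq_left h4]
  · rw [min_eq_right h4]
    have h5 := σ.height_mono h4
    rw [h3 n le_rfl] at h5
    exact le_antisymm (σ.height_le k) h5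

end NCMatching

namespace WheelPoly

open MvPolynomial NCMatching

variable {n : ℕ}

/-- Every `k` occurs in `n - 1` of the pairs `i < j`. -/
theorem sum_pairs_eq {k : ℕ} (h1 : 1 ≤ k) (hk : k ≤ n) :
    ∑ i ∈ Finset.Icc 1 n, ∑ j ∈ Finset.Icc (i + 1) n,
      ((if i = k then 1 else 0) + if j = k then 1 else 0) = n - 1 := by
  have h2 : ∀ i ∈ Finset.Icc 1 n, ∑ j ∈ Finset.Icc (i + 1) n,
      ((if i = k then 1 else 0) + if j = k then 1 else 0) =
        (if i = k then n - k else 0) + if i < k then 1 else 0 := by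
    intro i _
    rw [Finset.sum_add_distrib, Finset.sum_const, Nat.card_Icc, Finset.sum_ite_eq']
    congr 1
    · split_ifs with h
      · rw [h, smul_eq_mul, mul_one]
        omega
      · rw [smul_zero]
    · simp only [Finset.mem_Icc]
      split_ifs <;> omega
  have h3 : (Finset.Icc 1 n).filter (fun i => i < k) = Finset.Ico 1 k := by
    ext i
    simp only [Finset.mem_filter, Finset.mem_Icc, Finset.mem_Ico]
    omega
  rw [Finset.sum_congr rfl h2, Finset.sum_add_distrib, Finset.sum_ite_eq',
    if_pos (Finset.mem_Icc.2 ⟨h1, hk⟩), ← Finset.card_filter, h3, Nat.card_Ico]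
  omega

theorem sum_sub_mul_two (n : ℕ) : (∑ i ∈ Finset.Icc 1 n, (n - i)) * 2 = n * (n - 1) := by
  rw [← Finset.sum_range_id_mul_two, ← Finset.sum_range_reflect]
  congr 1
  rw [← Finset.Ico_add_one_right_eq_Icc, Finset.sum_Ico_eq_sum_range]
  refine Finset.sum_congr (by simp) fun i _ => by omega

theorem degreeOf_linear_le {σ : Type*} [DecidableEq σ] (a b v : σ) (c d : ℂ) :
    (C c * X a - C d * X b : MvPolynomial σ ℂ).degreeOf v ≤
      (if v = a then 1 else 0) + if v = b then 1 else 0 := by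
  refine (degreeOf_sub_le v _ _).trans
      ((max_le_max (degreeOf_C_mul_le _ _ _) (degreeOf_C_mul_le _ _ _)).trans ?_)
  rw [degreeOf_X, degreeOf_X]
  exact max_le (Nat.le_add_right _ _) (Nat.le_add_left _ _)

section Eval

variable [NeZero n]

theorem natCast_eq_natCast_iff_of_le {a b : ℕ} (ha : 1 ≤ a) (ha' : a ≤ 2 * n) (hb : 1 ≤ b)
    (hb' : b ≤ 2 * n) : (a : ZMod (2 * n)) = b ↔ a = b := by
  constructor
  · intro h
    have h1 : label n ⟨a - 1, by omega⟩ = label n ⟨b - 1, by omega⟩ := by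
      rw [label_apply, label_apply]
      simp only [Nat.sub_add_cancel ha, Nat.sub_add_cancel hb, h]
    have h2 := (label n).injective h1
    rw [Fin.mk.injEq] at h2
    omega
  · rintro rfl
    rfl

theorem degreeOf_psiNested_le (v : ZMod (2 * n)) : (psiNested n).degreeOf v ≤ n - 1 := by
  obtain ⟨m, rfl⟩ := (label n).surjective v
  obtain ⟨k, hk⟩ : ∃ k, k = (m : ℕ) + 1 := ⟨_, rfl⟩
  have hm := m.is_lt
  rw [label_apply, ← hk]
  refine (degreeOf_C_mul_le _ _ _).trans ((degreeOf_prod_le _ _ _).trans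
    ((Finset.sum_le_sum fun i _ => degreeOf_prod_le _ _ _).trans ?_))
  obtain ⟨k', h1, h2, hk'⟩ : ∃ k', 1 ≤ k' ∧ k' ≤ n ∧ (k = k' ∨ k = n + k') := by
    rcases le_or_gt k n with h | h
    · exact ⟨k, by omega, h, Or.inl rfl⟩
    · exact ⟨k - n, by omega, by omega, Or.inr (by omega)⟩
  rw [← sum_pairs_eq h1 h2]
  refine Finset.sum_le_sum fun i hi => Finset.sum_le_sum fun j hj => ?_
  rw [Finset.mem_Icc] at hi hj
  refine (degreeOf_mul_le _ _ _).trans ((add_le_add (degreeOf_linear_le _ _ _ _ _)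
    (degreeOf_linear_le _ _ _ _ _)).trans ?_)
  have hk1 : 1 ≤ k := by omega
  have hk2 : k ≤ 2 * n := by omega
  simp only [natCast_eq_natCast_iff_of_le hk1 hk2 (show 1 ≤ i by omega) (by omega),
    natCast_eq_natCast_iff_of_le hk1 hk2 (show 1 ≤ j by omega) (by omega),
    natCast_eq_natCast_iff_of_le hk1 hk2 (show 1 ≤ n + i by omega) (by omega),
    natCast_eq_natCast_iff_of_le hk1 hk2 (show 1 ≤ n + j by omega) (by omega)]
  split_ifs <;> omega

theorem ev_psiNested (y : Fin (2 * n) → ℂ) : ev y (psiNested n) =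
    ((q - q⁻¹) ^ (n * (n - 1)))⁻¹ * ∏ i ∈ Finset.Icc 1 n, ∏ j ∈ Finset.Icc (i + 1) n,
      ((q * y ((label n).symm (i : ZMod (2 * n))) -
          q⁻¹ * y ((label n).symm (j : ZMod (2 * n)))) *
        (q * y ((label n).symm ((n + i : ℕ) : ZMod (2 * n))) -
          q⁻¹ * y ((label n).symm ((n + j : ℕ) : ZMod (2 * n))))) := by
  unfold psiNested ev
  simp only [map_mul, map_prod, map_sub, eval_C, eval_X]

theorem label_symm_natCast {k : ℕ} {i : Fin (2 * n)} (h : (i : ℕ) + 1 = k) :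
    (label n).symm (k : ZMod (2 * n)) = i := by
  rw [Equiv.symm_apply_eq, label_apply, h]

theorem isWheel_psiNested : IsWheel (psiNested n) := by
  refine ⟨degreeOf_psiNested_le, fun y i j k hij hjk h1 h2 => ?_⟩
  rw [Fin.lt_def] at hij hjk
  have hk := k.is_lt
  have key : ∀ x : ℂ, q * x - q⁻¹ * (q ^ 2 * x) = 0 := by
    intro x
    rw [q_inv]
    linear_combination -(q * x) * q_pow_three
  rw [ev_psiNested, mul_eq_zero]
  right
  rcases lt_or_ge (j : ℕ) n with hj | hj
  · refine Finset.prod_eq_zero (i := (i : ℕ) + 1) (Finset.mem_Icc.2 (by omega)) ?_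
    refine Finset.prod_eq_zero (i := (j : ℕ) + 1) (Finset.mem_Icc.2 (by omega)) ?_
    rw [label_symm_natCast (i := i) rfl, label_symm_natCast (i := j) rfl, h1, key, zero_mul]
  · refine Finset.prod_eq_zero (i := (j : ℕ) + 1 - n) (Finset.mem_Icc.2 (by omega)) ?_
    refine Finset.prod_eq_zero (i := (k : ℕ) + 1 - n) (Finset.mem_Icc.2 (by omega)) ?_
    rw [label_symm_natCast (k := n + (j + 1 - n)) (i := j) (by omega),
      label_symm_natCast (k := n + (k + 1 - n)) (i := k) (by omega), h2, key, mul_zero]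

theorem ev_orientation_psiNested_of_ne {σ : NCMatching n} (h : σ ≠ nested n) :
    ev (orientation σ) (psiNested n) = 0 := by
  obtain ⟨j, hj, hj'⟩ := exists_closing_of_ne_nested h
  have hj0 : (j : ℕ) ≠ 0 := by
    rw [Fin.lt_def] at hj'
    omega
  obtain ⟨o, ho⟩ : ∃ o : Fin (2 * n), (o : ℕ) = 0 := ⟨⟨0, by omega⟩, rfl⟩
  have ho' : o < σ.partner o := by
    have := σ.partner_ne o
    rw [Ne, Fin.ext_iff] at this
    rw [Fin.lt_def]
    omega
  rw [ev_psiNested, mul_eq_zero]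
  right
  refine Finset.prod_eq_zero (i := 1) (Finset.mem_Icc.2 (by omega)) ?_
  refine Finset.prod_eq_zero (i := (j : ℕ) + 1) (Finset.mem_Icc.2 (by omega)) ?_
  rw [label_symm_natCast (k := 1) (i := o) (by omega), label_symm_natCast (i := j) rfl,
    orientation, orientation, if_pos ho', if_neg (lt_asymm hj'), mul_inv_cancel₀ q_ne_zero,
    inv_mul_cancel₀ q_ne_zero, sub_self, zero_mul]

theorem ev_orientation_psiNested_nested :
    ev (orientation (nested n)) (psiNested n) = 1 := by
  have ho : ∀ i : Fin (2 * n), orientation (nested n) i = if (i : ℕ) < n then q⁻¹ else q := by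
    intro i
    have : i < (nested n).partner i ↔ (i : ℕ) < n := by
      change i < i.rev ↔ _
      rw [Fin.lt_def, Fin.val_rev]
      omega
    simp only [orientation, this]
  have h1 : ∀ k, 1 ≤ k → k ≤ n →
      orientation (nested n) ((label n).symm (k : ZMod (2 * n))) = q⁻¹ := by
    intro k hk hk'
    rw [label_symm_natCast (i := ⟨k - 1, by omega⟩) (by simp only; omega), ho,
      if_pos (by simp only; omega)]
  have h2 : ∀ k, 1 ≤ k → k ≤ n →
      orientation (nested n) ((label n).symm ((n + k : ℕ) : ZMod (2 * n))) = q := by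
    intro k hk hk'
    rw [label_symm_natCast (i := ⟨n + k - 1, by omega⟩) (by simp only; omega), ho,
      if_neg (by simp only; omega)]
  have hq : q - q⁻¹ ≠ 0 := by
    rw [q_inv]
    exact sub_ne_zero.2 q_sq_ne_q.symm
  have h3 : ∀ i ∈ Finset.Icc 1 n, ∏ j ∈ Finset.Icc (i + 1) n,
      ((q * orientation (nested n) ((label n).symm (i : ZMod (2 * n))) -
          q⁻¹ * orientation (nested n) ((label n).symm (j : ZMod (2 * n)))) *
        (q * orientation (nested n) ((label n).symm ((n + i : ℕ) : ZMod (2 * n))) -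
          q⁻¹ * orientation (nested n) ((label n).symm ((n + j : ℕ) : ZMod (2 * n))))) =
      ((q - q⁻¹) ^ 2) ^ (n - i) := by
    intro i hi
    rw [Finset.mem_Icc] at hi
    have h4 : (Finset.Icc (i + 1) n).card = n - i := by
      rw [Nat.card_Icc]
      omega
    rw [← h4]
    refine Finset.prod_eq_pow_card fun j hj => ?_
    rw [Finset.mem_Icc] at hj
    rw [h1 i hi.1 hi.2, h1 j (by omega) hj.2, h2 i hi.1 hi.2, h2 j (by omega) hj.2]
    rw [q_inv]
    linear_combination q ^ 2 * (1 - q) ^ 2 * q_pow_three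
  rw [ev_psiNested, Finset.prod_congr rfl h3, Finset.prod_pow_eq_pow_sum, ← pow_mul, mul_comm 2,
    sum_sub_mul_two, inv_mul_cancel₀ (pow_ne_zero _ hq)]

/-! ### The dual basis -/

open Classical in
/-- The evaluations at matchings have a dual basis, constructed by adding boxes: the values of
`D_a Ψ_σ` are the entries of `e_a - 1`, and the recursion removes all of them but the one at `π`. -/
theorem exists_dual (π : NCMatching n) : ∃ f : Pol n, IsWheel f ∧
    ∀ σ, ev (orientation σ) f = if σ = π then 1 else 0 := by
  induction hk : π.young.card using Nat.strong_induction_on generalizing π with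
  | _ k ih =>
  by_cases hπ : π = nested n
  · refine ⟨psiNested n, isWheel_psiNested, fun σ => ?_⟩
    split_ifs with h
    · rw [h, hπ, ev_orientation_psiNested_nested]
    · exact ev_orientation_psiNested_of_ne (hπ ▸ h)
  · obtain ⟨a, σ, -, -, h1, -, -⟩ := exists_addsBox_of_ne_nested hπ
    have ih' : ∀ τ : NCMatching n, τ.young.card < k → ∃ f : Pol n, IsWheel f ∧
        ∀ σ, ev (orientation σ) f = if σ = τ then 1 else 0 := fun τ hτ => ih _ hτ τ rfl
    choose! Ψ hΨ hΨ' using ih'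
    have hσ : σ.young.card < k := hk ▸ card_young_lt h1.young_le h1.ne
    have hτ : ∀ τ, temperleyLieb a τ = σ ∧ τ ≠ σ ∧ τ ≠ π → τ.young.card < k :=
      fun τ h => hk ▸ h1.card_lt h.1 h.2.2
    refine ⟨D (label n a) (Ψ σ) - ∑ τ with temperleyLieb a τ = σ ∧ τ ≠ σ ∧ τ ≠ π, Ψ τ,
      ((hΨ σ hσ).D_label a).sub (IsWheel.sum fun τ h => hΨ τ (hτ τ (Finset.mem_filter.1 h).2)),
      fun μ => ?_⟩
    rw [map_sub, (hΨ σ hσ).ev_orientation_D, hΨ' σ hσ, hΨ' σ hσ, map_sum,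
      Finset.sum_congr rfl fun τ h => hΨ' τ (hτ τ (Finset.mem_filter.1 h).2) μ,
      Finset.sum_ite_eq]
    simp only [Finset.mem_filter, Finset.mem_univ, true_and]
    have h2 := h1.temperleyLieb_left
    have h3 := h1.temperleyLieb_right
    have h4 := h1.ne
    by_cases h5 : μ = σ
    · simp [h5, h2, h4]
    by_cases h6 : μ = π
    · simp [h6, h3, h4.symm]
    simp [h5, h6]

end Eval

/-! ### Existence and uniqueness of the family -/

open Classical in
/-- The family of polynomials satisfying the exchange relations and the rotation symmetry. -/
theorem exists_exchange_family (n : ℕ) : ∃ Ψ : NCMatching n → Pol n,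
    Ψ (nested n) = psiNested n ∧
    (∀ (a : Fin (2 * n)) (σ : NCMatching n), D ((a + 1 : ℕ) : ZMod (2 * n)) (Ψ σ) =
      (∑ τ with temperleyLieb a τ = σ, Ψ τ) - Ψ σ) ∧
    ∀ π, Ψ π.rotate = rename (· + 1) (Ψ π) := by
  rcases Nat.eq_zero_or_pos n with rfl | hn
  -- the labels lie in `ZMod 0 = ℤ` here, but there is only one matching and `Ψ` is constant
  · refine ⟨fun _ => psiNested 0, rfl, fun a => a.elim0, fun π => ?_⟩
    simp [psiNested]
  have : NeZero n := ⟨hn.ne'⟩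
  choose Ψ hΨ hΨ' using exists_dual (n := n)
  have ext : ∀ f g : Pol n, IsWheel f → IsWheel g →
      (∀ σ, ev (orientation σ) f = ev (orientation σ) g) → f = g := by
    intro f g hf hg h
    rw [← sub_eq_zero]
    exact (hf.sub hg).eq_zero_of_ev_orientation fun σ => by rw [map_sub, h, sub_self]
  refine ⟨Ψ, ?_, fun a σ => ?_, fun π => ?_⟩
  · refine ext _ _ (hΨ _) isWheel_psiNested fun σ => ?_
    rw [hΨ']
    split_ifs with h
    · rw [h, ev_orientation_psiNested_nested]
    · rw [ev_orientation_psiNested_of_ne h]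
  · rw [← label_apply]
    refine ext _ _ ((hΨ _).D_label a) ((IsWheel.sum fun _ _ => hΨ _).sub (hΨ _)) fun μ => ?_
    rw [(hΨ σ).ev_orientation_D, map_sub, map_sum]
    simp [hΨ']
  · refine ext _ _ (hΨ _) (hΨ π).rename_succ fun σ => ?_
    obtain ⟨σ, rfl⟩ := rotate_surjective σ
    rw [(hΨ π).ev_orientation_rotate, hΨ', hΨ']
    simp [rotate_injective.eq_iff]

/-- Every matching is reached by adding boxes, so the recursion determines the family. -/
theorem IsPsi.unique {Ψ Ψ' : NCMatching n → Pol n} (h : IsPsi Ψ) (h' : IsPsi Ψ') : Ψ = Ψ' := by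
  classical
  funext π
  induction hk : π.young.card using Nat.strong_induction_on generalizing π with
  | _ k ih =>
  by_cases hπ : π = NCMatching.nested n
  · rw [hπ, h.nested, h'.nested]
  · obtain ⟨a, σ, -, -, h1, -, -⟩ := exists_addsBox_of_ne_nested hπ
    rw [h.recursion a σ π h1, h'.recursion a σ π h1,
      ih _ (hk ▸ card_young_lt h1.young_le h1.ne) σ rfl]
    congr 1
    refine Finset.sum_congr rfl fun τ hτ => ?_
    obtain ⟨-, h2, -, h3⟩ := Finset.mem_filter.1 hτ
    exact ih _ (hk ▸ h1.card_lt h2 h3) τ rfl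

open Classical in
/-- The exchange relation contains the recursion: if `σ ↗ π` on the diagonal `a + 1`, then both
`σ` and `π` are preimages of `σ` under `e_a`. -/
theorem isPsi_of_exchange {Ψ : NCMatching n → Pol n}
    (h0 : Ψ (NCMatching.nested n) = psiNested n)
    (h1 : ∀ (a : Fin (2 * n)) (σ : NCMatching n), D ((a + 1 : ℕ) : ZMod (2 * n)) (Ψ σ) =
      (∑ τ with temperleyLieb a τ = σ, Ψ τ) - Ψ σ) : IsPsi Ψ := by
  refine ⟨h0, fun a σ π h => ?_⟩
  have h2 : (Finset.univ.filter fun τ => temperleyLieb a τ = σ) = insert σ (insert π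
      (Finset.univ.filter fun τ => temperleyLieb a τ = σ ∧ τ ≠ σ ∧ τ ≠ π)) := by
    ext τ
    simp only [Finset.mem_filter, Finset.mem_univ, true_and, Finset.mem_insert]
    constructor
    · intro h3
      tauto
    · rintro (rfl | rfl | h3)
      · exact h.temperleyLieb_left
      · exact h.temperleyLieb_right
      · exact h3.1
  rw [h1, h2, Finset.sum_insert, Finset.sum_insert]
  · ring
  · simp
  · simp [h.ne]

end WheelPoly

namespace WheelPoly

open MvPolynomial NCMatching

variable {n : ℕ}

/-! ### Expansion of the polynomials `D_{τ₁,τ₂}` -/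

theorem rename_succ_iterate (f : Pol n) (k : ℕ) :
    (fun g : Pol n => rename (· + 1) g)^[k] f = rename (· + (k : ZMod (2 * n))) f := by
  induction k with
  | zero =>
    simp only [Function.iterate_zero, id_eq, Nat.cast_zero, add_zero]
    exact (rename_id_apply f).symm
  | succ k ih =>
    rw [Function.iterate_succ_apply', ih, rename_rename]
    refine congrArg (fun g => rename g f) (funext fun i => ?_)
    simp only [Function.comp_apply, Nat.cast_succ, add_assoc]

theorem apply_rotate_iterate {Ψ : NCMatching n → Pol n}
    (h : ∀ π, Ψ π.rotate = rename (· + 1) (Ψ π)) (k : ℕ) (π : NCMatching n) :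
    Ψ (rotate^[k] π) = rename (· + (k : ZMod (2 * n))) (Ψ π) := by
  rw [← rename_succ_iterate]
  induction k with
  | zero => rfl
  | succ k ih => rw [Function.iterate_succ_apply', h, ih, Function.iterate_succ_apply']

theorem applyBoxes_eq_foldl (s : ZMod (2 * n)) (Y : YoungDiagram) (f : Pol n) :
    applyBoxes s Y f = (boxes Y).foldl
      (fun g b => (linD (s + (b.2 : ZMod (2 * n)) - (b.1 : ZMod (2 * n)))).toAddMonoidHom g) f :=
  rfl

open Classical in
/-- Let `ι` insert matchings of size `m` at the position `s`. In terms of the family `Ψ ∘ ι`, the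
operators `D` with labels shifted by `s` act like the operators `e_a - 1`. -/
theorem linD_insertion {m s : ℕ} {ι : NCMatching m → NCMatching n} (hι : IsInsertion s ι)
    {Ψ : NCMatching n → Pol n}
    (h1 : ∀ (a : Fin (2 * n)) (σ : NCMatching n), D ((a + 1 : ℕ) : ZMod (2 * n)) (Ψ σ) =
      (∑ τ with temperleyLieb a τ = σ, Ψ τ) - Ψ σ)
    {t : ZMod (2 * n)} (ht : t = s + m) (b : ℕ × ℕ) (a : Fin (2 * m)) (σ π τ : NCMatching m)
    (hb : (a : ℕ) + 1 + b.1 = m + b.2) (hσ : σ.AddsBox (a + 1) π) (hτ : τ.young ≤ σ.young) :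
    D (t + (b.2 : ZMod (2 * n)) - (b.1 : ZMod (2 * n))) (Ψ (ι τ)) =
      (∑ τ' with temperleyLieb a τ' = τ, Ψ (ι τ')) - Ψ (ι τ) := by
  have := hι.add_le
  obtain ⟨a', ha'⟩ : ∃ a' : Fin (2 * n), (a' : ℕ) = s + a := ⟨⟨s + a, by omega⟩, rfl⟩
  have h2 : t + (b.2 : ZMod (2 * n)) - (b.1 : ZMod (2 * n)) = ((a' + 1 : ℕ) : ZMod (2 * n)) := by
    have h3 := congrArg (fun k : ℕ => (k : ZMod (2 * n))) hb
    push_cast at h3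
    rw [ht, ha']
    push_cast
    linear_combination -h3
  rw [h2, h1, hι.sum_temperleyLieb ha' hσ hτ]

/-- `D_{τ₁,τ₂}` is an integral unitriangular combination of the polynomials
`Ψ_{ρ^{n₂}(σ₁σ₂)}`, whose coefficients are products of universal ones. -/
theorem basisD₂_eq_sum {n₁ n₂ : ℕ} {Ψ : NCMatching (n₁ + n₂) → Pol (n₁ + n₂)}
    (h0 : Ψ (nested (n₁ + n₂)) = psiNested (n₁ + n₂))
    (h1 : open Classical in ∀ (a : Fin (2 * (n₁ + n₂))) (σ : NCMatching (n₁ + n₂)),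
      D ((a + 1 : ℕ) : ZMod (2 * (n₁ + n₂))) (Ψ σ) =
        (∑ τ with temperleyLieb a τ = σ, Ψ τ) - Ψ σ)
    (h2 : ∀ π, Ψ π.rotate = rename (· + 1) (Ψ π))
    {A₁ : NCMatching n₁ → NCMatching n₁ → ℤ} {A₂ : NCMatching n₂ → NCMatching n₂ → ℤ}
    (hA₁ : open Classical in ∀ (M : Type) [AddCommGroup M] (F : NCMatching n₁ → M)
      (T : ℕ × ℕ → M →+ M),
      (∀ (b : ℕ × ℕ) (a : Fin (2 * n₁)) (σ π τ : NCMatching n₁), (a : ℕ) + 1 + b.1 = n₁ + b.2 →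
        σ.AddsBox (a + 1) π → τ.young ≤ σ.young →
        T b (F τ) = (∑ τ' with temperleyLieb a τ' = τ, F τ') - F τ) →
      ∀ π, (boxes π.young).foldl (fun g b => T b g) (F (nested n₁)) = ∑ τ, A₁ π τ • F τ)
    (hA₂ : open Classical in ∀ (M : Type) [AddCommGroup M] (F : NCMatching n₂ → M)
      (T : ℕ × ℕ → M →+ M),
      (∀ (b : ℕ × ℕ) (a : Fin (2 * n₂)) (σ π τ : NCMatching n₂), (a : ℕ) + 1 + b.1 = n₂ + b.2 →
        σ.AddsBox (a + 1) π → τ.young ≤ σ.young →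
        T b (F τ) = (∑ τ' with temperleyLieb a τ' = τ, F τ') - F τ) →
      ∀ π, (boxes π.young).foldl (fun g b => T b g) (F (nested n₂)) = ∑ τ, A₂ π τ • F τ)
    (τ₁ : NCMatching n₁) (τ₂ : NCMatching n₂) :
    basisD₂ τ₁ τ₂ = ∑ σ₁, ∑ σ₂, (A₁ τ₁ σ₁ * A₂ τ₂ σ₂) • Ψ (rotate^[n₂] (σ₁.concat σ₂)) := by
  have e1 : basisD (τ₁.nest n₂) = ∑ σ₁, A₁ τ₁ σ₁ • Ψ (σ₁.nest n₂) := by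
    rw [basisD, young_nest, ← h0, ← nest_nested, applyBoxes_eq_foldl]
    refine hA₁ _ (fun τ => Ψ (τ.nest n₂)) _ ?_ τ₁
    exact linD_insertion (isInsertion_nest n₁ n₂) h1 (by push_cast; ring)
  have e2 : ∀ σ₁ : NCMatching n₁, (boxes τ₂.young).foldl
      (fun g b => (linD (0 + (b.2 : ZMod (2 * (n₁ + n₂))) -
        (b.1 : ZMod (2 * (n₁ + n₂))))).toAddMonoidHom g) (Ψ (σ₁.nest n₂)) =
      ∑ σ₂, A₂ τ₂ σ₂ • Ψ (rotate^[n₂] (σ₁.concat σ₂)) := by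
    intro σ₁
    rw [← rotate_iterate_concat_nested]
    refine hA₂ _ (fun τ => Ψ (rotate^[n₂] (σ₁.concat τ))) _ ?_ τ₂
    intro b a σ π τ hb hσ hτ
    have h3 := linD_insertion (isInsertion_concat σ₁ n₂) h1 (t := -(n₂ : ZMod (2 * (n₁ + n₂))))
      (by
        have h4 := ZMod.natCast_self (2 * (n₁ + n₂))
        push_cast at h4 ⊢
        linear_combination -h4) b a σ π τ hb hσ hτ
    have h4 := D_rename_add (n₂ : ZMod (2 * (n₁ + n₂)))
      (-(n₂ : ZMod (2 * (n₁ + n₂))) + (b.2 : ZMod (2 * (n₁ + n₂))) -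
        (b.1 : ZMod (2 * (n₁ + n₂)))) (Ψ (σ₁.concat τ))
    simp only [apply_rotate_iterate h2]
    rw [← map_sum, ← map_sub, ← h3, ← h4]
    change D _ _ = D _ _
    congr 1
    ring
  -- applying the operators of the second diagram to a sum
  have e3 : ∀ (l : List (ℕ × ℕ)) (T : ℕ × ℕ → Pol (n₁ + n₂) →+ Pol (n₁ + n₂))
      (G : NCMatching n₁ → Pol (n₁ + n₂)),
      l.foldl (fun g b => T b g) (∑ σ₁, A₁ τ₁ σ₁ • G σ₁) =
        ∑ σ₁, A₁ τ₁ σ₁ • l.foldl (fun g b => T b g) (G σ₁) := by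
    intro l T
    induction l with
    | nil => exact fun _ => rfl
    | cons b l ih =>
      intro G
      simp only [List.foldl_cons, map_sum, map_zsmul]
      exact ih fun σ₁ => T b (G σ₁)
  rw [basisD₂, e1, applyBoxes_eq_foldl, e3]
  refine Finset.sum_congr rfl fun σ₁ _ => ?_
  rw [e2, Finset.smul_sum]
  exact Finset.sum_congr rfl fun σ₂ _ => (mul_smul _ _ _).symm

end WheelPoly

open Classical in
theorem mainTheorem3 (n₁ n₂ : ℕ) (π₁ : NCMatching n₁) (π₂ : NCMatching n₂) :
    (∃! Ψ : NCMatching (n₁ + n₂) → WheelPoly.Pol (n₁ + n₂), WheelPoly.IsPsi Ψ) ∧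
    ∀ Ψ : NCMatching (n₁ + n₂) → WheelPoly.Pol (n₁ + n₂), WheelPoly.IsPsi Ψ →
      Ψ (NCMatching.rotate^[n₂] (π₁.concat π₂)) =
          MvPolynomial.rename (fun k => k + (n₂ : ZMod (2 * (n₁ + n₂)))) (Ψ (π₁.concat π₂)) ∧
        ∃ c : NCMatching n₁ → NCMatching n₂ → IntermediateField.adjoin ℚ {WheelPoly.q},
          c π₁ π₂ = 1 ∧
          Ψ (NCMatching.rotate^[n₂] (π₁.concat π₂)) =
            ∑ τ₁ with τ₁.young ≤ π₁.young, ∑ τ₂ with τ₂.young ≤ π₂.young,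
              (c τ₁ τ₂ : ℂ) • WheelPoly.basisD₂ τ₁ τ₂ := by
  obtain ⟨Φ, h0, h1, h2⟩ := WheelPoly.exists_exchange_family (n₁ + n₂)
  have hΦ := WheelPoly.isPsi_of_exchange h0 h1
  refine ⟨⟨Φ, hΦ, fun Ψ hΨ => hΨ.unique hΦ⟩, fun Ψ hΨ => ?_⟩
  obtain rfl : Ψ = Φ := hΨ.unique hΦ
  refine ⟨WheelPoly.apply_rotate_iterate h2 n₂ _, ?_⟩
  obtain ⟨A₁, hA₁, hA₁', hA₁''⟩ := NCMatching.exists_unitriangular n₁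
  obtain ⟨A₂, hA₂, hA₂', hA₂''⟩ := NCMatching.exists_unitriangular n₂
  obtain ⟨B₁, hB₁, hB₁', hB₁''⟩ := NCMatching.exists_unitriangular_inverse A₁ hA₁ hA₁'
  obtain ⟨B₂, hB₂, hB₂', hB₂''⟩ := NCMatching.exists_unitriangular_inverse A₂ hA₂ hA₂'
  have key := WheelPoly.basisD₂_eq_sum h0 h1 h2 hA₁'' hA₂''
  refine ⟨fun τ₁ τ₂ => ((B₁ π₁ τ₁ * B₂ π₂ τ₂ : ℤ) : _), by simp [hB₁, hB₂], ?_⟩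
  -- the coefficients vanish unless `τ₁ ≤ π₁` and `τ₂ ≤ π₂`
  have e1 : ∑ τ₁ with τ₁.young ≤ π₁.young, ∑ τ₂ with τ₂.young ≤ π₂.young,
      ((((B₁ π₁ τ₁ * B₂ π₂ τ₂ : ℤ) : IntermediateField.adjoin ℚ {WheelPoly.q}) : ℂ)) •
        WheelPoly.basisD₂ τ₁ τ₂ =
      ∑ τ₁, ∑ τ₂, (B₁ π₁ τ₁ * B₂ π₂ τ₂) • WheelPoly.basisD₂ τ₁ τ₂ := by
    have e2 : ∀ τ₁ τ₂,
        ((((B₁ π₁ τ₁ * B₂ π₂ τ₂ : ℤ) : IntermediateField.adjoin ℚ {WheelPoly.q}) : ℂ)) •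
          WheelPoly.basisD₂ τ₁ τ₂ = (B₁ π₁ τ₁ * B₂ π₂ τ₂) • WheelPoly.basisD₂ τ₁ τ₂ := by
      intro τ₁ τ₂
      rw [← Int.cast_smul_eq_zsmul ℂ]
      exact congrArg (· • _) 
        (map_intCast (algebraMap (IntermediateField.adjoin ℚ {WheelPoly.q}) ℂ) _)
    simp only [e2]
    rw [Finset.sum_filter_of_ne]
    · refine Finset.sum_congr rfl fun τ₁ _ => ?_
      rw [Finset.sum_filter_of_ne]
      intro τ₂ _ h
      exact hB₂' _ _ (right_ne_zero_of_mul (left_ne_zero_of_smul h))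
    · intro τ₁ _ h
      obtain ⟨τ₂, -, h⟩ := Finset.exists_ne_zero_of_sum_ne_zero h
      exact hB₁' _ _ (left_ne_zero_of_mul (left_ne_zero_of_smul h))
  rw [e1]
  have e3 : ∀ σ₁ σ₂, (∑ τ₁, B₁ π₁ τ₁ * A₁ τ₁ σ₁) * (∑ τ₂, B₂ π₂ τ₂ * A₂ τ₂ σ₂) =
      if σ₁ = π₁ ∧ σ₂ = π₂ then 1 else 0 := by
    intro σ₁ σ₂
    by_cases h3 : σ₁ = π₁
    · by_cases h4 : σ₂ = π₂
      · rw [h3, h4, (hB₁'' π₁).2, (hB₂'' π₂).2, if_pos ⟨rfl, rfl⟩, one_mul]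
      · rw [(hB₂'' π₂).1 _ h4, mul_zero, if_neg fun h => h4 h.2]
    · rw [(hB₁'' π₁).1 _ h3, zero_mul, if_neg fun h => h3 h.1]
  calc Ψ (NCMatching.rotate^[n₂] (π₁.concat π₂))
      = ∑ σ₁, ∑ σ₂, (if σ₁ = π₁ ∧ σ₂ = π₂ then (1 : ℤ) else 0) •
          Ψ (NCMatching.rotate^[n₂] (σ₁.concat σ₂)) := by
        simp [ite_and]
    _ = ∑ σ₁, ∑ σ₂, ∑ τ₁, ∑ τ₂, ((B₁ π₁ τ₁ * B₂ π₂ τ₂) * (A₁ τ₁ σ₁ * A₂ τ₂ σ₂)) •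
          Ψ (NCMatching.rotate^[n₂] (σ₁.concat σ₂)) := by
        refine Finset.sum_congr rfl fun σ₁ _ => Finset.sum_congr rfl fun σ₂ _ => ?_
        rw [← e3, Finset.sum_mul_sum, Finset.sum_smul]
        refine Finset.sum_congr rfl fun τ₁ _ => ?_
        rw [Finset.sum_smul]
        refine Finset.sum_congr rfl fun τ₂ _ => ?_
        rw [mul_mul_mul_comm]
    _ = ∑ τ₁, ∑ τ₂, ∑ σ₁, ∑ σ₂, ((B₁ π₁ τ₁ * B₂ π₂ τ₂) * (A₁ τ₁ σ₁ * A₂ τ₂ σ₂)) •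
          Ψ (NCMatching.rotate^[n₂] (σ₁.concat σ₂)) := by
        simp_rw [Finset.sum_comm (s := Finset.univ (α := NCMatching n₂))
          (t := Finset.univ (α := NCMatching n₁))]
        rw [Finset.sum_comm]
        refine Finset.sum_congr rfl fun τ₁ _ => ?_
        rw [Finset.sum_congr rfl fun σ₁ _ => Finset.sum_comm, Finset.sum_comm]
    _ = ∑ τ₁, ∑ τ₂, (B₁ π₁ τ₁ * B₂ π₂ τ₂) • WheelPoly.basisD₂ τ₁ τ₂ := by
        refine Finset.sum_congr rfl fun τ₁ _ => Finset.sum_congr rfl fun τ₂ _ => ?_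
        rw [key, Finset.smul_sum]
        refine Finset.sum_congr rfl fun σ₁ _ => ?_
        rw [Finset.smul_sum]
        exact Finset.sum_congr rfl fun σ₂ _ => mul_smul _ _ _
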